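/- **Setting.** Let $N, I_1, I_2\ge 1$, and let observation $n\in\{1,\dots,N\}$ be taken at level $i_1[n]\in\{1,\dots,I_1\}$ of a first factor and level $i_2[n]\in\{1,\dots,I_2\}$ of a second factor. Put $n_{ij}=\#\{n: i_1[n]=i,\ i_2[n]=j\}$, $p=I_1+I_2$ and $\bar n=2N/p$. The design has *balanced levels*: every level of factor $k$ carries exactly $N/I_k$ observations ($k=1,2$). Consider the Gaussian crossed effect model with parameters $\theta=(a^{(0)},a^{(1)},a^{(2)})\in\mathbb R\times\mathbb R^{I_1}\times\mathbb R^{I_2}$: independently $a^{(0)}\sim\mathcal N(\mu_{pr},\tau_{pr}^{-1})$ (the improper flat prior if $\tau_{pr}=0$), $a^{(k)}_i\sim\mathcal N(0,\tau_k^{-1})$, and, given $\theta$, independently $y_n\sim\mathcal N(a^{(0)}+a^{(1)}_{i_1[n]}+a^{(2)}_{i_2[n]},\tau^{-1})$, where $\gamma=(\tau,\tau_1,\tau_2)\in(0,\infty)^3$, $\mu_{pr}\in\mathbb R$ and $\tau_{pr}\in[0,\infty)$. For a Markov kernel $P$ with stationary law $\pi$, the *rate of convergence* is the infimum $\rho$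 of all $r\ge0$ such that $\|P^tf-\pi(f)\|_{L^2(\pi)}=O(r^t)$ for every $f\in L^2(\pi)$, and the *relaxation time* is $(1-\rho)^{-1}\in[1,\infty]$. Let $T_{aux}$ be the relaxation time of the two-component deterministic-scan Gibbs sampler on $\{1,\dots,I_1\}\times\{1,\dots,I_2\}$ whose target has probability mass function proportional to $n_{ij}$. Let $T_{cgs}$ be the relaxation time of the collapsed Gibbs sampler for the posterior $\mathcal L(\theta\mid y,\gamma)$, one iteration of which draws $(a^{(0)},a^{(1)})$ from its conditional posterior law given $a^{(2)}$ and then $(a^{(0)},a^{(2)})$ from its conditional posterior law given $a^{(1)}$. Each update is carried out exactly by the program that passes once through the $N$ observations to form, for each level of the factor being updated, the number of its observations and the sum of their residuals, then draws $a^{(0)}$ from its conditional law given the effects of the other factor, and then draws the effects of the updated factor independently, each from its full conditional law; the cost per iteration is the number of arithmetic operations, square roots, constant loads and standard normal draws that this program makes. Let $Cost(Gibbs)=(\text{cost per iteration})\times T_{cgs}$. **Theorem.** For every $\gamma$ there are constants $0<c,C<\infty$ depending only on $\gamma$ such that, for all $N,I_1,I_2\ge1$, all designs with balanced levels, all data $y\in\mathbb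 R^N$, and all $\mu_{pr}\in\mathbb R$, $\tau_{pr}\ge0$: the posterior is a proper probability distribution; for almost every current state $\theta$ under it, one run of the program from $\theta$ returns a draw from the transition law of the collapsed Gibbs sampler at $\theta$; and $$c\,\min\{\bar n,T_{aux}\}\le T_{cgs}\le C(1+\tau_{pr})\min\{\bar n,T_{aux}\},$$ $$c\,(2N+p)\min\{\bar n,T_{aux}\}\le Cost(Gibbs)\le C(1+\tau_{pr})\,(2N+p)\min\{\bar n,T_{aux}\}.$$ In particular, for the flat prior, or for any fixed $\tau_{pr}$, $Cost(Gibbs)=\Theta\big((2N+p)\min\{\bar n,T_{aux}\}\big)$. -/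

import Mathlib

open MeasureTheory ProbabilityTheory
open scoped NNReal ENNReal

noncomputable section

namespace CrossedEffects

/-! ### Markov chains: rate of convergence, relaxation time, Gibbs sampling -/

/-- The `L²(π)` rate of convergence of a Markov chain with transition kernel `P` and stationary
law `π`: the infimum of all `r` such that, for every square-integrable `f`,
`‖Pᵗ f - π(f)‖_{L²(π)} = O(rᵗ)`. -/
def l2Rate {Ω : Type*} [MeasurableSpace Ω] (P : Kernel Ω Ω) (π : Measure Ω) : ℝ≥0∞ :=
  sInf {r : ℝ≥0∞ | ∀ f : Ω → ℝ, MemLp f 2 π → ∃ C : ℝ≥0, ∀ t : ℕ,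
    eLpNorm (fun x => (∫ z, f z ∂((P ^ t) x)) - ∫ z, f z ∂π) 2 π ≤ C * r ^ t}

/-- The relaxation time: the reciprocal of one minus the rate of convergence. It is `∞` when the
rate is `1`. -/
def relaxationTime {Ω : Type*} [MeasurableSpace Ω] (P : Kernel Ω Ω) (π : Measure Ω) : ℝ≥0∞ :=
  (1 - l2Rate P π)⁻¹

/-- One exact block update of a Gibbs sampler targeting `π`: from the current state `ω`, draw a
new state from the conditional law under `π` of the state given the retained coordinates `X`,
at the value `X ω`. -/
def blockUpdate {Ω β : Type*} [MeasurableSpace Ω] [StandardBorelSpace Ω] [Nonempty Ω]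
    [MeasurableSpace β] (π : Measure Ω) [IsFiniteMeasure π] (X : Ω → β) (hX : Measurable X) :
    Kernel Ω Ω :=
  (condDistrib id X π).comap X hX

/-- Two-block deterministic-scan Gibbs sampler: one iteration first updates everything but `X`,
then everything but `Y`. -/
def twoBlockGibbs {Ω β β' : Type*} [MeasurableSpace Ω] [StandardBorelSpace Ω] [Nonempty Ω]
    [MeasurableSpace β] [MeasurableSpace β'] (π : Measure Ω) [IsFiniteMeasure π]
    (X : Ω → β) (hX : Measurable X) (Y : Ω → β') (hY : Measurable Y) : Kernel Ω Ω :=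
  blockUpdate π Y hY ∘ₖ blockUpdate π X hX

/-! ### The design -/

/-- A two-factor design: observation `n` is taken at level `lev₁ n` of the first factor and at
level `lev₂ n` of the second. -/
structure Design (N I₁ I₂ : ℕ) where
  lev₁ : Fin N → Fin I₁
  lev₂ : Fin N → Fin I₂

variable {N I₁ I₂ : ℕ}

/-- Number of observations at level `i` of the first factor. -/
def Design.occ₁ (D : Design N I₁ I₂) (i : Fin I₁) : ℕ := ∑ n : Fin N, if D.lev₁ n = i then 1 else 0

/-- Number of observations at level `j` of the second factor. -/
def Design.occ₂ (D : Design N I₁ I₂) (j : Fin I₂) : ℕ := ∑ n : Fin N, if D.lev₂ n = j then 1 else 0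

/-- Co-occurrence counts: the number of observations in cell `(i, j)`. -/
def Design.cooc (D : Design N I₁ I₂) (i : Fin I₁) (j : Fin I₂) : ℕ :=
  ∑ n : Fin N, if D.lev₁ n = i ∧ D.lev₂ n = j then 1 else 0

/-- Balanced levels. -/
def Design.Balanced (D : Design N I₁ I₂) : Prop :=
  (∀ i, (D.occ₁ i : ℝ) = (N : ℝ) / I₁) ∧ (∀ j, (D.occ₂ j : ℝ) = (N : ℝ) / I₂)

/-- The average number of observations per factor level, `K N / p` with `K = 2`, `p = I₁ + I₂`. -/
def nbar (N I₁ I₂ : ℕ) : ℝ≥0 := 2 * N / (I₁ + I₂)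

/-! ### The auxiliary Gibbs sampler -/

/-- The law on cells with probability mass function proportional to the co-occurrence counts. -/
def Design.auxTarget (D : Design N I₁ I₂) : Measure (Fin I₁ × Fin I₂) :=
  cond (Measure.count.withDensity fun x => (D.cooc x.1 x.2 : ℝ≥0∞)) Set.univ

instance (D : Design N I₁ I₂) : IsFiniteMeasure D.auxTarget := by
  unfold Design.auxTarget; infer_instance

/-- The auxiliary sampler: update the first component given the second, then the second given
the first. -/
def Design.auxGibbs [NeZero I₁] [NeZero I₂] (D : Design N I₁ I₂) :
    Kernel (Fin I₁ × Fin I₂) (Fin I₁ × Fin I₂) :=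
  twoBlockGibbs D.auxTarget Prod.snd measurable_snd Prod.fst measurable_fst

/-- Relaxation time of the auxiliary sampler. -/
def Design.Taux [NeZero I₁] [NeZero I₂] (D : Design N I₁ I₂) : ℝ≥0∞ :=
  relaxationTime D.auxGibbs D.auxTarget

/-! ### The crossed effect model with Gaussian likelihood -/

/-- The variance parameters `γ`, as precisions: `τ` of the likelihood, `τ₁`, `τ₂` of the
effects of the two factors. -/
structure Precisions where
  τ : ℝ≥0
  τ₁ : ℝ≥0
  τ₂ : ℝ≥0

/-- The regression parameters `(a⁰, a¹, a²)`. -/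
abbrev Param (I₁ I₂ : ℕ) : Type := ℝ × (Fin I₁ → ℝ) × (Fin I₂ → ℝ)

/-- Prior of the global effect: normal with mean `μpr` and precision `τpr`, where `τpr = 0` is
the improper flat prior. -/
def globalPrior (μpr : ℝ) (τpr : ℝ≥0) : Measure ℝ :=
  if τpr = 0 then volume else gaussianReal μpr τpr⁻¹

/-- Prior of all parameters: independent, with `aᵏᵢ` normal with mean zero and precision `τₖ`. -/
def prior (I₁ I₂ : ℕ) (γ : Precisions) (μpr : ℝ) (τpr : ℝ≥0) : Measure (Param I₁ I₂) :=
  (globalPrior μpr τpr).prod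
    ((Measure.pi fun _ => gaussianReal 0 γ.τ₁⁻¹).prod (Measure.pi fun _ => gaussianReal 0 γ.τ₂⁻¹))

/-- Linear predictor of observation `n`. -/
def Design.predictor (D : Design N I₁ I₂) (θ : Param I₁ I₂) (n : Fin N) : ℝ :=
  θ.1 + θ.2.1 (D.lev₁ n) + θ.2.2 (D.lev₂ n)

/-- Likelihood: given `θ`, the observations are independent and normal with mean the linear
predictor and precision `τ`. -/
def Design.likelihood (D : Design N I₁ I₂) (γ : Precisions) (y : Fin N → ℝ)
    (θ : Param I₁ I₂) : ℝ≥0∞ :=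
  ∏ n, gaussianPDF (D.predictor θ n) γ.τ⁻¹ (y n)

/-- Posterior of `θ` given the data `y` and the precisions (Bayes' rule). -/
def Design.posterior (D : Design N I₁ I₂) (γ : Precisions) (μpr : ℝ) (τpr : ℝ≥0)
    (y : Fin N → ℝ) : Measure (Param I₁ I₂) :=
  cond ((prior I₁ I₂ γ μpr τpr).withDensity (D.likelihood γ y)) Set.univ

instance (D : Design N I₁ I₂) (γ : Precisions) (μpr : ℝ) (τpr : ℝ≥0) (y : Fin N → ℝ) :
    IsFiniteMeasure (D.posterior γ μpr τpr y) := by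
  unfold Design.posterior; infer_instance

/-- The collapsed Gibbs sampler: update `(a⁰, a¹)` given `a²`, then `(a⁰, a²)` given `a¹`, each
from its exact conditional posterior law. -/
def Design.collapsedGibbs (D : Design N I₁ I₂) (γ : Precisions) (μpr : ℝ) (τpr : ℝ≥0)
    (y : Fin N → ℝ) : Kernel (Param I₁ I₂) (Param I₁ I₂) :=
  twoBlockGibbs (D.posterior γ μpr τpr y)
    (fun θ => θ.2.2) (measurable_snd.comp measurable_snd)
    (fun θ => θ.2.1) (measurable_fst.comp measurable_snd)

/-- Relaxation time of the collapsed Gibbs sampler. -/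
def Design.Tcgs (D : Design N I₁ I₂) (γ : Precisions) (μpr : ℝ) (τpr : ℝ≥0)
    (y : Fin N → ℝ) : ℝ≥0∞ :=
  relaxationTime (D.collapsedGibbs γ μpr τpr y) (D.posterior γ μpr τpr y)

/-! ### Cost model: straight-line programs over real registers

Every instruction costs one step: an arithmetic operation, a square root, loading a constant, or
a draw of an independent standard normal variable. -/

/-- Instructions with registers in `R`; the first argument is the target register. -/
inductive Instr (R : Type) where
  | const (d : R) (c : ℝ)
  | add (d a b : R)
  | sub (d a b : R)
  | mul (d a b : R)
  | div (d a b : R)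
  | sqrt (d a : R)
  | gauss (d : R)

section Semantics

variable {R : Type} [DecidableEq R]

/-- Assign to register `d` the value `g s` computed from the current memory `s`. -/
def assign (d : R) (g : (R → ℝ) → ℝ) (hg : Measurable g) : Kernel (R → ℝ) (R → ℝ) :=
  Kernel.deterministic (fun s => Function.update s d (g s)) (by
    refine measurable_pi_iff.2 fun r => ?_
    by_cases h : r = d
    · subst h; simpa using hg
    · simpa [Function.update_of_ne h] using measurable_pi_apply r)

/-- The random effect of one instruction on the memory. -/
def Instr.step : Instr R → Kernel (R → ℝ) (R → ℝ)
  | .const d c => assign d (fun _ => c) measurable_const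
  | .add d a b => assign d (fun s => s a + s b) (by fun_prop)
  | .sub d a b => assign d (fun s => s a - s b) (by fun_prop)
  | .mul d a b => assign d (fun s => s a * s b) (by fun_prop)
  | .div d a b => assign d (fun s => s a / s b) (by fun_prop)
  | .sqrt d a => assign d (fun s => √(s a)) (by fun_prop)
  | .gauss d => (Kernel.id ×ₖ Kernel.const _ (gaussianReal 0 1)).map
      fun x : (R → ℝ) × ℝ => Function.update x.1 d x.2

/-- The random effect of a program: its instructions are executed from left to right. -/
def exec : List (Instr R) → Kernel (R → ℝ) (R → ℝ)
  | [] => Kernel.id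
  | i :: p => exec p ∘ₖ i.step

/-- The number of steps of a program. -/
def steps (p : List (Instr R)) : ℕ := p.length

end Semantics

/-! ### One iteration of the collapsed Gibbs sampler as a program -/

/-- The registers: the data, the parameters, for each level a residual sum and an observation
count, and finitely many scalars. -/
inductive Reg (N I₁ I₂ : ℕ) where
  | data (n : Fin N)
  | a₀
  | a₁ (i : Fin I₁)
  | a₂ (j : Fin I₂)
  | sum₁ (i : Fin I₁)
  | sum₂ (j : Fin I₂)
  | cnt₁ (i : Fin I₁)
  | cnt₂ (j : Fin I₂)
  | lik
  | fac
  | one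
  | prec
  | lin
  | u
  | v
  | z
  deriving DecidableEq

open Instr Reg in
/-- Program for the joint update of `a⁰` and the effects `a` of one factor (levels `lev`, prior
precision `τk`), given the effects `b` of the other factor (levels `lev'`). With `cᵢ` the number
of observations at level `i` and `sᵢ` the sum of their values of `y - b`, it draws `a⁰` from the
normal law with precision `τpr + ∑ᵢ cᵢ wᵢ` and mean `(τpr μpr + ∑ᵢ wᵢ sᵢ) / (τpr + ∑ᵢ cᵢ wᵢ)`,
where `wᵢ = τ τk / (τk + cᵢ τ)`, and then, independently over `i`, draws `aᵢ` from the normal law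
with precision `τk + cᵢ τ` and mean `τ (sᵢ - cᵢ a⁰) / (τk + cᵢ τ)`. -/
def blockProgram {I J : ℕ} (lev : Fin N → Fin I) (lev' : Fin N → Fin J)
    (a sum cnt : Fin I → Reg N I₁ I₂) (b : Fin J → Reg N I₁ I₂)
    (τ τk μpr τpr : ℝ) : List (Instr (Reg N I₁ I₂)) :=
  -- load the hyperparameters, reset the accumulators
  [const lik τ, const fac τk, const one 1, const prec τpr, const lin μpr, mul lin lin prec]
  ++ (List.finRange I).flatMap (fun i => [const (sum i) 0, const (cnt i) 0])
  -- one pass through the data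
  ++ (List.finRange N).flatMap (fun n =>
      [sub v (data n) (b (lev' n)),
       add (sum (lev n)) (sum (lev n)) v,
       add (cnt (lev n)) (cnt (lev n)) one])
  -- accumulate precision and linear coefficient of the global effect
  ++ (List.finRange I).flatMap (fun i =>
      [mul u (cnt i) lik, add u u fac, div u fac u, mul u u lik,
       mul v u (sum i), add lin lin v,
       mul v u (cnt i), add prec prec v])
  -- draw the global effect
  ++ [gauss z, sqrt u prec, div z z u, div v lin prec, add a₀ v z]
  -- draw the effects of the factor
  ++ (List.finRange I).flatMap (fun i =>
      [mul u (cnt i) lik, add u u fac,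
       mul v (cnt i) a₀, sub v (sum i) v, mul v v lik, div v v u,
       gauss z, sqrt u u, div z z u, add (a i) v z])

/-- Program for one iteration of the collapsed Gibbs sampler. -/
def Design.iteration (D : Design N I₁ I₂) (γ : Precisions) (μpr : ℝ) (τpr : ℝ≥0) :
    List (Instr (Reg N I₁ I₂)) :=
  blockProgram D.lev₁ D.lev₂ Reg.a₁ Reg.sum₁ Reg.cnt₁ Reg.a₂ γ.τ γ.τ₁ μpr τpr
  ++ blockProgram D.lev₂ D.lev₁ Reg.a₂ Reg.sum₂ Reg.cnt₂ Reg.a₁ γ.τ γ.τ₂ μpr τpr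

/-- Initial memory: data and current parameters, every other register zero. -/
def loadMem (y : Fin N → ℝ) (θ : Param I₁ I₂) : Reg N I₁ I₂ → ℝ
  | .data n => y n
  | .a₀ => θ.1
  | .a₁ i => θ.2.1 i
  | .a₂ j => θ.2.2 j
  | _ => 0

/-- The parameters held in memory. -/
def readParam (s : Reg N I₁ I₂ → ℝ) : Param I₁ I₂ :=
  (s .a₀, fun i => s (.a₁ i), fun j => s (.a₂ j))

/-- The law of the new parameters after running the program for one iteration from `θ`. -/
def Design.iterationLaw (D : Design N I₁ I₂) (γ : Precisions) (μpr : ℝ) (τpr : ℝ≥0)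
    (y : Fin N → ℝ) (θ : Param I₁ I₂) : Measure (Param I₁ I₂) :=
  (exec (D.iteration γ μpr τpr) (loadMem y θ)).map readParam

/-- Complexity of the collapsed Gibbs sampler: cost per iteration times relaxation time. -/
def Design.costGibbs (D : Design N I₁ I₂) (γ : Precisions) (μpr : ℝ) (τpr : ℝ≥0)
    (y : Fin N → ℝ) : ℝ≥0∞ :=
  (steps (D.iteration γ μpr τpr) : ℝ≥0∞) * D.Tcgs γ μpr τpr y

end CrossedEffects

end

/-!
Running two copies of the chain with the same Gaussian noise, the difference of their second-factor
effects evolves by a deterministic linear map. For balanced levels this map leaves the effects with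
mean zero and the constant effects invariant: on the former it is the product of two shrinkage
factors with the round trip through the levels of the first factor, on the latter it is a scalar.
The rate of the auxiliary sampler is the largest eigenvalue `l` of the round trip on mean-zero
functions. Hence the linear functional given by an eigenvector bounds the rate of the collapsed
sampler from below by the shrinkage factors times `l`, and the contraction of smooth compactly
supported functions, which are dense in `L²`, bounds it from above by the norm of the linear map.
Since each shrinkage factor differs from `1` by a quantity of the order of the inverse of the number
of observations per level, one minus the rate is comparable to `max {1 / n̄, 1 - l}`.
-/

open MeasureTheory ProbabilityTheory
open scoped NNReal ENNReal BigOperators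

noncomputable section

namespace CrossedEffects

/-! ### Alternating projections in a Hilbert space -/

section Hilbert

open scoped InnerProductSpace

theorem le_of_forall_mul_pow_le {a k r C : ℝ} (ha : 0 < a) (hr : 0 ≤ r)
    (h : ∀ t : ℕ, a * k ^ t ≤ C * r ^ t) : k ≤ r := by
  by_contra! hk
  have hk0 : 0 < k := hr.trans_lt hk
  have hlim := (tendsto_pow_atTop_nhds_zero_of_lt_one (div_nonneg hr hk0.le)
    ((div_lt_one hk0).2 hk)).const_mul C
  rw [mul_zero] at hlim
  obtain ⟨t, ht⟩ := (hlim.eventually (gt_mem_nhds ha)).exists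
  rw [div_pow, ← mul_div_assoc, div_lt_iff₀ (pow_pos hk0 t)] at ht
  exact absurd (h t) (not_le.2 ht)

theorem mul_mul_pow_succ {M : Type*} [Monoid M] {p q : M} (hq : IsIdempotentElem q)
    (t : ℕ) : (q * p * q) ^ (t + 1) = q * (p * q) ^ (t + 1) := by
  induction t with
  | zero => simp only [zero_add, pow_one, mul_assoc]
  | succ t ih =>
    calc (q * p * q) ^ (t + 2) = q * p * (q * q) * (p * q) ^ (t + 1) := by
          rw [pow_succ', ih]; simp only [mul_assoc]
      _ = q * (p * q) ^ (t + 2) := by rw [hq.eq, pow_succ' _ (t + 1)]; simp only [mul_assoc]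

variable {H : Type*} [NormedAddCommGroup H] [InnerProductSpace ℝ H] {A p q : H →L[ℝ] H}

theorem norm_pow_succ_apply_sq_le (hA : A.IsSymmetric) (x : H) (t : ℕ) :
    ‖(A ^ (t + 1)) x‖ ^ 2 ≤ ‖(A ^ t) x‖ * ‖(A ^ (t + 2)) x‖ := by
  have hsucc (s : ℕ) : (A ^ (s + 1)) x = A ((A ^ s) x) := by rw [pow_succ', mul_apply_eq_comp]
  calc ‖(A ^ (t + 1)) x‖ ^ 2 = ⟪(A ^ t) x, (A ^ (t + 2)) x⟫_ℝ := by
        rw [← real_inner_self_eq_norm_sq, hsucc (t + 1), ← hA.apply_clm, ← hsucc]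
    _ ≤ _ := real_inner_le_norm _ _

theorem norm_apply_mul_norm_pow_le (hA : A.IsSymmetric) (x : H) (t : ℕ) :
    ‖A x‖ * ‖(A ^ t) x‖ ≤ ‖x‖ * ‖(A ^ (t + 1)) x‖ := by
  induction t with
  | zero => simp [mul_comm]
  | succ t ih =>
    rcases (norm_nonneg ((A ^ t) x)).eq_or_lt with h0 | h0
    · have : (A ^ (t + 1)) x = 0 := by
        rw [pow_succ', mul_apply_eq_comp, norm_eq_zero.1 h0.symm, map_zero]
      rw [this, norm_zero, mul_zero]
      positivity
    · refine le_of_mul_le_mul_left ?_ h0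
      calc ‖(A ^ t) x‖ * (‖A x‖ * ‖(A ^ (t + 1)) x‖)
          = ‖A x‖ * ‖(A ^ t) x‖ * ‖(A ^ (t + 1)) x‖ := by ring
        _ ≤ ‖x‖ * ‖(A ^ (t + 1)) x‖ * ‖(A ^ (t + 1)) x‖ := by gcongr
        _ = ‖x‖ * ‖(A ^ (t + 1)) x‖ ^ 2 := by ring
        _ ≤ ‖x‖ * (‖(A ^ t) x‖ * ‖(A ^ (t + 2)) x‖) := by
          gcongr; exact norm_pow_succ_apply_sq_le hA x t
        _ = _ := by ring

theorem norm_apply_le_of_norm_pow_succ_le (hA : A.IsSymmetric) {r C : ℝ}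
    (hr : 0 ≤ r) {x : H} (h : ∀ t : ℕ, ‖(A ^ (t + 1)) x‖ ≤ C * r ^ t) : ‖A x‖ ≤ r * ‖x‖ := by
  rcases (norm_nonneg (A x)).eq_or_lt with h0 | h0
  · rw [← h0]; positivity
  have hx : 0 < ‖x‖ := norm_pos_iff.2 fun hx => h0.ne' (by rw [hx, map_zero, norm_zero])
  have hgrowth (t : ℕ) : ‖A x‖ * (‖A x‖ / ‖x‖) ^ t ≤ ‖(A ^ (t + 1)) x‖ := by
    induction t with
    | zero => simp
    | succ t ih =>
      calc ‖A x‖ * (‖A x‖ / ‖x‖) ^ (t + 1)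
          = ‖A x‖ / ‖x‖ * (‖A x‖ * (‖A x‖ / ‖x‖) ^ t) := by ring
        _ ≤ ‖A x‖ / ‖x‖ * ‖(A ^ (t + 1)) x‖ := by gcongr
        _ ≤ ‖(A ^ (t + 2)) x‖ := by
          rw [div_mul_eq_mul_div, div_le_iff₀ hx, mul_comm _ ‖x‖]
          exact norm_apply_mul_norm_pow_le hA x (t + 1)
  rw [← div_le_iff₀ hx]
  exact le_of_forall_mul_pow_le h0 hr fun t => (hgrowth t).trans (h t)

variable [CompleteSpace H]

theorem norm_apply_le_of_isStarProjection (hp : IsStarProjection p) (x : H) : ‖p x‖ ≤ ‖x‖ := by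
  obtain ⟨K, _, rfl⟩ := isStarProjection_iff_eq_starProjection.1 hp
  exact K.norm_starProjection_apply_le x

/-- The symmetric operator `q p q` inherits the decay of `(p q)ᵗ`, and for a symmetric operator
decay of an orbit at rate `r` bounds the first step by `r`, with no constant. -/
theorem norm_mul_mul_apply_le_of_dense (hp : IsStarProjection p) (hq : IsStarProjection q)
    {r : ℝ} (hr : 0 ≤ r) {D : Set H} (hD : Dense D)
    (hdecay : ∀ g ∈ D, ∃ C : ℝ, ∀ t : ℕ, ‖((p * q) ^ (t + 1)) g‖ ≤ C * r ^ t) (f : H) :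
    ‖q (p (q f))‖ ≤ r * ‖f‖ := by
  have hclosed : IsClosed {g : H | ‖q (p (q g))‖ ≤ r * ‖g‖} :=
    isClosed_le (by fun_prop) (by fun_prop)
  refine hclosed.closure_subset_iff.2 (fun g hg => ?_) (hD f)
  obtain ⟨C, hC⟩ := hdecay g hg
  have hp' := (ContinuousLinearMap.IsStarProjection.isSymmetricProjection hp).isSymmetric
  have hq' := (ContinuousLinearMap.IsStarProjection.isSymmetricProjection hq).isSymmetric
  refine norm_apply_le_of_norm_pow_succ_le (A := q * p * q) (C := C)
    (fun x y => (hq' _ _).trans ((hp' _ _).trans (hq' _ _))) hr fun t => ?_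
  rw [mul_mul_pow_succ hq.isIdempotentElem]
  exact (norm_apply_le_of_isStarProjection hq _).trans (hC t)

theorem norm_mul_pow_succ_apply_le_of_dense (hp : IsStarProjection p) (hq : IsStarProjection q)
    {r : ℝ} (hr : 0 ≤ r) {D : Set H} (hD : Dense D)
    (hdecay : ∀ g ∈ D, ∃ C : ℝ, ∀ t : ℕ, ‖((p * q) ^ (t + 1)) g‖ ≤ C * r ^ t) (f : H) (t : ℕ) :
    ‖((p * q) ^ (t + 1)) f‖ ≤ r ^ t * ‖f‖ := by
  have hqq (x : H) : q (q x) = q x := DFunLike.congr_fun hq.isIdempotentElem.eq x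
  have hqpow (s : ℕ) : ‖q (((p * q) ^ s) f)‖ ≤ r ^ s * ‖f‖ := by
    induction s with
    | zero => simpa using norm_apply_le_of_isStarProjection hq f
    | succ s ih =>
      calc ‖q (((p * q) ^ (s + 1)) f)‖ = ‖q (p (q (q (((p * q) ^ s) f))))‖ := by
            rw [pow_succ', hqq]; rfl
        _ ≤ r * ‖q (((p * q) ^ s) f)‖ := norm_mul_mul_apply_le_of_dense hp hq hr hD hdecay _
        _ ≤ r * (r ^ s * ‖f‖) := by gcongr
        _ = r ^ (s + 1) * ‖f‖ := by ring
  rw [pow_succ', mul_apply_eq_comp]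
  exact (norm_apply_le_of_isStarProjection hp _).trans (hqpow t)

end Hilbert

/-! ### Kernels with an invariant measure -/

section Invariant

variable {Ω : Type*} [MeasurableSpace Ω] {π : Measure Ω} {κ η : Kernel Ω Ω}

theorem ae_ae_of_invariant (h : κ.Invariant π) {p : Ω → Prop} (hp : ∀ᵐ x ∂π, p x) :
    ∀ᵐ x ∂π, ∀ᵐ z ∂(κ x), p z :=
  Measure.ae_ae_of_ae_comp (κ := κ) (by rwa [h.def])

theorem invariant_pow (h : κ.Invariant π) (t : ℕ) : (κ ^ t).Invariant π := by
  induction t with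
  | zero => exact Measure.id_comp
  | succ t ih => rw [pow_succ]; exact ih.comp h

theorem pow_ae_eq (h : κ.Invariant π) (hκη : ∀ᵐ x ∂π, κ x = η x) (t : ℕ) :
    ∀ᵐ x ∂π, (κ ^ t) x = (η ^ t) x := by
  induction t with
  | zero => simp
  | succ t ih =>
    filter_upwards [hκη, ae_ae_of_invariant h ih] with x hx hx'
    change ((κ ^ t) ∘ₖ κ) x = ((η ^ t) ∘ₖ η) x
    rw [Kernel.comp_apply, Kernel.comp_apply, ← hx]
    exact Measure.comp_congr hx'

theorem ae_integrable_of_invariant (h : κ.Invariant π) {f : Ω → ℝ} (hf : Integrable f π) :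
    ∀ᵐ x ∂π, Integrable f (κ x) :=
  Measure.ae_integrable_of_integrable_comp (κ := κ) (by rwa [h.def])

theorem integral_pow_zero (κ : Kernel Ω Ω) {f : Ω → ℝ} (hf : AEStronglyMeasurable f π) :
    ∀ᵐ x ∂π, ∫ z, f z ∂((κ ^ 0) x) = f x := by
  have hid : (Kernel.id : Kernel Ω Ω).Invariant π := Measure.id_comp
  filter_upwards [ae_ae_of_invariant hid hf.ae_eq_mk, hf.ae_eq_mk] with x hx hx'
  change ∫ z, f z ∂(Kernel.id x) = _
  rw [integral_congr_ae hx, hx', Kernel.id_apply, integral_dirac' _ _ hf.stronglyMeasurable_mk]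

theorem integral_pow_succ (h : κ.Invariant π) {f : Ω → ℝ} (hf : Integrable f π) (t : ℕ) :
    ∀ᵐ x ∂π, ∫ z, f z ∂((κ ^ (t + 1)) x) = ∫ w, ∫ z, f z ∂((κ ^ t) w) ∂(κ x) := by
  filter_upwards [ae_integrable_of_invariant (invariant_pow h (t + 1)) hf] with x hx
  rw [pow_succ] at hx ⊢
  exact Kernel.integral_comp hx

theorem integral_integral_of_invariant [SFinite π] [IsSFiniteKernel κ] (h : κ.Invariant π)
    {f : Ω → ℝ} (hf : Integrable f π) : ∫ x, ∫ z, f z ∂(κ x) ∂π = ∫ z, f z ∂π := by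
  have hcomp := Kernel.integral_comp (κ := Kernel.const Unit π) (η := κ) (a := ()) (f := f)
    (by rwa [← Measure.comp_eq_comp_const_apply, h.def])
  rwa [← Measure.comp_eq_comp_const_apply, h.def, Kernel.const_apply, eq_comm] at hcomp

theorem invariant_congr (h : κ.Invariant π) (hκη : ∀ᵐ x ∂π, κ x = η x) : η.Invariant π := by
  rw [Kernel.Invariant, ← Measure.comp_congr hκη]
  exact h

end Invariant

/-! ### The rate of convergence -/

section Rate

variable {Ω : Type*} [MeasurableSpace Ω] {π : Measure Ω} {κ η : Kernel Ω Ω}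

theorem l2Rate_congr (h : κ.Invariant π) (hκη : ∀ᵐ x ∂π, κ x = η x) :
    l2Rate κ π = l2Rate η π := by
  have hnorm (f : Ω → ℝ) (t : ℕ) :
      eLpNorm (fun x => (∫ z, f z ∂((κ ^ t) x)) - ∫ z, f z ∂π) 2 π
        = eLpNorm (fun x => (∫ z, f z ∂((η ^ t) x)) - ∫ z, f z ∂π) 2 π := by
    refine eLpNorm_congr_ae ?_
    filter_upwards [pow_ae_eq h hκη t] with x hx
    rw [hx]
  simp only [l2Rate, hnorm]

theorem l2Rate_le_of_eLpNorm_succ_le [IsFiniteMeasure π] {r : ℝ≥0}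
    (h : ∀ f : Ω → ℝ, MemLp f 2 π → ∃ C : ℝ≥0, ∀ t : ℕ,
      eLpNorm (fun x => (∫ z, f z ∂((κ ^ (t + 1)) x)) - ∫ z, f z ∂π) 2 π ≤ C * (r : ℝ≥0∞) ^ t) :
    l2Rate κ π ≤ r := by
  refine ENNReal.le_of_forall_pos_le_add fun ε hε _ => sInf_le fun f hf => ?_
  have : 0 < r + ε := by positivity
  obtain ⟨C, hC⟩ := h f hf
  have hf0 : MemLp (fun x => (∫ z, f z ∂((κ ^ 0) x)) - ∫ z, f z ∂π) 2 π := by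
    refine (hf.sub (memLp_const (∫ z, f z ∂π))).ae_eq ?_
    filter_upwards [integral_pow_zero κ hf.aestronglyMeasurable] with x hx
    rw [hx, Pi.sub_apply]
  lift eLpNorm (fun x => (∫ z, f z ∂((κ ^ 0) x)) - ∫ z, f z ∂π) 2 π to ℝ≥0
    using hf0.eLpNorm_ne_top with C₀ hC₀
  refine ⟨C₀ + C / (r + ε), fun t => ?_⟩
  cases t with
  | zero => rw [← hC₀]; norm_cast; simp
  | succ t =>
    refine (hC t).trans ?_
    norm_cast
    calc C * r ^ t ≤ C * (r + ε) ^ t := by gcongr; exact le_self_add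
      _ = C / (r + ε) * (r + ε) ^ (t + 1) := by field_simp; ring
      _ ≤ (C₀ + C / (r + ε)) * (r + ε) ^ (t + 1) := by gcongr; exact le_add_self

variable [IsProbabilityMeasure π] [IsMarkovKernel κ] {f : Ω → ℝ} {m c : ℝ}

theorem integral_pow_sub_integral_of_affine (h : κ.Invariant π) (hf : Integrable f π)
    (hκ : ∀ᵐ x ∂π, ∫ z, f z ∂(κ x) = m * f x + c) (t : ℕ) :
    ∀ᵐ x ∂π, ∫ z, f z ∂((κ ^ t) x) - ∫ z, f z ∂π = m ^ t * (f x - ∫ z, f z ∂π) := by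
  set M := ∫ z, f z ∂π with hM
  have hmean : M = m * M + c := by
    have hint := integral_integral_of_invariant h hf
    rw [integral_congr_ae hκ, integral_add (hf.const_mul _) (integrable_const _),
      integral_const_mul, ← hM] at hint
    simpa using hint.symm
  induction t with
  | zero =>
    filter_upwards [integral_pow_zero κ hf.aestronglyMeasurable] with x hx
    rw [hx, pow_zero, one_mul]
  | succ t ih =>
    filter_upwards [hκ, integral_pow_succ h hf t, ae_ae_of_invariant h ih,
      ae_integrable_of_invariant h hf] with x hx hsucc hpow hint
    have hpow' : ∀ᵐ w ∂(κ x), ∫ z, f z ∂((κ ^ t) w) = m ^ t * (f w - M) + M := by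
      filter_upwards [hpow] with w hw
      linarith
    have hint' : Integrable (fun w => f w - M) (κ x) := hint.sub (integrable_const _)
    rw [hsucc, integral_congr_ae hpow', integral_add (hint'.const_mul _) (integrable_const _),
      integral_const_mul, integral_sub hint (integrable_const _), hx]
    simp only [integral_const, probReal_univ, one_smul]
    linear_combination (-m ^ t) * hmean

/-- An observable that the kernel maps to an affine image of itself is, up to centring, an
eigenfunction with eigenvalue `m`. -/
theorem le_l2Rate_of_affine (h : κ.Invariant π) (hf : MemLp f 2 π)
    (hκ : ∀ᵐ x ∂π, ∫ z, f z ∂(κ x) = m * f x + c) (hne : ¬ ∀ᵐ x ∂π, f x = ∫ z, f z ∂π) :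
    ENNReal.ofReal m ≤ l2Rate κ π := by
  set M := ∫ z, f z ∂π
  have hfM : MemLp (fun x => f x - M) 2 π := hf.sub (memLp_const M)
  have hpos : 0 < (eLpNorm (fun x => f x - M) 2 π).toReal := by
    refine ENNReal.toReal_pos (fun h0 => hne ?_) hfM.eLpNorm_ne_top
    rw [eLpNorm_eq_zero_iff hfM.aestronglyMeasurable (by norm_num)] at h0
    filter_upwards [h0] with x hx
    simpa [sub_eq_zero] using hx
  refine le_sInf fun r hrate => ?_
  obtain ⟨C, hC⟩ := hrate f hf
  rcases eq_or_ne r ∞ with rfl | hr'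
  · exact le_top
  lift r to ℝ≥0 using hr'
  refine ENNReal.ofReal_le_of_le_toReal ((le_abs_self m).trans ?_)
  refine le_of_forall_mul_pow_le (C := C) hpos r.2 fun t => ?_
  have hnorm : eLpNorm (fun x => f x - M) 2 π * ENNReal.ofReal |m| ^ t
      = eLpNorm (fun x => (∫ z, f z ∂((κ ^ t) x)) - M) 2 π := by
    rw [eLpNorm_congr_ae (integral_pow_sub_integral_of_affine h
      (hf.integrable (by norm_num)) hκ t)]
    have hsmul := eLpNorm_const_smul (m ^ t) (fun x => f x - M) 2 π
    simp only [Pi.smul_def, smul_eq_mul] at hsmul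
    rw [hsmul, mul_comm, enorm_pow, Real.enorm_eq_ofReal_abs]
  have hle := ENNReal.toReal_mono (by finiteness) (hnorm.trans_le (hC t))
  simpa [ENNReal.toReal_ofReal (abs_nonneg m)] using hle

end Rate

/-! ### The two-block Gibbs sampler as a product of projections -/

section TwoBlockGibbs

theorem dense_toLp {Ω : Type*} [MeasurableSpace Ω] {π : Measure Ω} {D : Set (Ω → ℝ)}
    (hD : ∀ f ∈ D, MemLp f 2 π)
    (hdense : ∀ f : Ω → ℝ, MemLp f 2 π → ∀ ε : ℝ, 0 < ε →
      ∃ g ∈ D, eLpNorm (f - g) 2 π ≤ ENNReal.ofReal ε) :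
    Dense {F : Lp ℝ 2 π | ∃ g, ∃ hg : MemLp g 2 π, g ∈ D ∧ F = hg.toLp g} := by
  refine Metric.dense_iff.2 fun F ε hε => ?_
  obtain ⟨g, hgD, hg⟩ := hdense F (Lp.memLp F) (ε / 2) (half_pos hε)
  refine ⟨(hD g hgD).toLp g, ?_, g, hD g hgD, hgD, rfl⟩
  rw [Metric.mem_ball, dist_comm, Lp.dist_def]
  have hcongr : eLpNorm (⇑F - ⇑((hD g hgD).toLp g)) 2 π = eLpNorm (⇑F - g) 2 π :=
    eLpNorm_congr_ae ((Filter.EventuallyEq.refl _ _).sub (hD g hgD).coeFn_toLp)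
  rw [hcongr]
  exact (ENNReal.toReal_le_of_le_ofReal (half_pos hε).le hg).trans_lt (half_lt_self hε)

variable {Ω β β' : Type*} [mΩ : MeasurableSpace Ω] [mβ : MeasurableSpace β]
  [mβ' : MeasurableSpace β'] {π : Measure Ω} {X : Ω → β} {hX : Measurable X} {Y : Ω → β'}
  {hY : Measurable Y}

variable (π) in
/-- The operator `f ↦ E[f | X] - E f` on `L²(π)`: the projection onto the mean-zero functions of
`X`, encoded as a difference of two nested orthogonal projections. -/
def centeredCondExp [IsFiniteMeasure π] (hX : Measurable X) : Lp ℝ 2 π →L[ℝ] Lp ℝ 2 π :=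
  (lpMeas ℝ ℝ (mβ.comap X) 2 π).subtypeL ∘L condExpL2 ℝ ℝ hX.comap_le
    - (ℝ ∙ Lp.const 2 π (1 : ℝ)).starProjection

theorem isStarProjection_centeredCondExp [IsFiniteMeasure π] :
    IsStarProjection (centeredCondExp π hX) := by
  have : Fact (mβ.comap X ≤ mΩ) := ⟨hX.comap_le⟩
  set U := lpMeas ℝ ℝ (mβ.comap X) 2 π
  set V := ℝ ∙ Lp.const 2 π (1 : ℝ)
  have hVU : V ≤ U := by
    rw [Submodule.span_singleton_le_iff_mem]
    exact mem_lpMeas_iff_aestronglyMeasurable.2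
      (aestronglyMeasurable_const.congr (Lp.coeFn_const 2 π (1 : ℝ)).symm)
  have hU : U.starProjection = U.subtypeL ∘L condExpL2 ℝ ℝ hX.comap_le := rfl
  rw [centeredCondExp, ← hU]
  exact ContinuousLinearMap.isStarProjection_iff_isSymmetricProjection.2
    (V.isSymmetricProjection_starProjection.sub_of_range_le_range
      U.isSymmetricProjection_starProjection
      (by rwa [Submodule.range_starProjection, Submodule.range_starProjection]))

variable [StandardBorelSpace Ω] [Nonempty Ω]

instance isMarkovKernel_blockUpdate [IsFiniteMeasure π] : IsMarkovKernel (blockUpdate π X hX) := by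
  unfold blockUpdate; infer_instance

instance isMarkovKernel_twoBlockGibbs [IsFiniteMeasure π] :
    IsMarkovKernel (twoBlockGibbs π X hX Y hY) := by
  unfold twoBlockGibbs; infer_instance

theorem invariant_blockUpdate [IsFiniteMeasure π] : (blockUpdate π X hX).Invariant π := by
  have h := congrArg Measure.snd
    (compProd_map_condDistrib (mβ := mβ) (μ := π) (X := X) (Y := id) aemeasurable_id)
  rw [Measure.snd_compProd, Measure.snd_map_prodMk hX, Measure.map_id] at h
  rw [Kernel.Invariant, blockUpdate, ← Kernel.comp_deterministic_eq_comap, ← Measure.comp_assoc,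
    Measure.deterministic_comp_eq_map, h]

theorem invariant_twoBlockGibbs [IsFiniteMeasure π] : (twoBlockGibbs π X hX Y hY).Invariant π :=
  invariant_blockUpdate.comp invariant_blockUpdate

variable [IsProbabilityMeasure π]

theorem centeredCondExp_ae_eq (f : Lp ℝ 2 π) :
    centeredCondExp π hX f =ᵐ[π] fun x => ∫ z, f z ∂(blockUpdate π X hX x) - ∫ z, f z ∂π := by
  set e := Lp.const 2 π (1 : ℝ)
  have he : e =ᵐ[π] fun _ => 1 := Lp.coeFn_const 2 π (1 : ℝ)
  have hnorm : ‖e‖ = 1 := by simp [e, Lp.norm_const]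
  have hinner : inner ℝ e f = ∫ z, f z ∂π := by
    rw [L2.inner_def]
    refine integral_congr_ae ?_
    filter_upwards [he] with x hx
    simp [hx]
  have hcond := (Lp.memLp f).condExpL2_ae_eq_condExp (𝕜 := ℝ) hX.comap_le
  rw [Lp.toLp_coeFn] at hcond
  filter_upwards [he, hcond,
    condExp_ae_eq_integral_condDistrib_id hX ((Lp.memLp f).integrable (by norm_num)),
    Lp.coeFn_sub (condExpL2 ℝ ℝ hX.comap_le f : Lp ℝ 2 π) ((∫ z, f z ∂π) • e),
    Lp.coeFn_smul (∫ z, f z ∂π) e] with x hone hL2 hdistrib hsub hsmul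
  rw [centeredCondExp, sub_apply,
    Submodule.starProjection_unit_singleton ℝ hnorm, hinner, ContinuousLinearMap.comp_apply]
  erw [hsub]
  rw [Pi.sub_apply, hsmul, Pi.smul_apply, hone, smul_eq_mul, mul_one, hL2, hdistrib]
  rfl

theorem integral_centeredCondExp (f : Lp ℝ 2 π) : ∫ x, centeredCondExp π hX f x ∂π = 0 := by
  have hf : Integrable f π := (Lp.memLp f).integrable (by norm_num)
  have hint : Integrable (fun x => ∫ z, f z ∂(blockUpdate π X hX x)) π := by
    refine Integrable.integral_comp (κ := Kernel.const Unit π) (a := ()) (f := f) ?_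
    rwa [← Measure.comp_eq_comp_const_apply, invariant_blockUpdate.def]
  rw [integral_congr_ae (centeredCondExp_ae_eq f), integral_sub hint (integrable_const _),
    integral_integral_of_invariant invariant_blockUpdate hf]
  simp

theorem centeredCondExp_mul_ae_eq (f : Lp ℝ 2 π) :
    (centeredCondExp π hX * centeredCondExp π hY) f =ᵐ[π]
      fun x => ∫ z, f z ∂(twoBlockGibbs π X hX Y hY x) - ∫ z, f z ∂π := by
  have hf : Integrable f π := (Lp.memLp f).integrable (by norm_num)
  filter_upwards [centeredCondExp_ae_eq (hX := hX) (centeredCondExp π hY f),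
    ae_ae_of_invariant (invariant_blockUpdate (hX := hX)) (centeredCondExp_ae_eq (hX := hY) f),
    ae_integrable_of_invariant (invariant_twoBlockGibbs (hX := hX) (hY := hY)) hf]
    with x hX' hY' hint
  rw [mul_apply_eq_comp, hX', integral_centeredCondExp, sub_zero, integral_congr_ae hY',
    integral_sub hint.integral_comp (integrable_const _), twoBlockGibbs, Kernel.integral_comp hint]
  simp

theorem centeredCondExp_mul_pow_succ_ae_eq {f : Ω → ℝ} (hf : MemLp f 2 π) (t : ℕ) :
    ((centeredCondExp π hX * centeredCondExp π hY) ^ (t + 1)) (hf.toLp f) =ᵐ[π]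
      fun x => ∫ z, f z ∂((twoBlockGibbs π X hX Y hY ^ (t + 1)) x) - ∫ z, f z ∂π := by
  have hinv : (twoBlockGibbs π X hX Y hY).Invariant π := invariant_twoBlockGibbs
  have hint : Integrable f π := hf.integrable (by norm_num)
  induction t with
  | zero =>
    filter_upwards [centeredCondExp_mul_ae_eq (hX := hX) (hY := hY) (hf.toLp f),
      ae_ae_of_invariant hinv hf.coeFn_toLp] with x hx hx'
    rw [zero_add, pow_one, hx, integral_congr_ae hx', integral_congr_ae hf.coeFn_toLp, pow_one]
  | succ t ih =>
    set g := ((centeredCondExp π hX * centeredCondExp π hY) ^ (t + 1)) (hf.toLp f) with hg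
    have hg0 : ∫ x, g x ∂π = 0 := by
      rw [hg, pow_succ', mul_apply_eq_comp, mul_apply_eq_comp, integral_centeredCondExp]
    filter_upwards [centeredCondExp_mul_ae_eq (hX := hX) (hY := hY) g, ae_ae_of_invariant hinv ih,
      integral_pow_succ hinv hint (t + 1),
      ae_integrable_of_invariant (invariant_pow hinv (t + 2)) hint] with x hx hx' hsucc hx2
    rw [pow_succ] at hx2
    rw [pow_succ', mul_apply_eq_comp, hx, hg0, sub_zero, integral_congr_ae hx',
      integral_sub hx2.integral_comp (integrable_const _), hsucc]
    simp

theorem eLpNorm_twoBlockGibbs_pow_succ {f : Ω → ℝ} (hf : MemLp f 2 π) (t : ℕ) :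
    eLpNorm (fun x => ∫ z, f z ∂((twoBlockGibbs π X hX Y hY ^ (t + 1)) x) - ∫ z, f z ∂π) 2 π
      = ‖((centeredCondExp π hX * centeredCondExp π hY) ^ (t + 1)) (hf.toLp f)‖ₑ := by
  rw [Lp.enorm_def, eLpNorm_congr_ae (centeredCondExp_mul_pow_succ_ae_eq hf t)]

theorem l2Rate_twoBlockGibbs_le {r : ℝ≥0} {D : Set (Ω → ℝ)}
    (hD : ∀ f ∈ D, MemLp f 2 π)
    (hdense : ∀ f : Ω → ℝ, MemLp f 2 π → ∀ ε : ℝ, 0 < ε →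
      ∃ g ∈ D, eLpNorm (f - g) 2 π ≤ ENNReal.ofReal ε)
    (hdecay : ∀ f ∈ D, ∃ C : ℝ≥0, ∀ t : ℕ,
      eLpNorm (fun x => ∫ z, f z ∂((twoBlockGibbs π X hX Y hY ^ (t + 1)) x) - ∫ z, f z ∂π) 2 π
        ≤ C * (r : ℝ≥0∞) ^ t) :
    l2Rate (twoBlockGibbs π X hX Y hY) π ≤ r := by
  refine l2Rate_le_of_eLpNorm_succ_le fun f hf => ⟨‖hf.toLp f‖₊, fun t => ?_⟩
  rw [eLpNorm_twoBlockGibbs_pow_succ hf, enorm_eq_nnnorm]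
  norm_cast
  rw [← NNReal.coe_le_coe, coe_nnnorm, NNReal.coe_mul, coe_nnnorm, NNReal.coe_pow, mul_comm]
  refine norm_mul_pow_succ_apply_le_of_dense isStarProjection_centeredCondExp
    isStarProjection_centeredCondExp r.2 (dense_toLp hD hdense) ?_ _ t
  rintro _ ⟨g, hg, hgD, rfl⟩
  obtain ⟨C, hC⟩ := hdecay g hgD
  refine ⟨C, fun t => ?_⟩
  have hgt := hC t
  rw [eLpNorm_twoBlockGibbs_pow_succ hg, enorm_eq_nnnorm] at hgt
  exact_mod_cast hgt

end TwoBlockGibbs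

/-! ### Averages over the levels of a factor -/

theorem exists_max_eigenvalue {E : Type*} [NormedAddCommGroup E] [InnerProductSpace ℝ E]
    [FiniteDimensional ℝ E] {T : E →ₗ[ℝ] E} (hT : T.IsPositive) :
    ∃ l : ℝ≥0, (∀ x, ‖T x‖ ≤ l * ‖x‖) ∧ (l = 0 ∨ ∃ x, x ≠ 0 ∧ T x = (l : ℝ) • x) := by
  rcases subsingleton_or_nontrivial E with _ | _
  · exact ⟨0, fun x => by simp [Subsingleton.elim (T x) 0], Or.inl rfl⟩
  set b := hT.isSymmetric.eigenvectorBasis rfl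
  set ev := hT.isSymmetric.eigenvalues rfl
  have hTb (i) : T (b i) = ev i • b i := hT.isSymmetric.apply_eigenvectorBasis rfl i
  have hev (i) : 0 ≤ ev i := hT.nonneg_eigenvalues rfl i
  have : Nonempty (Fin (Module.finrank ℝ E)) := ⟨⟨0, Module.finrank_pos⟩⟩
  obtain ⟨k, -, hk⟩ := Finset.exists_max_image Finset.univ ev Finset.univ_nonempty
  refine ⟨⟨ev k, hev k⟩, fun x => ?_, Or.inr ⟨b k, b.orthonormal.ne_zero k, hTb k⟩⟩
  refine le_of_sq_le_sq ?_ (mul_nonneg (hev k) (norm_nonneg x))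
  rw [mul_pow, ← b.sum_sq_norm_inner_right (T x), ← b.sum_sq_norm_inner_right x, Finset.mul_sum]
  refine Finset.sum_le_sum fun i _ => ?_
  rw [← hT.isSymmetric, hTb, real_inner_smul_left, norm_mul, mul_pow,
    Real.norm_of_nonneg (hev i)]
  gcongr
  exacts [hev i, hk i (Finset.mem_univ i)]

section SecondEigenvalue

variable {κ : Type*} [Fintype κ]

/-- `l` is the norm of the averaging operator `K` on centered functions and, unless it vanishes,
an eigenvalue there. For a positive averaging operator this is its second largest eigenvalue. -/
structure IsSecondEigenvalue (K : (κ → ℝ) →ₗ[ℝ] (κ → ℝ)) (l : ℝ≥0) : Prop where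
  sum_sq_apply_le : ∀ g : κ → ℝ, 𝔼 j, g j = 0 → ∑ j, K g j ^ 2 ≤ (l : ℝ) ^ 2 * ∑ j, g j ^ 2
  eq_zero_or_exists : l = 0 ∨ ∃ g : κ → ℝ, g ≠ 0 ∧ 𝔼 j, g j = 0 ∧ K g = (l : ℝ) • g

theorem IsSecondEigenvalue.le_one {K : (κ → ℝ) →ₗ[ℝ] (κ → ℝ)} {l : ℝ≥0}
    (hl : IsSecondEigenvalue K l)
    (hK : ∀ (g : κ → ℝ) (c : ℝ), (∀ j, |g j| ≤ c) → ∀ j, |K g j| ≤ c) : l ≤ 1 := by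
  rcases hl.eq_zero_or_exists with rfl | ⟨g, hg, -, hKg⟩
  · exact zero_le_one
  obtain ⟨j, hj⟩ := Function.ne_iff.1 hg
  obtain ⟨k, -, hk⟩ := Finset.exists_max_image Finset.univ (fun j => |g j|) ⟨j, Finset.mem_univ j⟩
  have hk0 : 0 < |g k| := (abs_pos.2 hj).trans_le (hk j (Finset.mem_univ j))
  have h := hK g |g k| (fun j => hk j (Finset.mem_univ j)) k
  rw [hKg, Pi.smul_apply, smul_eq_mul, abs_mul, NNReal.abs_eq] at h
  exact_mod_cast le_of_mul_le_mul_right (h.trans_eq (one_mul _).symm) hk0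

theorem IsSecondEigenvalue.sum_sq_pow_apply_le {K : (κ → ℝ) →ₗ[ℝ] (κ → ℝ)} {l : ℝ≥0}
    (hl : IsSecondEigenvalue K l) (hK : ∀ g : κ → ℝ, 𝔼 j, K g j = 𝔼 j, g j) {g : κ → ℝ}
    (hg : 𝔼 j, g j = 0) (t : ℕ) :
    ∑ j, (K ^ t) g j ^ 2 ≤ ((l : ℝ) ^ t) ^ 2 * ∑ j, g j ^ 2 := by
  have hmean (t) : 𝔼 j, (K ^ t) g j = 0 := by
    induction t with
    | zero => simpa using hg
    | succ t ih => rw [pow_succ', Module.End.mul_apply, hK, ih]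
  induction t with
  | zero => simp
  | succ t ih =>
    rw [pow_succ', Module.End.mul_apply]
    calc ∑ j, K ((K ^ t) g) j ^ 2 ≤ (l : ℝ) ^ 2 * ∑ j, (K ^ t) g j ^ 2 :=
          hl.sum_sq_apply_le _ (hmean t)
      _ ≤ (l : ℝ) ^ 2 * (((l : ℝ) ^ t) ^ 2 * ∑ j, g j ^ 2) := by gcongr
      _ = ((l : ℝ) ^ (t + 1)) ^ 2 * ∑ j, g j ^ 2 := by ring

theorem exists_isSecondEigenvalue {K : (κ → ℝ) →ₗ[ℝ] (κ → ℝ)}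
    (hmean : ∀ g : κ → ℝ, 𝔼 j, K g j = 𝔼 j, g j)
    (hsymm : ∀ f g : κ → ℝ, ∑ j, K f j * g j = ∑ j, f j * K g j)
    (hpos : ∀ g : κ → ℝ, 0 ≤ ∑ j, K g j * g j) : ∃ l : ℝ≥0, IsSecondEigenvalue K l := by
  let e := WithLp.linearEquiv 2 ℝ (κ → ℝ)
  let T : EuclideanSpace ℝ κ →ₗ[ℝ] EuclideanSpace ℝ κ := e.symm ∘ₗ K ∘ₗ e
  have hT (x) : (T x).ofLp = K x.ofLp := rfl
  let V : Submodule ℝ (EuclideanSpace ℝ κ) :=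
    { carrier := {x | 𝔼 j, x j = 0}
      add_mem' := fun {x y} hx hy => by
        simp_all [Finset.expect_add_distrib]
      zero_mem' := by simp
      smul_mem' := fun c x hx => by
        simp_all [← Finset.mul_expect] }
  have hV : ∀ x ∈ V, T x ∈ V := fun x hx => (hmean x.ofLp).trans hx
  have hin (x y : EuclideanSpace ℝ κ) : inner ℝ (T x) y = ∑ j, K x.ofLp j * y j := by
    simp only [PiLp.inner_apply, hT, RCLike.inner_apply, conj_trivial, mul_comm]
  have hTsymm : T.IsSymmetric := fun x y => by
    rw [hin, hsymm, real_inner_comm, hin]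
    simp only [mul_comm]
  have hTpos : (T.restrict hV).IsPositive :=
    ⟨hTsymm.restrict_invariant hV, fun x => by
      simpa [← hin] using hpos (x : EuclideanSpace ℝ κ).ofLp⟩
  obtain ⟨l, hl, hl'⟩ := exists_max_eigenvalue hTpos
  refine ⟨l, fun g hg => ?_, hl'.imp_right ?_⟩
  · have h := pow_le_pow_left₀ (norm_nonneg _) (hl ⟨WithLp.toLp 2 g, hg⟩) 2
    rw [mul_pow, Submodule.coe_norm, Submodule.coe_norm, LinearMap.coe_restrict_apply,
      EuclideanSpace.real_norm_sq_eq, EuclideanSpace.real_norm_sq_eq] at h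
    exact h
  · rintro ⟨x, hx, hTx⟩
    refine ⟨(x : EuclideanSpace ℝ κ).ofLp, fun h => hx (Subtype.ext (WithLp.ofLp_injective 2 h)),
      x.2, ?_⟩
    exact congrArg (fun v : V => (v : EuclideanSpace ℝ κ).ofLp) hTx

end SecondEigenvalue

section Levels

variable {ν ι κ : Type*} [Fintype ν] [DecidableEq ι]

/-- The number of observations at level `i` of the factor `lev`, as a real number. -/
def levelCount (lev : ν → ι) (i : ι) : ℝ := ∑ n, if lev n = i then 1 else 0

/-- The sums of the values `r` over the observations at each level of the factor `lev`. -/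
def levelSum (lev : ν → ι) : (ν → ℝ) →ₗ[ℝ] (ι → ℝ) where
  toFun r i := ∑ n, if lev n = i then r n else 0
  map_add' r s := by
    ext i; simp only [Pi.add_apply, ← Finset.sum_add_distrib, ← ite_add_zero]
  map_smul' c r := by
    ext i
    simp only [Pi.smul_apply, smul_eq_mul, RingHom.id_apply, Finset.mul_sum, mul_ite, mul_zero]

/-- The averages of the values `r` over the observations at each level of the factor `lev`; the
average at an empty level is `0`. -/
def levelMean (lev : ν → ι) : (ν → ℝ) →ₗ[ℝ] (ι → ℝ) where
  toFun r i := levelSum lev r i / levelCount lev i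
  map_add' r s := by ext i; simp only [map_add, Pi.add_apply, add_div]
  map_smul' c r := by
    ext i; simp only [map_smul, Pi.smul_apply, smul_eq_mul, RingHom.id_apply, mul_div_assoc]

theorem levelSum_apply (lev : ν → ι) (r : ν → ℝ) (i : ι) :
    levelSum lev r i = ∑ n, if lev n = i then r n else 0 := rfl

theorem levelMean_apply (lev : ν → ι) (r : ν → ℝ) (i : ι) :
    levelMean lev r i = levelSum lev r i / levelCount lev i := rfl

theorem levelSum_one (lev : ν → ι) : levelSum lev 1 = levelCount lev := rfl

theorem levelCount_nonneg (lev : ν → ι) (i : ι) : 0 ≤ levelCount lev i :=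
  Finset.sum_nonneg fun n _ => by split_ifs <;> norm_num

theorem levelMean_const {lev : ν → ι} {i : ι} (hi : 0 < levelCount lev i) (c : ℝ) :
    levelMean lev (fun _ => c) i = c := by
  have hc : (fun _ => c : ν → ℝ) = c • 1 := by ext; simp
  rw [hc, map_smul, Pi.smul_apply, levelMean_apply, levelSum_one, div_self hi.ne', smul_eq_mul,
    mul_one]

theorem abs_levelSum_le (lev : ν → ι) {r : ν → ℝ} {c : ℝ} (hr : ∀ n, |r n| ≤ c) (i : ι) :
    |levelSum lev r i| ≤ c * levelCount lev i := by
  rw [levelSum_apply, levelCount, Finset.mul_sum]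
  refine (Finset.abs_sum_le_sum_abs _ _).trans (Finset.sum_le_sum fun n _ => ?_)
  split_ifs
  · simpa using hr n
  · simp

theorem abs_levelMean_le {lev : ν → ι} {i : ι} (hi : 0 < levelCount lev i) {r : ν → ℝ} {c : ℝ}
    (hr : ∀ n, |r n| ≤ c) : |levelMean lev r i| ≤ c := by
  rw [levelMean_apply, abs_div, abs_of_pos hi, div_le_iff₀ hi]
  exact abs_levelSum_le lev hr i

/-- Averages over the observations at each level of the factor `lev` of a function of the level
of the factor `lev'`. -/
def transfer (lev : ν → ι) (lev' : ν → κ) : (κ → ℝ) →ₗ[ℝ] (ι → ℝ) :=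
  levelMean lev ∘ₗ LinearMap.funLeft ℝ ℝ lev'

theorem transfer_apply (lev : ν → ι) (lev' : ν → κ) (g : κ → ℝ) :
    transfer lev lev' g = levelMean lev fun n => g (lev' n) := rfl

/-- Averaging a function of the level of the factor `lev'` first over the levels of `lev` and then
over the levels of `lev'`. -/
def roundTrip [DecidableEq κ] (lev : ν → ι) (lev' : ν → κ) : (κ → ℝ) →ₗ[ℝ] (κ → ℝ) :=
  transfer lev' lev ∘ₗ transfer lev lev'

theorem roundTrip_apply [DecidableEq κ] (lev : ν → ι) (lev' : ν → κ)
    (g : κ → ℝ) : roundTrip lev lev' g = transfer lev' lev (transfer lev lev' g) := rfl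

variable [Fintype ι]

theorem sum_mul_levelSum (lev : ν → ι) (f : ι → ℝ) (r : ν → ℝ) :
    ∑ i, f i * levelSum lev r i = ∑ n, f (lev n) * r n := by
  simp only [levelSum_apply, Finset.mul_sum]
  rw [Finset.sum_comm]
  simp

theorem sum_levelSum (lev : ν → ι) (r : ν → ℝ) : ∑ i, levelSum lev r i = ∑ n, r n := by
  simpa using sum_mul_levelSum lev 1 r

theorem sum_levelCount (lev : ν → ι) : ∑ i, levelCount lev i = Fintype.card ν := by
  simpa [← levelSum_one] using sum_levelSum lev 1

/-- The factor `lev` has equally many observations at each of its levels. -/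
def IsBalancedFactor (lev : ν → ι) : Prop :=
  ∀ i, levelCount lev i = Fintype.card ν / Fintype.card ι

theorem IsBalancedFactor.levelCount_pos [Nonempty ν] {lev : ν → ι} (h : IsBalancedFactor lev)
    (i : ι) : 0 < levelCount lev i := by
  have : Nonempty ι := ⟨i⟩
  rw [h i]
  exact div_pos (Nat.cast_pos.2 Fintype.card_pos) (Nat.cast_pos.2 Fintype.card_pos)

theorem IsBalancedFactor.expect_mul_levelMean {lev : ν → ι} (h : IsBalancedFactor lev)
    (f : ι → ℝ) (r : ν → ℝ) : 𝔼 i, f i * levelMean lev r i = 𝔼 n, f (lev n) * r n := by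
  rcases isEmpty_or_nonempty ι with hι | _
  · have : IsEmpty ν := lev.isEmpty
    simp
  have hι : (Fintype.card ι : ℝ) ≠ 0 := Nat.cast_ne_zero.2 Fintype.card_ne_zero
  rw [Fintype.expect_eq_sum_div_card, Fintype.expect_eq_sum_div_card,
    ← sum_mul_levelSum lev f r, Finset.sum_div, Finset.sum_div]
  refine Finset.sum_congr rfl fun i _ => ?_
  rw [levelMean_apply, h i]
  field_simp

theorem IsBalancedFactor.expect_levelMean {lev : ν → ι} (h : IsBalancedFactor lev) (r : ν → ℝ) :
    𝔼 i, levelMean lev r i = 𝔼 n, r n := by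
  simpa using h.expect_mul_levelMean 1 r

theorem IsBalancedFactor.expect_comp [Nonempty ν] {lev : ν → ι} (h : IsBalancedFactor lev)
    (g : ι → ℝ) : 𝔼 n, g (lev n) = 𝔼 i, g i := by
  have hone (i) : levelMean lev (fun _ => 1) i = 1 := levelMean_const (h.levelCount_pos i) 1
  simpa [hone] using (h.expect_mul_levelMean g fun _ => 1).symm

theorem IsBalancedFactor.expect_transfer_mul [DecidableEq κ] [Fintype κ] {lev : ν → ι}
    {lev' : ν → κ} (h : IsBalancedFactor lev) (h' : IsBalancedFactor lev') (f : ι → ℝ)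
    (g : κ → ℝ) :
    𝔼 i, transfer lev lev' g i * f i = 𝔼 j, g j * transfer lev' lev f j := by
  simp only [mul_comm _ (f _)]
  rw [transfer_apply, transfer_apply, h.expect_mul_levelMean, h'.expect_mul_levelMean]
  simp only [mul_comm]

theorem IsBalancedFactor.sum_roundTrip_mul [DecidableEq κ] [Fintype κ] {lev : ν → ι}
    {lev' : ν → κ} (h : IsBalancedFactor lev) (h' : IsBalancedFactor lev') (f g : κ → ℝ) :
    ∑ j, roundTrip lev lev' f j * g j
      = Fintype.card κ * 𝔼 i, transfer lev lev' f i * transfer lev lev' g i := by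
  rw [roundTrip_apply, ← h'.expect_transfer_mul h, Fintype.card_mul_expect]

theorem IsBalancedFactor.sum_mul_roundTrip_of_eq_smul [DecidableEq κ] [Fintype κ] {lev : ν → ι}
    {lev' : ν → κ} (h : IsBalancedFactor lev) (h' : IsBalancedFactor lev') {l : ℝ} {g : κ → ℝ}
    (hg : roundTrip lev lev' g = l • g) (f : κ → ℝ) :
    ∑ j, g j * roundTrip lev lev' f j = l * ∑ j, g j * f j := by
  calc ∑ j, g j * roundTrip lev lev' f j = ∑ j, roundTrip lev lev' g j * f j := by
        simp only [mul_comm (g _)]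
        rw [h.sum_roundTrip_mul h', h.sum_roundTrip_mul h']
        simp only [mul_comm]
    _ = l * ∑ j, g j * f j := by simp [hg, Finset.mul_sum, mul_assoc]

variable [Nonempty ν]

theorem IsBalancedFactor.transfer_const {lev : ν → ι} (h : IsBalancedFactor lev)
    (lev' : ν → κ) (c : ℝ) :
    transfer lev lev' (fun _ => c) = fun _ => c :=
  funext fun i => levelMean_const (h.levelCount_pos i) c

theorem IsBalancedFactor.abs_transfer_le {lev : ν → ι} (h : IsBalancedFactor lev) {lev' : ν → κ}
    {g : κ → ℝ} {c : ℝ} (hg : ∀ j, |g j| ≤ c) (i : ι) : |transfer lev lev' g i| ≤ c :=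
  abs_levelMean_le (h.levelCount_pos i) fun n => hg (lev' n)

variable [DecidableEq κ] [Fintype κ] {lev : ν → ι} {lev' : ν → κ}

theorem IsBalancedFactor.expect_transfer (h : IsBalancedFactor lev) (h' : IsBalancedFactor lev')
    (g : κ → ℝ) : 𝔼 i, transfer lev lev' g i = 𝔼 j, g j :=
  (h.expect_levelMean _).trans (h'.expect_comp g)

theorem IsBalancedFactor.roundTrip_const (h : IsBalancedFactor lev) (h' : IsBalancedFactor lev')
    (c : ℝ) : roundTrip lev lev' (fun _ => c) = fun _ => c := by
  rw [roundTrip_apply, h.transfer_const, h'.transfer_const]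

theorem IsBalancedFactor.expect_roundTrip (h : IsBalancedFactor lev)
    (h' : IsBalancedFactor lev') (g : κ → ℝ) : 𝔼 j, roundTrip lev lev' g j = 𝔼 j, g j :=
  (h'.expect_transfer h _).trans (h.expect_transfer h' g)

theorem IsBalancedFactor.exists_isSecondEigenvalue (h : IsBalancedFactor lev)
    (h' : IsBalancedFactor lev') :
    ∃ l : ℝ≥0, l ≤ 1 ∧ IsSecondEigenvalue (roundTrip lev lev') l := by
  obtain ⟨l, hl⟩ := CrossedEffects.exists_isSecondEigenvalue (h.expect_roundTrip h')
    (fun f g => by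
      simp only [mul_comm (f _)]
      rw [h.sum_roundTrip_mul h', h.sum_roundTrip_mul h']
      simp only [mul_comm])
    (fun g => by
      rw [h.sum_roundTrip_mul h']
      exact mul_nonneg (Nat.cast_nonneg _)
        (Finset.expect_nonneg fun i _ => mul_self_nonneg _))
  exact ⟨l, hl.le_one fun g c hg => h'.abs_transfer_le (h.abs_transfer_le hg), hl⟩

end Levels

/-! ### The auxiliary sampler -/

section Aux

theorem condDistrib_id_of_ne_zero {Ω β : Type*} [MeasurableSpace Ω] [StandardBorelSpace Ω]
    [Nonempty Ω] [MeasurableSpace β] [MeasurableSingletonClass β] {π : Measure Ω}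
    [IsFiniteMeasure π] {X : Ω → β} (hX : Measurable X) {b : β} (hb : π (X ⁻¹' {b}) ≠ 0) :
    condDistrib id X π b = π[|X ⁻¹' {b}] := by
  ext s hs
  have hm := measurableSet_singleton b
  rw [condDistrib_apply_of_ne_zero measurable_id b (by rwa [Measure.map_apply hX hm]),
    cond_apply (hX hm), Measure.map_apply hX hm,
    Measure.map_apply (hX.prodMk measurable_id) (hm.prod hs)]
  rfl

variable {N I₁ I₂ : ℕ} (D : Design N I₁ I₂)

/-- The cell of observation `n`: the pair of its levels. -/
def Design.cell (n : Fin N) : Fin I₁ × Fin I₂ := (D.lev₁ n, D.lev₂ n)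

theorem Design.cast_cooc (x : Fin I₁ × Fin I₂) : (D.cooc x.1 x.2 : ℝ) = levelCount D.cell x := by
  simp [cooc, levelCount, cell, Prod.ext_iff]

theorem Design.cast_occ₁ (i : Fin I₁) : (D.occ₁ i : ℝ) = levelCount D.lev₁ i := by
  simp [occ₁, levelCount]

theorem Design.cast_occ₂ (j : Fin I₂) : (D.occ₂ j : ℝ) = levelCount D.lev₂ j := by
  simp [occ₂, levelCount]

theorem Design.Balanced.isBalancedFactor {D : Design N I₁ I₂} (hB : D.Balanced) :
    IsBalancedFactor D.lev₁ ∧ IsBalancedFactor D.lev₂ :=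
  ⟨fun i => by simpa [D.cast_occ₁] using hB.1 i, fun j => by simpa [D.cast_occ₂] using hB.2 j⟩

theorem Design.sum_cooc : ∑ x : Fin I₁ × Fin I₂, D.cooc x.1 x.2 = N := by
  have h : ∑ x : Fin I₁ × Fin I₂, (D.cooc x.1 x.2 : ℝ) = N := by
    simp only [D.cast_cooc, sum_levelCount, Fintype.card_fin]
  exact_mod_cast h

theorem Design.auxTarget_singleton (x : Fin I₁ × Fin I₂) :
    D.auxTarget {x} = (N : ℝ≥0∞)⁻¹ * D.cooc x.1 x.2 := by
  rw [Design.auxTarget, cond_apply MeasurableSet.univ, Set.univ_inter,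
    withDensity_apply _ MeasurableSet.univ, withDensity_apply _ (measurableSet_singleton x),
    Measure.restrict_univ, Measure.restrict_singleton, lintegral_smul_measure, lintegral_dirac,
    lintegral_fintype]
  simp only [Measure.count_singleton, mul_one, smul_eq_mul, one_mul, ← Nat.cast_sum, sum_cooc]

theorem Design.integral_auxTarget (f : Fin I₁ × Fin I₂ → ℝ) :
    ∫ x, f x ∂D.auxTarget = 𝔼 n, f (D.cell n) := by
  have hsum := sum_mul_levelSum D.cell f 1
  simp only [levelSum_one, Pi.one_apply, mul_one] at hsum
  rw [integral_fintype Integrable.of_finite, Fintype.expect_eq_sum_div_card, ← hsum,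
    Finset.sum_div, Fintype.card_fin]
  refine Finset.sum_congr rfl fun x _ => ?_
  rw [measureReal_def, auxTarget_singleton, ENNReal.toReal_mul, ENNReal.toReal_inv,
    ENNReal.toReal_natCast, ENNReal.toReal_natCast, D.cast_cooc, smul_eq_mul]
  ring

theorem Design.setIntegral_auxTarget {β : Type*} [MeasurableSpace β] [MeasurableSingletonClass β]
    [DecidableEq β] {X : Fin I₁ × Fin I₂ → β} (hX : Measurable X) (f : Fin I₁ × Fin I₂ → ℝ)
    (b : β) : ∫ x in X ⁻¹' {b}, f x ∂D.auxTarget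
      = levelSum (fun n => X (D.cell n)) (fun n => f (D.cell n)) b / N := by
  rw [← integral_indicator (hX (measurableSet_singleton b)), integral_auxTarget,
    Fintype.expect_eq_sum_div_card, Fintype.card_fin, levelSum_apply]
  congr 1
  exact Finset.sum_congr rfl fun n _ => by by_cases h : X (D.cell n) = b <;> simp [h]

variable [NeZero N]

instance : IsProbabilityMeasure D.auxTarget := by
  have huniv : (Measure.count.withDensity fun x : Fin I₁ × Fin I₂ => (D.cooc x.1 x.2 : ℝ≥0∞))
      Set.univ = N := by
    rw [withDensity_apply _ MeasurableSet.univ, Measure.restrict_univ, lintegral_fintype]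
    simp only [Measure.count_singleton, mul_one, ← Nat.cast_sum, D.sum_cooc]
  refine cond_isProbabilityMeasure_of_finite ?_ ?_
  · rw [huniv]; exact Nat.cast_ne_zero.2 (NeZero.ne N)
  · rw [huniv]; exact ENNReal.natCast_ne_top N

variable [NeZero I₁] [NeZero I₂]

theorem Design.integral_blockUpdate_auxTarget {β : Type*} [MeasurableSpace β]
    [MeasurableSingletonClass β] [DecidableEq β] {X : Fin I₁ × Fin I₂ → β} (hX : Measurable X)
    {x : Fin I₁ × Fin I₂} (hx : 0 < levelCount (fun n => X (D.cell n)) (X x))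
    (f : Fin I₁ × Fin I₂ → ℝ) :
    ∫ z, f z ∂(blockUpdate D.auxTarget X hX x)
      = levelMean (fun n => X (D.cell n)) (fun n => f (D.cell n)) (X x) := by
  have hN : (N : ℝ) ≠ 0 := Nat.cast_ne_zero.2 (NeZero.ne N)
  have hreal : D.auxTarget.real (X ⁻¹' {X x}) = levelCount (fun n => X (D.cell n)) (X x) / N := by
    rw [← levelSum_one, ← setIntegral_one_eq_measureReal]
    exact D.setIntegral_auxTarget hX 1 (X x)
  have hne : D.auxTarget (X ⁻¹' {X x}) ≠ 0 := fun h0 => by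
    rw [measureReal_def, h0, ENNReal.toReal_zero] at hreal
    exact div_ne_zero hx.ne' hN hreal.symm
  rw [blockUpdate, Kernel.comap_apply, condDistrib_id_of_ne_zero hX hne, ProbabilityTheory.cond,
    integral_smul_measure, D.setIntegral_auxTarget hX, ENNReal.toReal_inv, ← measureReal_def,
    hreal, levelMean_apply, smul_eq_mul]
  field_simp

instance : IsMarkovKernel D.auxGibbs := isMarkovKernel_twoBlockGibbs

instance isMarkovKernel_pow {Ω : Type*} [MeasurableSpace Ω] (κ : Kernel Ω Ω) [IsMarkovKernel κ]
    (t : ℕ) : IsMarkovKernel (κ ^ t) := by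
  induction t with
  | zero => exact inferInstanceAs (IsMarkovKernel Kernel.id)
  | succ t ih =>
    rw [pow_succ]
    exact inferInstanceAs (IsMarkovKernel ((κ ^ t) ∘ₖ κ))

variable {D}

theorem Design.Balanced.integral_auxGibbs (hB : D.Balanced) (f : Fin I₁ × Fin I₂ → ℝ)
    (x : Fin I₁ × Fin I₂) : ∫ z, f z ∂(D.auxGibbs x)
      = transfer D.lev₂ D.lev₁ (levelMean D.lev₁ fun n => f (D.cell n)) x.2 := by
  have hfst (z : Fin I₁ × Fin I₂) : ∫ w, f w ∂(blockUpdate D.auxTarget Prod.fst measurable_fst z)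
      = levelMean D.lev₁ (fun n => f (D.cell n)) z.1 :=
    D.integral_blockUpdate_auxTarget measurable_fst (hB.isBalancedFactor.1.levelCount_pos z.1) f
  rw [auxGibbs, twoBlockGibbs, Kernel.integral_comp Integrable.of_finite]
  simp only [hfst]
  exact D.integral_blockUpdate_auxTarget measurable_snd
    (hB.isBalancedFactor.2.levelCount_pos x.2) _

theorem Design.Balanced.integral_auxGibbs_pow_succ (hB : D.Balanced) (f : Fin I₁ × Fin I₂ → ℝ)
    (t : ℕ) (x : Fin I₁ × Fin I₂) : ∫ z, f z ∂((D.auxGibbs ^ (t + 1)) x)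
      = (roundTrip D.lev₁ D.lev₂ ^ t)
          (transfer D.lev₂ D.lev₁ (levelMean D.lev₁ fun n => f (D.cell n))) x.2 := by
  induction t generalizing x with
  | zero => simpa using hB.integral_auxGibbs f x
  | succ t ih =>
    have h : D.auxGibbs ^ (t + 1 + 1) = (D.auxGibbs ^ (t + 1)) ∘ₖ D.auxGibbs := pow_succ _ _
    rw [h, Kernel.integral_comp Integrable.of_finite]
    simp only [ih, hB.integral_auxGibbs]
    rw [pow_succ']
    rfl

theorem Design.Balanced.abs_integral_auxGibbs_pow_succ_sub_le (hB : D.Balanced) {l : ℝ≥0}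
    (hl : IsSecondEigenvalue (roundTrip D.lev₁ D.lev₂) l) (f : Fin I₁ × Fin I₂ → ℝ) :
    ∃ S : ℝ≥0, ∀ t x, |(∫ z, f z ∂((D.auxGibbs ^ (t + 1)) x)) - ∫ z, f z ∂D.auxTarget|
      ≤ S * (l : ℝ) ^ t := by
  obtain ⟨h₁, h₂⟩ := hB.isBalancedFactor
  set K := roundTrip D.lev₁ D.lev₂
  set h := transfer D.lev₂ D.lev₁ (levelMean D.lev₁ fun n => f (D.cell n))
  set M := ∫ z, f z ∂D.auxTarget
  have hM : 𝔼 j, (h - fun _ => M : Fin I₂ → ℝ) j = 0 := by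
    have hh : 𝔼 j, h j = M := by
      rw [h₂.expect_transfer h₁, h₁.expect_levelMean, ← D.integral_auxTarget]
    simp [Finset.expect_sub_distrib, hh]
  have hconst (t) : (K ^ t) (fun _ => M) = fun _ => M := by
    induction t with
    | zero => rfl
    | succ t ih => rw [pow_succ', Module.End.mul_apply, ih, h₁.roundTrip_const h₂]
  refine ⟨(√(∑ j, (h j - M) ^ 2)).toNNReal, fun t x => ?_⟩
  have heq : (∫ z, f z ∂((D.auxGibbs ^ (t + 1)) x)) - M = (K ^ t) (h - fun _ => M) x.2 := by
    rw [hB.integral_auxGibbs_pow_succ, map_sub, hconst, Pi.sub_apply]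
  rw [heq]
  refine abs_le_of_sq_le_sq ?_ (by positivity)
  rw [mul_comm, mul_pow, Real.coe_toNNReal _ (Real.sqrt_nonneg _), Real.sq_sqrt (by positivity)]
  exact (Finset.single_le_sum (fun j _ => sq_nonneg _) (Finset.mem_univ x.2)).trans
    (hl.sum_sq_pow_apply_le (h₁.expect_roundTrip h₂) hM t)

theorem Design.Balanced.l2Rate_auxGibbs_le (hB : D.Balanced) {l : ℝ≥0}
    (hl : IsSecondEigenvalue (roundTrip D.lev₁ D.lev₂) l) :
    l2Rate D.auxGibbs D.auxTarget ≤ l := by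
  refine l2Rate_le_of_eLpNorm_succ_le fun f _ => ?_
  obtain ⟨S, hS⟩ := hB.abs_integral_auxGibbs_pow_succ_sub_le hl f
  refine ⟨S, fun t => (eLpNorm_le_of_ae_bound (.of_forall (hS t))).trans_eq ?_⟩
  rw [measure_univ, ENNReal.one_rpow, one_mul, ENNReal.ofReal_mul S.coe_nonneg,
    ENNReal.ofReal_pow l.coe_nonneg, ENNReal.ofReal_coe_nnreal, ENNReal.ofReal_coe_nnreal]

theorem Design.Balanced.le_l2Rate_auxGibbs (hB : D.Balanced) {l : ℝ≥0}
    (hl : IsSecondEigenvalue (roundTrip D.lev₁ D.lev₂) l) :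
    l ≤ l2Rate D.auxGibbs D.auxTarget := by
  rcases hl.eq_zero_or_exists with rfl | ⟨g, hg, hmean, hKg⟩
  · simp
  have hcell (g : Fin I₂ → ℝ) : ∫ z : Fin I₁ × Fin I₂, g z.2 ∂D.auxTarget = 𝔼 j, g j :=
    (D.integral_auxTarget _).trans (hB.isBalancedFactor.2.expect_comp g)
  rw [← ENNReal.ofReal_coe_nnreal]
  refine le_l2Rate_of_affine (f := fun x => g x.2) (c := 0) invariant_twoBlockGibbs
    MemLp.of_discrete (.of_forall fun x => ?_) fun hae => hg ?_
  · refine (hB.integral_auxGibbs _ x).trans ?_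
    have hx := congrFun hKg x.2
    rw [Pi.smul_apply, smul_eq_mul] at hx
    rw [add_zero, ← hx]
    rfl
  · rw [hcell, hmean] at hae
    have hsq : 𝔼 j, g j ^ 2 = 0 := by
      rw [← hcell fun j => g j ^ 2]
      refine integral_eq_zero_of_ae ?_
      filter_upwards [hae] with x hx
      simp [hx]
    rw [Finset.expect_eq_zero_iff_of_nonneg fun j _ => sq_nonneg _] at hsq
    exact funext fun j => pow_eq_zero_iff two_ne_zero |>.1 (hsq j (Finset.mem_univ j))

theorem Design.Balanced.l2Rate_auxGibbs (hB : D.Balanced) {l : ℝ≥0}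
    (hl : IsSecondEigenvalue (roundTrip D.lev₁ D.lev₂) l) :
    l2Rate D.auxGibbs D.auxTarget = l :=
  (hB.l2Rate_auxGibbs_le hl).antisymm (hB.le_l2Rate_auxGibbs hl)

end Aux

/-! ### Gaussian conjugacy -/

section Conjugacy

/-- The unnormalized Gaussian density with scale `A`, precision `p` and linear coefficient `l`.
Conjugate updates add the last two. -/
def gaussFactor (A p l x : ℝ) : ℝ≥0∞ := ENNReal.ofReal (A * Real.exp (-p * x ^ 2 / 2 + l * x))

@[fun_prop]
theorem measurable_gaussFactor (A p l : ℝ) : Measurable (gaussFactor A p l) := by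
  unfold gaussFactor
  fun_prop

theorem gaussFactor_mul {A : ℝ} (hA : 0 ≤ A) (B p q l m x : ℝ) :
    gaussFactor A p l x * gaussFactor B q m x = gaussFactor (A * B) (p + q) (l + m) x := by
  rw [gaussFactor, gaussFactor, gaussFactor, ← ENNReal.ofReal_mul (by positivity),
    mul_mul_mul_comm, ← Real.exp_add]
  congr 3
  ring

theorem gaussianPDF_eq_gaussFactor (m : ℝ) {p : ℝ≥0} (hp : p ≠ 0) :
    ∃ A : ℝ, 0 < A ∧ gaussianPDF m p⁻¹ = gaussFactor A p (p * m) := by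
  have hp₀ : (p : ℝ) ≠ 0 := NNReal.coe_ne_zero.2 hp
  refine ⟨(√(2 * Real.pi * p⁻¹))⁻¹ * Real.exp (-p * m ^ 2 / 2),
    mul_pos (inv_pos.2 (Real.sqrt_pos.2 (by positivity))) (Real.exp_pos _),
    funext fun x => ?_⟩
  rw [gaussianPDF, gaussianPDFReal, gaussFactor, NNReal.coe_inv, mul_assoc _ (Real.exp _),
    ← Real.exp_add]
  congr 3
  field_simp
  ring

theorem gaussianReal_eq_withDensity (m : ℝ) {p : ℝ≥0} (hp : p ≠ 0) :
    ∃ A : ℝ, 0 < A ∧ gaussianReal m p⁻¹ = volume.withDensity (gaussFactor A p (p * m)) := by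
  obtain ⟨A, hA, h⟩ := gaussianPDF_eq_gaussFactor m hp
  exact ⟨A, hA, by rw [gaussianReal_of_var_ne_zero _ (inv_ne_zero hp), h]⟩

theorem globalPrior_eq_withDensity (μpr : ℝ) (τpr : ℝ≥0) :
    ∃ A : ℝ, 0 < A ∧ globalPrior μpr τpr = volume.withDensity (gaussFactor A τpr (τpr * μpr)) := by
  rw [globalPrior]
  split_ifs with h
  · refine ⟨1, one_pos, ?_⟩
    have hone : gaussFactor 1 0 0 = 1 := funext fun x => by simp [gaussFactor]
    rw [h, NNReal.coe_zero, zero_mul, hone, withDensity_one]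
  · exact gaussianReal_eq_withDensity μpr h

theorem gaussianReal_eq_map (m : ℝ) {p : ℝ≥0} :
    gaussianReal m p⁻¹ = (gaussianReal 0 1).map fun z => m + z / √p := by
  have h : (fun z : ℝ => m + z / √p) = (fun z => m + z) ∘ fun z => z / √p := rfl
  rw [h, ← Measure.map_map (by fun_prop) (by fun_prop), gaussianReal_map_div_const,
    gaussianReal_map_const_add, zero_div, zero_add]
  congr 1
  ext
  simp

theorem withDensity_gaussFactor {A p : ℝ} (hA : 0 ≤ A) (hp : 0 < p) (l : ℝ) :
    volume.withDensity (gaussFactor A p l)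
      = (A * √(2 * Real.pi / p) * Real.exp (l ^ 2 / (2 * p))).toNNReal •
        (gaussianReal 0 1).map fun z => l / p + z / √p := by
  lift p to ℝ≥0 using hp.le
  have hp' : p ≠ 0 := (NNReal.coe_pos.1 hp).ne'
  change _ = ENNReal.ofReal _ • (_ : Measure ℝ)
  rw [← gaussianReal_eq_map, gaussianReal_of_var_ne_zero _ (inv_ne_zero hp'),
    ← withDensity_smul _ (measurable_gaussianPDF _ _)]
  congr 1
  ext x
  have hs : √(2 * Real.pi / p) ≠ 0 := (Real.sqrt_pos.2 (by positivity)).ne'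
  rw [Pi.smul_apply, smul_eq_mul, gaussianPDF, ← ENNReal.ofReal_mul (by positivity), gaussFactor,
    gaussianPDFReal, NNReal.coe_inv, ← div_eq_mul_inv, mul_mul_mul_comm, mul_assoc A,
    mul_assoc A]
  congr 2
  rw [mul_comm (Real.exp _), mul_assoc, mul_inv_cancel_left₀ hs, ← Real.exp_add]
  congr 1
  field_simp
  ring

theorem pi_withDensity {ι : Type*} [Fintype ι] {α : ι → Type*} [∀ i, MeasurableSpace (α i)]
    (μ : ∀ i, Measure (α i)) [∀ i, IsProbabilityMeasure (μ i)] {g : ∀ i, α i → ℝ≥0∞}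
    (hg : ∀ i, Measurable (g i)) [∀ i, SigmaFinite ((μ i).withDensity (g i))] :
    Measure.pi (fun i => (μ i).withDensity (g i))
      = (Measure.pi μ).withDensity fun x => ∏ i, g i (x i) := by
  refine Measure.pi_eq fun s hs => ?_
  have hbox : MeasurableSet (Set.univ.pi s) := MeasurableSet.univ_pi hs
  have hind (x) : (Set.univ.pi s).indicator (fun x => ∏ i, g i (x i)) x
      = ∏ i, (s i).indicator (g i) (x i) := by
    classical
    by_cases hx : x ∈ Set.univ.pi s
    · rw [Set.indicator_of_mem hx]
      exact Finset.prod_congr rfl fun i _ => (Set.indicator_of_mem (hx i (Set.mem_univ i)) _).symm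
    · obtain ⟨i, hi⟩ : ∃ i, x i ∉ s i := by simpa [Set.mem_pi] using hx
      rw [Set.indicator_of_notMem hx]
      exact (Finset.prod_eq_zero (Finset.mem_univ i) (Set.indicator_of_notMem hi _)).symm
  have hmeas (i) : Measurable ((s i).indicator (g i)) := (hg i).indicator (hs i)
  rw [withDensity_apply _ hbox, ← lintegral_indicator hbox]
  simp only [hind]
  rw [lintegral_prod_eq_prod_lintegral_of_indepFun Finset.univ
    (fun i (x : ∀ i, α i) => (s i).indicator (g i) (x i))
    (iIndepFun_pi fun i => (hmeas i).aemeasurable)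
    (fun i => (hmeas i).comp (measurable_pi_apply i))]
  refine Finset.prod_congr rfl fun i _ => ?_
  rw [(measurePreserving_eval μ i).lintegral_comp (hmeas i), lintegral_indicator (hs i),
    withDensity_apply _ (hs i)]

theorem pi_smul_measure {ι : Type*} [Fintype ι] {α : ι → Type*} [∀ i, MeasurableSpace (α i)]
    (μ : ∀ i, Measure (α i)) [∀ i, IsFiniteMeasure (μ i)] (c : ι → ℝ≥0) :
    Measure.pi (fun i => c i • μ i) = (∏ i, c i) • Measure.pi μ := by
  refine Measure.pi_eq fun s _ => ?_
  simp only [Measure.smul_apply, Measure.pi_pi, ENNReal.smul_def, smul_eq_mul,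
    Finset.prod_mul_distrib, ENNReal.ofNNReal_finsetProd]

theorem pi_gaussianReal_withDensity {ι : Type*} [Fintype ι] {p : ℝ≥0} (hp : p ≠ 0) {q : ι → ℝ}
    (hq : ∀ i, 0 ≤ q i) : ∃ C : ℝ, 0 < C ∧ ∀ m : ι → ℝ,
      (Measure.pi fun _ => gaussianReal 0 p⁻¹).withDensity
          (fun x => ∏ i, gaussFactor 1 (q i) (m i) (x i))
        = (C * Real.exp (∑ i, m i ^ 2 / (2 * (q i + p)))).toNNReal •
          (Measure.pi fun _ => gaussianReal 0 1).map
            fun z i => m i / (q i + p) + z i / √(q i + p) := by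
  obtain ⟨A, hA, hprior⟩ := gaussianReal_eq_withDensity 0 hp
  have hp' : 0 < (p : ℝ) := NNReal.coe_pos.2 (pos_iff_ne_zero.2 hp)
  have hqp (i) : 0 < q i + p := add_pos_of_nonneg_of_pos (hq i) hp'
  refine ⟨∏ i, A * √(2 * Real.pi / (q i + p)), Finset.prod_pos fun i _ => by
    have := hqp i
    positivity, fun m => ?_⟩
  have hone (i) : (gaussianReal 0 p⁻¹).withDensity (gaussFactor 1 (q i) (m i))
      = (A * √(2 * Real.pi / (q i + p)) * Real.exp (m i ^ 2 / (2 * (q i + p)))).toNNReal •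
        (gaussianReal 0 1).map fun z => m i / (q i + p) + z / √(q i + p) := by
    rw [hprior, ← withDensity_mul _ (by fun_prop) (by fun_prop),
      ← withDensity_gaussFactor hA.le (hqp i)]
    congr 1
    ext x
    rw [Pi.mul_apply, gaussFactor_mul hA.le, mul_one, mul_zero, zero_add, add_comm]
  have _ (i) : IsProbabilityMeasure ((gaussianReal 0 1).map
      fun z => m i / (q i + p) + z / √(q i + p)) :=
    Measure.isProbabilityMeasure_map (by fun_prop)
  have _ (i : ι) :
      SigmaFinite ((gaussianReal 0 p⁻¹).withDensity (gaussFactor 1 (q i) (m i))) := by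
    rw [hone]; infer_instance
  rw [← pi_withDensity _ fun i => by fun_prop]
  simp only [hone]
  rw [pi_smul_measure, ← Measure.pi_map_pi fun i => by fun_prop, Real.exp_sum,
    ← Finset.prod_mul_distrib, Real.toNNReal_prod_of_nonneg fun i _ => by positivity]

end Conjugacy

/-! ### The joint update of the global effect and one factor -/

section Block

variable {ν ι : Type*} [Fintype ν] [DecidableEq ι] (lev : ν → ι) (τ τk μpr τpr : ℝ) (r : ν → ℝ)

/-- Conditional precision of the effect of level `i`. -/
def levelPrec (i : ι) : ℝ := levelCount lev i * τ + τk

/-- Weight of level `i` in the law of the global effect once the effects are integrated out. -/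
def levelWeight (i : ι) : ℝ := τk / levelPrec lev τ τk i * τ

/-- Conditional mean of the effect of level `i` given the residuals `r` and the global effect
`a`. -/
def effectMean (a : ℝ) (i : ι) : ℝ :=
  (levelSum lev r i - levelCount lev i * a) * τ / levelPrec lev τ τk i

/-- The effects given the residuals `r` and the global effect `a`, as a function of standard
normal variables `z`. -/
def effectDraw (a : ℝ) (z : ι → ℝ) (i : ι) : ℝ :=
  effectMean lev τ τk r a i + z i / √(levelPrec lev τ τk i)

theorem levelPrec_pos {τ τk : ℝ} (hτ : 0 ≤ τ) (hτk : 0 < τk) (i : ι) :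
    0 < levelPrec lev τ τk i :=
  add_pos_of_nonneg_of_pos (mul_nonneg (levelCount_nonneg lev i) hτ) hτk

@[fun_prop]
theorem measurable_levelSum (i : ι) : Measurable fun r => levelSum lev r i := by
  simp only [levelSum_apply]
  exact Finset.measurable_sum _ fun n _ => by split_ifs <;> fun_prop

theorem measurable_effectDraw : Measurable fun x : (ν → ℝ) × ℝ × (ι → ℝ) =>
    effectDraw lev τ τk x.1 x.2.1 x.2.2 := by
  refine measurable_pi_iff.2 fun i => ?_
  unfold effectDraw effectMean
  fun_prop

variable [Fintype ι]

/-- Precision of the global effect, with the effects of the factor integrated out. -/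
def globalPrec : ℝ := τpr + ∑ i, levelWeight lev τ τk i * levelCount lev i

/-- Linear coefficient of the log density of the global effect, with the effects of the factor
integrated out. -/
def globalLin : ℝ := τpr * μpr + ∑ i, levelWeight lev τ τk i * levelSum lev r i

/-- The global effect as a function of a standard normal variable `z`. -/
def globalDraw (z : ℝ) : ℝ :=
  globalLin lev τ τk μpr τpr r / globalPrec lev τ τk τpr + z / √(globalPrec lev τ τk τpr)

/-- The joint update of the global effect and the effects of the factor `lev` as a function of
standard normal variables `z`. -/
def blockDraw (z : ℝ × (ι → ℝ)) : ℝ × (ι → ℝ) :=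
  (globalDraw lev τ τk μpr τpr r z.1,
    effectDraw lev τ τk r (globalDraw lev τ τk μpr τpr r z.1) z.2)

/-- The law of the independent standard normal variables that drive a block update. -/
def blockNoise (ι : Type*) [Fintype ι] : Measure (ℝ × (ι → ℝ)) :=
  (gaussianReal 0 1).prod (Measure.pi fun _ => gaussianReal 0 1)

instance : IsProbabilityMeasure (blockNoise ι) := by unfold blockNoise; infer_instance

theorem measurable_blockDraw : Measurable fun x : (ν → ℝ) × ℝ × (ι → ℝ) =>
    blockDraw lev τ τk μpr τpr x.1 x.2 := by
  have hglobal : Measurable fun x : (ν → ℝ) × ℝ × (ι → ℝ) =>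
      globalDraw lev τ τk μpr τpr x.1 x.2.1 := by
    unfold globalDraw globalLin
    fun_prop
  refine hglobal.prodMk (measurable_pi_iff.2 fun i => ?_)
  unfold effectDraw effectMean
  fun_prop

theorem measurable_blockDraw_right (r : ν → ℝ) : Measurable (blockDraw lev τ τk μpr τpr r) :=
  (measurable_blockDraw lev τ τk μpr τpr).comp (f := fun z => (r, z)) (by fun_prop)

variable {τ τk μpr τpr}

theorem globalPrec_pos [Nonempty ν] (hτ : 0 < τ) (hτk : 0 < τk) (hτpr : 0 ≤ τpr) :
    0 < globalPrec lev τ τk τpr := by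
  have hweight (i) : 0 < levelWeight lev τ τk i :=
    mul_pos (div_pos hτk (levelPrec_pos lev hτ.le hτk i)) hτ
  obtain ⟨i, -, hi⟩ : ∃ i ∈ Finset.univ, levelCount lev i ≠ 0 := by
    refine Finset.exists_ne_zero_of_sum_ne_zero ?_
    rw [sum_levelCount]
    exact_mod_cast Fintype.card_ne_zero
  exact add_pos_of_nonneg_of_pos hτpr (Finset.sum_pos'
    (fun i _ => mul_nonneg (hweight i).le (levelCount_nonneg lev i))
    ⟨i, Finset.mem_univ i, mul_pos (hweight i) ((levelCount_nonneg lev i).lt_of_ne' hi)⟩)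

theorem sum_sq_sub_effect (a : ℝ) (x : ι → ℝ) :
    ∑ n, (r n - (a + x (lev n))) ^ 2 = ∑ n, (r n - a) ^ 2
      + ∑ i, (levelCount lev i * x i ^ 2
        - 2 * (levelSum lev r i - levelCount lev i * a) * x i) := by
  have hx := sum_mul_levelSum lev x r
  have hx1 := sum_mul_levelSum lev x 1
  have hsq := sum_mul_levelSum lev (fun i => x i ^ 2) 1
  simp only [levelSum_one, Pi.one_apply, mul_one] at hx1 hsq
  have hlhs : ∑ n, (r n - (a + x (lev n))) ^ 2 = ∑ n, (r n - a) ^ 2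
      + (∑ n, x (lev n) ^ 2 - 2 * ∑ n, x (lev n) * r n + 2 * a * ∑ n, x (lev n)) := by
    simp only [Finset.mul_sum, ← Finset.sum_add_distrib, ← Finset.sum_sub_distrib]
    exact Finset.sum_congr rfl fun n _ => by ring
  rw [hlhs, ← hsq, ← hx, ← hx1]
  simp only [Finset.mul_sum, ← Finset.sum_add_distrib, ← Finset.sum_sub_distrib]
  exact congrArg _ (Finset.sum_congr rfl fun i _ => by ring)

theorem prod_gaussianPDF_eq {τ : ℝ≥0} (hτ : 0 < τ) : ∃ C : ℝ, 0 < C ∧ ∀ (a : ℝ) (x : ι → ℝ),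
    ∏ n, gaussianPDF (a + x (lev n)) τ⁻¹ (r n)
      = ENNReal.ofReal (C * Real.exp (-τ / 2 * ∑ n, (r n - a) ^ 2)) *
        ∏ i, gaussFactor 1 (levelCount lev i * τ)
          ((levelSum lev r i - levelCount lev i * a) * τ) (x i) := by
  have hτ₀ : (τ : ℝ) ≠ 0 := (NNReal.coe_pos.2 hτ).ne'
  refine ⟨∏ _n : ν, (√(2 * Real.pi * (τ⁻¹ : ℝ≥0)))⁻¹, Finset.prod_pos fun _ _ =>
    inv_pos.2 (Real.sqrt_pos.2 (by positivity)), fun a x => ?_⟩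
  simp only [gaussianPDF, gaussianPDFReal, gaussFactor]
  rw [← ENNReal.ofReal_prod_of_nonneg fun n _ => by positivity, Finset.prod_mul_distrib,
    ← Real.exp_sum, ← ENNReal.ofReal_prod_of_nonneg fun i _ => by positivity,
    Finset.prod_mul_distrib, ← Real.exp_sum, ← ENNReal.ofReal_mul (by positivity),
    Finset.prod_const_one, one_mul, mul_assoc (∏ _n, _), ← Real.exp_add]
  have hscale : ∑ n, -(r n - (a + x (lev n))) ^ 2 / (2 * ((τ⁻¹ : ℝ≥0) : ℝ))
      = -τ / 2 * ∑ n, (r n - (a + x (lev n))) ^ 2 := by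
    rw [Finset.mul_sum]
    refine Finset.sum_congr rfl fun n _ => ?_
    rw [NNReal.coe_inv]
    field_simp
  rw [hscale, sum_sq_sub_effect, mul_add, Finset.mul_sum (s := (Finset.univ : Finset ι))]
  congr 4
  exact Finset.sum_congr rfl fun i _ => by ring

/-- Completing the square in the global effect `a` after the effects have been integrated out. -/
theorem sum_sq_exponent (hp : ∀ i, levelPrec lev τ τk i ≠ 0) (a : ℝ) :
    -τ / 2 * ∑ n, (r n - a) ^ 2
      + ∑ i, ((levelSum lev r i - levelCount lev i * a) * τ) ^ 2 / (2 * levelPrec lev τ τk i)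
    = -τ / 2 * ∑ n, r n ^ 2 + ∑ i, (levelSum lev r i * τ) ^ 2 / (2 * levelPrec lev τ τk i)
      + (-(∑ i, levelWeight lev τ τk i * levelCount lev i) * a ^ 2 / 2
        + (∑ i, levelWeight lev τ τk i * levelSum lev r i) * a) := by
  have hsq : ∑ n, (r n - a) ^ 2 = ∑ n, r n ^ 2
      + ∑ i, (levelCount lev i * a ^ 2 - 2 * a * levelSum lev r i) := by
    simp only [Finset.sum_sub_distrib, ← Finset.sum_mul, ← Finset.mul_sum, sum_levelCount,
      sum_levelSum, sub_sq, Finset.sum_add_distrib, Finset.sum_const, Finset.card_univ,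
      nsmul_eq_mul, mul_right_comm _ _ a, mul_comm 2 a]
    ring
  have hterm (i) : -τ / 2 * (levelCount lev i * a ^ 2 - 2 * a * levelSum lev r i)
        + ((levelSum lev r i - levelCount lev i * a) * τ) ^ 2 / (2 * levelPrec lev τ τk i)
      = (levelSum lev r i * τ) ^ 2 / (2 * levelPrec lev τ τk i)
        + (-(levelWeight lev τ τk i * levelCount lev i) * a ^ 2 / 2
          + levelWeight lev τ τk i * levelSum lev r i * a) := by
    have hpi := hp i
    have hτk : τk = levelPrec lev τ τk i - levelCount lev i * τ := by rw [levelPrec]; ring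
    rw [levelWeight]
    generalize levelPrec lev τ τk i = P at hpi hτk
    rw [hτk]
    field_simp
    ring
  rw [hsq, mul_add, add_assoc, Finset.mul_sum (s := (Finset.univ : Finset ι)),
    ← Finset.sum_add_distrib, Finset.sum_congr rfl fun i _ => hterm i, Finset.sum_add_distrib,
    Finset.sum_add_distrib, ← add_assoc]
  simp only [← Finset.sum_mul, ← Finset.sum_div, Finset.sum_neg_distrib]

theorem lintegral_effects {τ τk : ℝ≥0} (hτ : 0 < τ) (hτk : 0 < τk) : ∃ B : ℝ, 0 ≤ B ∧
    ∀ (a : ℝ) (F : (ι → ℝ) → ℝ≥0∞), Measurable F →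
    ∫⁻ x, (∏ n, gaussianPDF (a + x (lev n)) τ⁻¹ (r n)) * F x
        ∂(Measure.pi fun _ => gaussianReal 0 τk⁻¹)
      = gaussFactor B (∑ i, levelWeight lev τ τk i * levelCount lev i)
          (∑ i, levelWeight lev τ τk i * levelSum lev r i) a *
        ∫⁻ z, F (effectDraw lev τ τk r a z) ∂(Measure.pi fun _ => gaussianReal 0 1) := by
  obtain ⟨C, hC, hlik⟩ := prod_gaussianPDF_eq lev r hτ
  obtain ⟨C', hC', hconj⟩ := pi_gaussianReal_withDensity hτk.ne'
    fun i => mul_nonneg (levelCount_nonneg lev i) τ.coe_nonneg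
  have hp (i) := (levelPrec_pos lev τ.coe_nonneg (NNReal.coe_pos.2 hτk) i).ne'
  refine ⟨C * C' * Real.exp (-τ / 2 * ∑ n, r n ^ 2
    + ∑ i, (levelSum lev r i * τ) ^ 2 / (2 * levelPrec lev τ τk i)), by positivity,
    fun a F hF => ?_⟩
  have hdraw : Measurable (effectDraw lev τ τk r a) :=
    (measurable_effectDraw lev τ τk).comp (f := fun z => (r, a, z)) (by fun_prop)
  simp only [hlik, mul_assoc (ENNReal.ofReal _)]
  rw [lintegral_const_mul _ (by fun_prop)]
  have h := lintegral_withDensity_eq_lintegral_mul (Measure.pi fun _ : ι => gaussianReal 0 τk⁻¹)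
    (f := fun x => ∏ i, gaussFactor 1 (levelCount lev i * τ)
      ((levelSum lev r i - levelCount lev i * a) * τ) (x i)) (by fun_prop) hF
  simp only [Pi.mul_apply] at h
  rw [← h, hconj fun i => (levelSum lev r i - levelCount lev i * a) * τ,
    lintegral_smul_measure]
  change _ * (ENNReal.ofReal _ * ∫⁻ x, F x ∂(Measure.map (effectDraw lev τ τk r a) _)) = _
  rw [lintegral_map hF hdraw, ← mul_assoc, ← ENNReal.ofReal_mul (by positivity), gaussFactor,
    mul_mul_mul_comm, ← Real.exp_add, mul_assoc (C * C'), ← Real.exp_add,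
    ← sum_sq_exponent lev r hp]
  rfl

theorem lintegral_block [Nonempty ν] {τ τk : ℝ≥0} (hτ : 0 < τ) (hτk : 0 < τk) (μpr : ℝ)
    (τpr : ℝ≥0) : ∃ Z : ℝ≥0∞, ∀ F : ℝ × (ι → ℝ) → ℝ≥0∞, Measurable F →
      ∫⁻ a, ∫⁻ x, (∏ n, gaussianPDF (a + x (lev n)) τ⁻¹ (r n)) * F (a, x)
        ∂(Measure.pi fun _ => gaussianReal 0 τk⁻¹) ∂(globalPrior μpr τpr)
      = Z * ∫⁻ z, F (blockDraw lev τ τk μpr τpr r z) ∂(blockNoise ι) := by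
  obtain ⟨A, hA, hprior⟩ := globalPrior_eq_withDensity μpr τpr
  obtain ⟨B, hB, heffects⟩ := lintegral_effects lev r hτ hτk
  have hP : 0 < globalPrec lev τ τk τpr :=
    globalPrec_pos lev (NNReal.coe_pos.2 hτ) (NNReal.coe_pos.2 hτk) τpr.coe_nonneg
  refine ⟨ENNReal.ofReal (A * B * √(2 * Real.pi / globalPrec lev τ τk τpr) *
    Real.exp (globalLin lev τ τk μpr τpr r ^ 2 / (2 * globalPrec lev τ τk τpr))), fun F hF => ?_⟩
  have heffect : Measurable fun x : ℝ × (ι → ℝ) => effectDraw lev τ τk r x.1 x.2 :=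
    (measurable_effectDraw lev τ τk).comp (f := fun x => (r, x)) (by fun_prop)
  have hglobal : Measurable (globalDraw lev τ τk μpr τpr r) := by
    unfold globalDraw
    fun_prop
  have hblock := measurable_blockDraw_right lev τ τk μpr τpr r
  set H : ℝ → ℝ≥0∞ := fun a => ∫⁻ z, F (a, effectDraw lev τ τk r a z)
    ∂(Measure.pi fun _ => gaussianReal 0 1)
  have hHm : Measurable H := Measurable.lintegral_prod_right'
    (f := fun x : ℝ × (ι → ℝ) => F (x.1, effectDraw lev τ τk r x.1 x.2))
    (hF.comp (measurable_fst.prodMk heffect))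
  simp only [fun a => heffects a (fun x => F (a, x)) (hF.comp measurable_prodMk_left)]
  have h := lintegral_withDensity_eq_lintegral_mul (globalPrior μpr τpr)
    (measurable_gaussFactor B (∑ i, levelWeight lev τ τk i * levelCount lev i)
      (∑ i, levelWeight lev τ τk i * levelSum lev r i)) hHm
  have hfactor : (gaussFactor A τpr (τpr * μpr) * gaussFactor B
      (∑ i, levelWeight lev τ τk i * levelCount lev i)
      (∑ i, levelWeight lev τ τk i * levelSum lev r i))
      = gaussFactor (A * B) (globalPrec lev τ τk τpr) (globalLin lev τ τk μpr τpr r) :=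
    funext fun a => gaussFactor_mul hA.le _ _ _ _ _ _
  have hintegral := lintegral_prod (μ := gaussianReal 0 1)
    (ν := Measure.pi fun _ : ι => gaussianReal 0 1) _ (hF.comp hblock).aemeasurable
  refine h.symm.trans ?_
  rw [hprior, ← withDensity_mul _ (by fun_prop) (by fun_prop), hfactor,
    withDensity_gaussFactor (by positivity) hP, lintegral_smul_measure]
  exact congrArg _ ((lintegral_map hHm hglobal).trans hintegral.symm)

end Block

/-! ### Kernels driven by independent noise -/

section NoiseKernel

variable {E S Ω : Type*} [MeasurableSpace E] [MeasurableSpace S] [MeasurableSpace Ω]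

/-- The kernel that draws a noise variable from `ν` and applies `Φ` to the state and the noise. -/
def noiseKernel (ν : Measure S) (Φ : E × S → Ω) : Kernel E Ω :=
  (Kernel.id ×ₖ Kernel.const E ν).map Φ

variable {ν : Measure S} [IsProbabilityMeasure ν] {Φ : E × S → Ω}

theorem noiseKernel_apply (hΦ : Measurable Φ) (x : E) :
    noiseKernel ν Φ x = ν.map fun z => Φ (x, z) := by
  rw [noiseKernel, Kernel.map_apply _ hΦ, Kernel.prod_apply, Kernel.id_apply, Kernel.const_apply,
    Measure.dirac_prod, Measure.map_map hΦ measurable_prodMk_left]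
  rfl

theorem isMarkovKernel_noiseKernel (hΦ : Measurable Φ) : IsMarkovKernel (noiseKernel ν Φ) := by
  unfold noiseKernel
  exact Kernel.IsMarkovKernel.map _ hΦ

theorem lintegral_noiseKernel (hΦ : Measurable Φ) (x : E) {F : Ω → ℝ≥0∞} (hF : Measurable F) :
    ∫⁻ w, F w ∂(noiseKernel ν Φ x) = ∫⁻ z, F (Φ (x, z)) ∂ν := by
  have hΦx : Measurable fun z => Φ (x, z) := hΦ.comp measurable_prodMk_left
  rw [noiseKernel_apply hΦ, lintegral_map hF hΦx]

theorem integral_noiseKernel (hΦ : Measurable Φ) (x : E) {f : Ω → ℝ} (hf : Measurable f) :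
    ∫ w, f w ∂(noiseKernel ν Φ x) = ∫ z, f (Φ (x, z)) ∂ν := by
  have hΦx : Measurable fun z => Φ (x, z) := hΦ.comp measurable_prodMk_left
  rw [noiseKernel_apply hΦ, integral_map hΦx.aemeasurable hf.aestronglyMeasurable]

theorem blockUpdate_ae_eq_noiseKernel [StandardBorelSpace Ω] [Nonempty Ω] {π : Measure Ω}
    [IsFiniteMeasure π] {X : Ω → E} (hX : Measurable X) (hΦ : Measurable Φ)
    (hXΦ : ∀ x z, X (Φ (x, z)) = x) {μ : Measure E} {Z : E → ℝ≥0∞}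
    (hπ : ∀ F : Ω → ℝ≥0∞, Measurable F →
      ∫⁻ w, F w ∂π = ∫⁻ x, Z x * ∫⁻ z, F (Φ (x, z)) ∂ν ∂μ) :
    ∀ᵐ w ∂π, blockUpdate π X hX w = noiseKernel ν Φ (X w) := by
  have _ := isMarkovKernel_noiseKernel (ν := ν) hΦ
  refine ae_of_ae_map hX.aemeasurable
    (p := fun x => condDistrib id X π x = noiseKernel ν Φ x) ?_
  refine condDistrib_ae_eq_of_measure_eq_compProd X aemeasurable_id ?_
  refine Measure.ext_of_lintegral _ fun F hF => ?_
  have hredraw : Measurable fun x => ∫⁻ w, F (x, w) ∂noiseKernel ν Φ x :=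
    hF.lintegral_kernel_prod_right'
  rw [lintegral_map hF (hX.prodMk measurable_id), Measure.lintegral_compProd hF,
    lintegral_map hredraw hX, hπ (fun w => F (X w, id w)) (hF.comp (hX.prodMk measurable_id)),
    hπ (fun w => ∫⁻ w', F (X w, w') ∂noiseKernel ν Φ (X w)) (hredraw.comp hX)]
  refine lintegral_congr fun x => ?_
  have hFx : Measurable fun w => F (x, w) := hF.comp measurable_prodMk_left
  simp only [id_eq, hXΦ, lintegral_const, measure_univ, mul_one, lintegral_noiseKernel hΦ x hFx]

end NoiseKernel

/-! ### The posterior -/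

theorem gaussianPDF_add_left (a b : ℝ) (v : ℝ≥0) (x : ℝ) :
    gaussianPDF (a + b) v x = gaussianPDF a v (x - b) := by
  simp only [gaussianPDF, gaussianPDFReal]
  congr 4
  ring

theorem gaussianPDF_swap (m : ℝ) (v : ℝ≥0) (x : ℝ) : gaussianPDF m v x = gaussianPDF x v m := by
  simp only [gaussianPDF, gaussianPDFReal]
  congr 4
  ring

theorem gaussianPDF_le (m : ℝ) (v : ℝ≥0) (x : ℝ) :
    gaussianPDF m v x ≤ ENNReal.ofReal (√(2 * Real.pi * v))⁻¹ := by
  refine ENNReal.ofReal_le_ofReal (mul_le_of_le_one_right (by positivity) ?_)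
  rw [Real.exp_le_one_iff, neg_div, neg_nonpos]
  positivity

instance sFinite_globalPrior (μpr : ℝ) (τpr : ℝ≥0) : SFinite (globalPrior μpr τpr) := by
  unfold globalPrior
  split_ifs <;> infer_instance

theorem globalPrior_ne_zero (μpr : ℝ) (τpr : ℝ≥0) : globalPrior μpr τpr ≠ 0 := by
  rw [globalPrior]
  split_ifs
  · exact NeZero.ne volume
  · exact IsProbabilityMeasure.ne_zero _

theorem globalPrior_le_smul_volume (μpr : ℝ) (τpr : ℝ≥0) :
    ∃ A : ℝ≥0, globalPrior μpr τpr ≤ A • volume := by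
  obtain ⟨A, hA, hprior⟩ := globalPrior_eq_withDensity μpr τpr
  refine ⟨(A * Real.exp (τpr * μpr ^ 2 / 2)).toNNReal, ?_⟩
  rw [hprior, ENNReal.smul_def, ← withDensity_const]
  refine withDensity_mono (ae_of_all _ fun a => ENNReal.ofReal_le_ofReal ?_)
  have hsq : 0 ≤ (τpr : ℝ) * (a - μpr) ^ 2 := by positivity
  gcongr
  linarith

section LIntegralProd

variable {α β δ : Type*} [MeasurableSpace α] [MeasurableSpace β] [MeasurableSpace δ]
  {μ : Measure α} {ν : Measure β} {ρ : Measure δ} [SFinite μ] [SFinite ν] [SFinite ρ]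

theorem lintegral_prod_prod_fst {F : α × β × δ → ℝ≥0∞} (hF : Measurable F) :
    ∫⁻ x, F x ∂(μ.prod (ν.prod ρ)) = ∫⁻ y, ∫⁻ x, ∫⁻ z, F (x, y, z) ∂ρ ∂μ ∂ν := by
  have hinner : Measurable fun x : α × β => ∫⁻ z, F (x.1, x.2, z) ∂ρ :=
    Measurable.lintegral_prod_right' (f := fun x : (α × β) × δ => F (x.1.1, x.1.2, x.2))
      (hF.comp (by fun_prop))
  rw [lintegral_prod _ hF.aemeasurable]
  refine (lintegral_congr fun x => ?_).trans (lintegral_lintegral_swap hinner.aemeasurable)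
  exact lintegral_prod _ (hF.comp measurable_prodMk_left).aemeasurable

theorem lintegral_prod_prod_snd {F : α × β × δ → ℝ≥0∞} (hF : Measurable F) :
    ∫⁻ x, F x ∂(μ.prod (ν.prod ρ)) = ∫⁻ z, ∫⁻ x, ∫⁻ y, F (x, y, z) ∂ν ∂μ ∂ρ := by
  have hinner : Measurable fun x : α × δ => ∫⁻ y, F (x.1, y, x.2) ∂ν :=
    Measurable.lintegral_prod_right' (f := fun x : (α × δ) × β => F (x.1.1, x.2, x.1.2))
      (hF.comp (by fun_prop))
  rw [lintegral_prod _ hF.aemeasurable]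
  refine (lintegral_congr fun x => ?_).trans (lintegral_lintegral_swap hinner.aemeasurable)
  exact lintegral_prod_symm' _ (hF.comp measurable_prodMk_left)

end LIntegralProd

section Posterior

variable {N I₁ I₂ : ℕ} (D : Design N I₁ I₂) (γ : Precisions) (μpr : ℝ) (τpr : ℝ≥0) (y : Fin N → ℝ)

/-- Prior times likelihood: the posterior before normalization. -/
def Design.jointDensity : Measure (Param I₁ I₂) :=
  (prior I₁ I₂ γ μpr τpr).withDensity (D.likelihood γ y)

/-- The exact draw of `(a⁰, a¹)` given `a²`, as a function of `a²` and the noise. -/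
def Design.draw₁ (x : (Fin I₂ → ℝ) × ℝ × (Fin I₁ → ℝ)) : Param I₁ I₂ :=
  let w := blockDraw D.lev₁ γ.τ γ.τ₁ μpr τpr (fun n => y n - x.1 (D.lev₂ n)) x.2
  (w.1, w.2, x.1)

/-- The exact draw of `(a⁰, a²)` given `a¹`, as a function of `a¹` and the noise. -/
def Design.draw₂ (x : (Fin I₁ → ℝ) × ℝ × (Fin I₂ → ℝ)) : Param I₁ I₂ :=
  let w := blockDraw D.lev₂ γ.τ γ.τ₂ μpr τpr (fun n => y n - x.1 (D.lev₁ n)) x.2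
  (w.1, x.1, w.2)

theorem Design.measurable_draw₁ : Measurable (D.draw₁ γ μpr τpr y) := by
  have h := (measurable_blockDraw D.lev₁ γ.τ γ.τ₁ μpr τpr).comp
    (f := fun x : (Fin I₂ → ℝ) × ℝ × (Fin I₁ → ℝ) => (fun n => y n - x.1 (D.lev₂ n), x.2))
    (by fun_prop)
  exact h.fst.prodMk (h.snd.prodMk measurable_fst)

theorem Design.measurable_draw₂ : Measurable (D.draw₂ γ μpr τpr y) := by
  have h := (measurable_blockDraw D.lev₂ γ.τ γ.τ₂ μpr τpr).comp
    (f := fun x : (Fin I₁ → ℝ) × ℝ × (Fin I₂ → ℝ) => (fun n => y n - x.1 (D.lev₁ n), x.2))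
    (by fun_prop)
  exact h.fst.prodMk (measurable_fst.prodMk h.snd)

@[fun_prop]
theorem Design.measurable_likelihood : Measurable (D.likelihood γ y) := by
  unfold Design.likelihood Design.predictor gaussianPDF gaussianPDFReal
  fun_prop

theorem Design.likelihood_eq₁ (θ : Param I₁ I₂) : D.likelihood γ y θ
    = ∏ n, gaussianPDF (θ.1 + θ.2.1 (D.lev₁ n)) γ.τ⁻¹ (y n - θ.2.2 (D.lev₂ n)) :=
  Finset.prod_congr rfl fun _ _ => gaussianPDF_add_left _ _ _ _

theorem Design.likelihood_eq₂ (θ : Param I₁ I₂) : D.likelihood γ y θ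
    = ∏ n, gaussianPDF (θ.1 + θ.2.2 (D.lev₂ n)) γ.τ⁻¹ (y n - θ.2.1 (D.lev₁ n)) :=
  Finset.prod_congr rfl fun _ _ => by
    rw [← gaussianPDF_add_left, predictor, add_right_comm]

theorem Design.lintegral_jointDensity {F : Param I₁ I₂ → ℝ≥0∞} (hF : Measurable F) :
    ∫⁻ θ, F θ ∂(D.jointDensity γ μpr τpr y)
      = ∫⁻ θ, D.likelihood γ y θ * F θ ∂(prior I₁ I₂ γ μpr τpr) :=
  lintegral_withDensity_eq_lintegral_mul _ (D.measurable_likelihood γ y) hF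

variable {γ}

theorem Design.prior_absolutelyContinuous (hτ : 0 < γ.τ) :
    prior I₁ I₂ γ μpr τpr ≪ D.jointDensity γ μpr τpr y := by
  refine withDensity_absolutelyContinuous' (D.measurable_likelihood γ y).aemeasurable
    (ae_of_all _ fun θ => Finset.prod_ne_zero_iff.2 fun n _ => ?_)
  exact (gaussianPDF_pos _ (inv_ne_zero hτ.ne') _).ne'

theorem Design.jointDensity_univ_ne_zero (hτ : 0 < γ.τ) :
    D.jointDensity γ μpr τpr y Set.univ ≠ 0 := fun hzero => by
  have h := D.prior_absolutelyContinuous μpr τpr y hτ hzero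
  rw [prior, ← Set.univ_prod_univ, Measure.prod_prod, mul_eq_zero,
    Measure.measure_univ_eq_zero] at h
  exact h.elim (globalPrior_ne_zero μpr τpr) (by simp)

variable [NeZero N]

theorem Design.lintegral_likelihood_le (hτ : 0 < γ.τ) :
    ∃ C : ℝ≥0, ∀ x, ∫⁻ a, D.likelihood γ y (a, x) ∂(globalPrior μpr τpr) ≤ C := by
  obtain ⟨A, hA⟩ := globalPrior_le_smul_volume μpr τpr
  set M : ℝ≥0 := (√(2 * Real.pi * (γ.τ⁻¹ : ℝ≥0)))⁻¹.toNNReal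
  let n₀ : Fin N := ⟨0, NeZero.pos N⟩
  refine ⟨A * ∏ _n ∈ Finset.univ.erase n₀, M, fun x => ?_⟩
  -- One observation makes the likelihood integrable; the others contribute bounded factors.
  have hle (a : ℝ) : D.likelihood γ y (a, x) ≤ (∏ _n ∈ Finset.univ.erase n₀, (M : ℝ≥0∞)) *
      gaussianPDF (y n₀ - (x.1 (D.lev₁ n₀) + x.2 (D.lev₂ n₀))) γ.τ⁻¹ a := by
    rw [likelihood, ← Finset.mul_prod_erase _ _ (Finset.mem_univ n₀), mul_comm,
      gaussianPDF_swap _ _ a, ← gaussianPDF_add_left, predictor, add_assoc]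
    exact mul_le_mul_left (Finset.prod_le_prod' fun n _ => gaussianPDF_le _ _ _) _
  refine (lintegral_mono' hA hle).trans ?_
  rw [lintegral_smul_measure, lintegral_const_mul _ (measurable_gaussianPDF _ _),
    lintegral_gaussianPDF_eq_one _ (inv_ne_zero hτ.ne'), mul_one, ENNReal.smul_def, smul_eq_mul,
    ENNReal.coe_mul, ENNReal.ofNNReal_finsetProd]

theorem Design.map_snd_jointDensity_le (hτ : 0 < γ.τ) :
    ∃ C : ℝ≥0, (D.jointDensity γ μpr τpr y).map Prod.snd
      ≤ C • (Measure.pi fun _ => gaussianReal 0 γ.τ₁⁻¹).prod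
        (Measure.pi fun _ => gaussianReal 0 γ.τ₂⁻¹) := by
  obtain ⟨C, hC⟩ := D.lintegral_likelihood_le μpr τpr y hτ
  refine ⟨C, Measure.le_iff.2 fun s hs => ?_⟩
  rw [Measure.map_apply measurable_snd hs, jointDensity, withDensity_apply _ (measurable_snd hs),
    ← Set.univ_prod, prior, ← Measure.prod_restrict, Measure.restrict_univ,
    lintegral_prod_symm' _ (D.measurable_likelihood γ y)]
  refine (lintegral_mono fun x => hC x).trans_eq ?_
  rw [setLIntegral_const]
  rfl

theorem Design.jointDensity_univ_ne_top (hτ : 0 < γ.τ) :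
    D.jointDensity γ μpr τpr y Set.univ ≠ ∞ := by
  obtain ⟨C, hC⟩ := D.map_snd_jointDensity_le μpr τpr y hτ
  have h := hC Set.univ
  rw [Measure.map_apply measurable_snd MeasurableSet.univ, Set.preimage_univ] at h
  exact ne_top_of_le_ne_top (measure_ne_top _ _) h

theorem Design.exists_posterior_eq_smul (hτ : 0 < γ.τ) :
    ∃ c : ℝ≥0∞, c ≠ 0 ∧ c ≠ ∞ ∧
      D.posterior γ μpr τpr y = c • D.jointDensity γ μpr τpr y := by
  refine ⟨(D.jointDensity γ μpr τpr y Set.univ)⁻¹,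
    ENNReal.inv_ne_zero.2 (D.jointDensity_univ_ne_top μpr τpr y hτ),
    ENNReal.inv_ne_top.2 (D.jointDensity_univ_ne_zero μpr τpr y hτ), ?_⟩
  rw [posterior, ProbabilityTheory.cond, Measure.restrict_univ]
  rfl

theorem Design.isProbabilityMeasure_posterior (hτ : 0 < γ.τ) :
    IsProbabilityMeasure (D.posterior γ μpr τpr y) :=
  cond_isProbabilityMeasure_of_finite (D.jointDensity_univ_ne_zero μpr τpr y hτ)
    (D.jointDensity_univ_ne_top μpr τpr y hτ)

theorem Design.ae_pi_of_ae_posterior (hτ : 0 < γ.τ) {p : (Fin I₂ → ℝ) → Prop}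
    (h : ∀ᵐ θ ∂(D.posterior γ μpr τpr y), p θ.2.2) :
    ∀ᵐ b ∂(Measure.pi fun _ : Fin I₂ => gaussianReal 0 γ.τ₂⁻¹), p b := by
  obtain ⟨c, hc0, -, hc⟩ := D.exists_posterior_eq_smul μpr τpr y hτ
  rw [hc, Measure.ae_ennreal_smul_measure_iff hc0] at h
  have hprior : ∀ᵐ θ ∂(prior I₁ I₂ γ μpr τpr), p θ.2.2 :=
    (D.prior_absolutelyContinuous μpr τpr y hτ).ae_le h
  have _ : (ae (globalPrior μpr τpr)).NeBot := ae_neBot.2 (globalPrior_ne_zero μpr τpr)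
  obtain ⟨a, ha⟩ := (Measure.ae_ae_of_ae_prod hprior).exists
  obtain ⟨_, hx⟩ := (Measure.ae_ae_of_ae_prod ha).exists
  exact hx

theorem Design.memLp_effect₂ (hτ : 0 < γ.τ) (j : Fin I₂) :
    MemLp (fun θ : Param I₁ I₂ => θ.2.2 j) 2 (D.posterior γ μpr τpr y) := by
  obtain ⟨c, -, hctop, hc⟩ := D.exists_posterior_eq_smul μpr τpr y hτ
  obtain ⟨C, hC⟩ := D.map_snd_jointDensity_le μpr τpr y hτ
  have hgaussian : MemLp (fun x : (Fin I₁ → ℝ) × (Fin I₂ → ℝ) => x.2 j) 2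
      ((Measure.pi fun _ => gaussianReal 0 γ.τ₁⁻¹).prod
        (Measure.pi fun _ => gaussianReal 0 γ.τ₂⁻¹)) :=
    ((memLp_id_gaussianReal' 2 (by norm_num)).comp_measurePreserving
      (measurePreserving_eval (fun _ : Fin I₂ => gaussianReal 0 γ.τ₂⁻¹) j)).comp_measurePreserving
      measurePreserving_snd
  have hjoint := hgaussian.of_measure_le_smul ENNReal.coe_ne_top hC
  rw [hc]
  exact ((memLp_map_measure_iff hjoint.1 measurable_snd.aemeasurable).1 hjoint).smul_measure hctop

theorem Design.lintegral_posterior₁ (hτ : 0 < γ.τ) (hτ₁ : 0 < γ.τ₁) :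
    ∃ Z : (Fin I₂ → ℝ) → ℝ≥0∞, ∀ F : Param I₁ I₂ → ℝ≥0∞, Measurable F →
      ∫⁻ θ, F θ ∂(D.posterior γ μpr τpr y)
        = ∫⁻ b, Z b * ∫⁻ z, F (D.draw₁ γ μpr τpr y (b, z)) ∂(blockNoise (Fin I₁))
          ∂(Measure.pi fun _ => gaussianReal 0 γ.τ₂⁻¹) := by
  obtain ⟨c, -, hctop, hc⟩ := D.exists_posterior_eq_smul μpr τpr y hτ
  choose Z hZ using fun b : Fin I₂ → ℝ =>
    lintegral_block D.lev₁ (fun n => y n - b (D.lev₂ n)) hτ hτ₁ μpr τpr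
  refine ⟨fun b => c * Z b, fun F hF => ?_⟩
  rw [hc, lintegral_smul_measure, D.lintegral_jointDensity γ μpr τpr y hF, prior,
    lintegral_prod_prod_snd (by fun_prop), smul_eq_mul, ← lintegral_const_mul' _ _ hctop]
  refine lintegral_congr fun b => ?_
  simp only [D.likelihood_eq₁, mul_assoc c]
  exact congrArg _ (hZ b (fun x => F (x.1, x.2, b)) (hF.comp (by fun_prop)))

theorem Design.lintegral_posterior₂ (hτ : 0 < γ.τ) (hτ₂ : 0 < γ.τ₂) :
    ∃ Z : (Fin I₁ → ℝ) → ℝ≥0∞, ∀ F : Param I₁ I₂ → ℝ≥0∞, Measurable F →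
      ∫⁻ θ, F θ ∂(D.posterior γ μpr τpr y)
        = ∫⁻ b, Z b * ∫⁻ z, F (D.draw₂ γ μpr τpr y (b, z)) ∂(blockNoise (Fin I₂))
          ∂(Measure.pi fun _ => gaussianReal 0 γ.τ₁⁻¹) := by
  obtain ⟨c, -, hctop, hc⟩ := D.exists_posterior_eq_smul μpr τpr y hτ
  choose Z hZ using fun b : Fin I₁ → ℝ =>
    lintegral_block D.lev₂ (fun n => y n - b (D.lev₁ n)) hτ hτ₂ μpr τpr
  refine ⟨fun b => c * Z b, fun F hF => ?_⟩
  rw [hc, lintegral_smul_measure, D.lintegral_jointDensity γ μpr τpr y hF, prior,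
    lintegral_prod_prod_fst (by fun_prop), smul_eq_mul, ← lintegral_const_mul' _ _ hctop]
  refine lintegral_congr fun b => ?_
  simp only [D.likelihood_eq₂, mul_assoc c]
  exact congrArg _ (hZ b (fun x => F (x.1, b, x.2)) (hF.comp (by fun_prop)))

theorem Design.blockUpdate_ae_eq₁ (hτ : 0 < γ.τ) (hτ₁ : 0 < γ.τ₁) :
    ∀ᵐ θ ∂(D.posterior γ μpr τpr y),
      blockUpdate (D.posterior γ μpr τpr y) (fun θ => θ.2.2)
        (measurable_snd.comp measurable_snd) θ
      = noiseKernel (blockNoise (Fin I₁)) (D.draw₁ γ μpr τpr y) θ.2.2 := by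
  obtain ⟨Z, hZ⟩ := D.lintegral_posterior₁ μpr τpr y hτ hτ₁
  exact blockUpdate_ae_eq_noiseKernel (X := fun θ : Param I₁ I₂ => θ.2.2)
    (measurable_snd.comp measurable_snd) (D.measurable_draw₁ γ μpr τpr y) (fun _ _ => rfl) hZ

theorem Design.blockUpdate_ae_eq₂ (hτ : 0 < γ.τ) (hτ₂ : 0 < γ.τ₂) :
    ∀ᵐ θ ∂(D.posterior γ μpr τpr y),
      blockUpdate (D.posterior γ μpr τpr y) (fun θ => θ.2.1)
        (measurable_fst.comp measurable_snd) θ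
      = noiseKernel (blockNoise (Fin I₂)) (D.draw₂ γ μpr τpr y) θ.2.1 := by
  obtain ⟨Z, hZ⟩ := D.lintegral_posterior₂ μpr τpr y hτ hτ₂
  exact blockUpdate_ae_eq_noiseKernel (X := fun θ : Param I₁ I₂ => θ.2.1)
    (measurable_fst.comp measurable_snd) (D.measurable_draw₂ γ μpr τpr y) (fun _ _ => rfl) hZ

end Posterior

/-! ### Semantics of straight-line programs -/

section Exec

variable {R : Type} [DecidableEq R]

theorem measurable_update_pair {ι : Type*} [DecidableEq ι] (d : ι) :
    Measurable fun x : (ι → ℝ) × ℝ => Function.update x.1 d x.2 := by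
  refine measurable_pi_iff.2 fun r => ?_
  rcases eq_or_ne r d with rfl | h
  · simpa only [Function.update_self] using measurable_snd
  · simpa only [Function.update_of_ne h] using measurable_fst.eval

theorem exec_nil (s : R → ℝ) : exec [] s = Measure.dirac s := Kernel.id_apply s

theorem exec_append (p q : List (Instr R)) : exec (p ++ q) = exec q ∘ₖ exec p := by
  induction p with
  | nil => exact (Kernel.comp_id _).symm
  | cons i p ih =>
    change exec (p ++ q) ∘ₖ i.step = exec q ∘ₖ (exec p ∘ₖ i.step)
    rw [ih, Kernel.comp_assoc]

theorem exec_append_of_eq_dirac {p : List (Instr R)} {s s' : R → ℝ}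
    (h : exec p s = Measure.dirac s') (q : List (Instr R)) : exec (p ++ q) s = exec q s' := by
  rw [exec_append, Kernel.comp_apply, h, Measure.dirac_bind (exec q).measurable]

theorem exec_assign (d : R) (g : (R → ℝ) → ℝ) (hg : Measurable g) (p : List (Instr R))
    (s : R → ℝ) : (exec p ∘ₖ assign d g hg) s = exec p (Function.update s d (g s)) := by
  rw [assign, Kernel.comp_deterministic_eq_comap, Kernel.comap_apply]

variable (p : List (Instr R)) (s : R → ℝ) (d a b : R)

theorem exec_const (c : ℝ) : exec (.const d c :: p) s = exec p (Function.update s d c) :=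
  exec_assign d _ measurable_const p s

theorem exec_add : exec (.add d a b :: p) s = exec p (Function.update s d (s a + s b)) :=
  exec_assign d _ (by fun_prop) p s

theorem exec_sub : exec (.sub d a b :: p) s = exec p (Function.update s d (s a - s b)) :=
  exec_assign d _ (by fun_prop) p s

theorem exec_mul : exec (.mul d a b :: p) s = exec p (Function.update s d (s a * s b)) :=
  exec_assign d _ (by fun_prop) p s

theorem exec_div : exec (.div d a b :: p) s = exec p (Function.update s d (s a / s b)) :=
  exec_assign d _ (by fun_prop) p s

theorem exec_sqrt : exec (.sqrt d a :: p) s = exec p (Function.update s d (√(s a))) :=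
  exec_assign d _ (by fun_prop) p s

theorem lintegral_exec_gauss {F : (R → ℝ) → ℝ≥0∞} (hF : Measurable F) :
    ∫⁻ w, F w ∂(exec (.gauss d :: p) s)
      = ∫⁻ x, ∫⁻ w, F w ∂(exec p (Function.update s d x)) ∂(gaussianReal 0 1) := by
  change ∫⁻ w, F w ∂((exec p ∘ₖ noiseKernel (gaussianReal 0 1)
    fun x : (R → ℝ) × ℝ => Function.update x.1 d x.2) s) = _
  rw [Kernel.lintegral_comp _ _ _ hF, lintegral_noiseKernel (measurable_update_pair d) _
    hF.lintegral_kernel]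

end Exec

theorem lintegral_update_pi {ι : Type*} [Fintype ι] [DecidableEq ι] (ν : Measure ℝ)
    [IsProbabilityMeasure ν] (i : ι) {H : (ι → ℝ) → ℝ≥0∞} (hH : Measurable H) :
    ∫⁻ x, ∫⁻ z, H (Function.update z i x) ∂(Measure.pi fun _ => ν) ∂ν
      = ∫⁻ z, H z ∂(Measure.pi fun _ => ν) := by
  have hupdate : Measurable fun x : (ι → ℝ) × ℝ => H (Function.update x.1 i x.2) :=
    hH.comp (measurable_update_pair i)
  have hinner : Measurable fun z : ι → ℝ => ∫⁻ x, H (Function.update z i x) ∂ν :=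
    hupdate.lintegral_prod_right'
  rw [← lintegral_lintegral_swap (f := fun z x => H (Function.update z i x)) hupdate.aemeasurable,
    lintegral_eq_lmarginal_univ 0, lintegral_eq_lmarginal_univ 0,
    lmarginal_erase' _ hinner (Finset.mem_univ i), lmarginal_erase' _ hH (Finset.mem_univ i)]
  simp only [Function.update_idem, lintegral_const, measure_univ, mul_one]

/-! ### The program for one block update -/

section BlockProgram

variable {N I₁ I₂ : ℕ}

open Instr Reg

/-- The instructions of `blockProgram` that reset the accumulators of level `i`. -/
def resetLevel (i : Fin I₁) : List (Instr (Reg N I₁ I₂)) :=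
  [const (sum₁ i) 0, const (cnt₁ i) 0]

/-- The instructions of `blockProgram` that process observation `n`. -/
def readObservation (lev : Fin N → Fin I₁) (lev' : Fin N → Fin I₂) (n : Fin N) :
    List (Instr (Reg N I₁ I₂)) :=
  [sub v (data n) (a₂ (lev' n)), add (sum₁ (lev n)) (sum₁ (lev n)) v,
    add (cnt₁ (lev n)) (cnt₁ (lev n)) one]

/-- The instructions of `blockProgram` that add the contribution of level `i` to the precision and
the linear coefficient of the global effect. -/
def accumulateLevel (i : Fin I₁) : List (Instr (Reg N I₁ I₂)) :=
  [mul u (cnt₁ i) lik, add u u fac, div u fac u, mul u u lik,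
    mul v u (sum₁ i), add lin lin v, mul v u (cnt₁ i), add prec prec v]

/-- The instructions of `blockProgram` that draw the effect of level `i`. -/
def drawLevel (i : Fin I₁) : List (Instr (Reg N I₁ I₂)) :=
  [mul u (cnt₁ i) lik, add u u fac, mul v (cnt₁ i) a₀, sub v (sum₁ i) v, mul v v lik, div v v u,
    gauss z, sqrt u u, div z z u, add (a₁ i) v z]

theorem exec_resetLevels (l : List (Fin I₁)) (s : Reg N I₁ I₂ → ℝ) :
    ∃ s', exec (l.flatMap resetLevel) s = Measure.dirac s' ∧
      (∀ i, s' (sum₁ i) = if i ∈ l then 0 else s (sum₁ i)) ∧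
      (∀ i, s' (cnt₁ i) = if i ∈ l then 0 else s (cnt₁ i)) ∧
      ∀ r, (∀ i, r ≠ sum₁ i) → (∀ i, r ≠ cnt₁ i) → s' r = s r := by
  induction l generalizing s with
  | nil => exact ⟨s, exec_nil s, by simp, by simp, fun r _ _ => rfl⟩
  | cons k l ih =>
    obtain ⟨s', hexec, hsum, hcnt, hframe⟩ :=
      ih (Function.update (Function.update s (sum₁ k) 0) (cnt₁ k) 0)
    refine ⟨s', by simpa only [List.flatMap_cons, resetLevel, List.cons_append, List.nil_append,
      exec_const] using hexec, fun i => ?_, fun i => ?_, fun r hsum' hcnt' => ?_⟩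
    · rcases eq_or_ne i k with rfl | hi <;> simp [*]
    · rcases eq_or_ne i k with rfl | hi <;> simp [*]
    · rw [hframe r hsum' hcnt', Function.update_of_ne (hcnt' k), Function.update_of_ne (hsum' k)]

theorem exec_readObservations (lev : Fin N → Fin I₁) (lev' : Fin N → Fin I₂) (l : List (Fin N))
    (s : Reg N I₁ I₂ → ℝ) :
    ∃ s', exec (l.flatMap (readObservation lev lev')) s = Measure.dirac s' ∧
      (∀ i, s' (sum₁ i) = s (sum₁ i)
        + (l.map fun n => if lev n = i then s (data n) - s (a₂ (lev' n)) else 0).sum) ∧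
      (∀ i, s' (cnt₁ i) = s (cnt₁ i) + (l.map fun n => if lev n = i then s one else 0).sum) ∧
      ∀ r, (∀ i, r ≠ sum₁ i) → (∀ i, r ≠ cnt₁ i) → r ≠ v → s' r = s r := by
  induction l generalizing s with
  | nil => exact ⟨s, exec_nil s, by simp, by simp, fun r _ _ _ => rfl⟩
  | cons k l ih =>
    simp only [List.flatMap_cons, readObservation, List.cons_append, List.nil_append, exec_sub,
      exec_add]
    obtain ⟨s', hexec, hsum, hcnt, hframe⟩ := ih _
    refine ⟨s', hexec, fun i => ?_, fun i => ?_, fun r hsum' hcnt' hv => ?_⟩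
    · rcases eq_or_ne (lev k) i with rfl | hi
      · simp [hsum, add_assoc]
      · simp [hsum, hi, hi.symm]
    · rcases eq_or_ne (lev k) i with rfl | hi
      · simp [hcnt, add_assoc]
      · simp [hcnt, hi, hi.symm]
    · rw [hframe r hsum' hcnt' hv, Function.update_of_ne (hcnt' _),
        Function.update_of_ne (hsum' _), Function.update_of_ne hv]

theorem exec_accumulateLevels (l : List (Fin I₁)) (s : Reg N I₁ I₂ → ℝ) :
    ∃ s', exec (l.flatMap accumulateLevel) s = Measure.dirac s' ∧
      s' lin = s lin
        + (l.map fun i => s fac / (s (cnt₁ i) * s lik + s fac) * s lik * s (sum₁ i)).sum ∧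
      s' prec = s prec
        + (l.map fun i => s fac / (s (cnt₁ i) * s lik + s fac) * s lik * s (cnt₁ i)).sum ∧
      ∀ r, r ≠ lin → r ≠ prec → r ≠ u → r ≠ v → s' r = s r := by
  induction l generalizing s with
  | nil => exact ⟨s, exec_nil s, by simp, by simp, fun r _ _ _ _ => rfl⟩
  | cons k l ih =>
    simp only [List.flatMap_cons, accumulateLevel, List.cons_append, List.nil_append, exec_mul,
      exec_add, exec_div]
    obtain ⟨s', hexec, hlin, hprec, hframe⟩ := ih _
    refine ⟨s', hexec, ?_, ?_, fun r hr_lin hr_prec hr_u hr_v => ?_⟩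
    · simp [hlin, add_assoc]
    · simp [hprec, add_assoc]
    · simp [hframe r hr_lin hr_prec hr_u hr_v, hr_lin, hr_prec, hr_u, hr_v]

/-- The part of the memory that a block update reads and writes: data and parameters. -/
def view (s : Reg N I₁ I₂ → ℝ) : (Fin N → ℝ) × Param I₁ I₂ := (fun n => s (data n), readParam s)

theorem measurable_view : Measurable (view : (Reg N I₁ I₂ → ℝ) → _) := by
  unfold view readParam
  fun_prop

theorem lintegral_exec_drawLevel (k : Fin I₁) (q : List (Instr (Reg N I₁ I₂)))
    (s : Reg N I₁ I₂ → ℝ) {F : (Reg N I₁ I₂ → ℝ) → ℝ≥0∞} (hF : Measurable F) :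
    ∃ t : ℝ → Reg N I₁ I₂ → ℝ,
      ∫⁻ w, F w ∂(exec (drawLevel k ++ q) s)
        = ∫⁻ x, ∫⁻ w, F w ∂(exec q (t x)) ∂(gaussianReal 0 1) ∧
      ∀ x, t x (a₁ k) = (s (sum₁ k) - s (cnt₁ k) * s a₀) * s lik / (s (cnt₁ k) * s lik + s fac)
          + x / √(s (cnt₁ k) * s lik + s fac) ∧
        ∀ r, r ≠ a₁ k → r ≠ u → r ≠ v → r ≠ z → t x r = s r := by
  simp only [drawLevel, List.cons_append, List.nil_append, exec_mul, exec_add, exec_sub, exec_div,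
    lintegral_exec_gauss _ _ _ hF, exec_sqrt]
  refine ⟨_, rfl, fun x => ⟨by simp, fun r hr_a hr_u hr_v hr_z => ?_⟩⟩
  simp [hr_a, hr_u, hr_v, hr_z]

theorem lintegral_exec_drawLevels {l : List (Fin I₁)} (hl : l.Nodup) (s : Reg N I₁ I₂ → ℝ)
    {G : (Fin N → ℝ) × Param I₁ I₂ → ℝ≥0∞} (hG : Measurable G) :
    ∫⁻ w, G (view w) ∂(exec (l.flatMap drawLevel) s)
    = ∫⁻ x, G (fun n => s (data n), s a₀, (fun i => if i ∈ l then
        (s (sum₁ i) - s (cnt₁ i) * s a₀) * s lik / (s (cnt₁ i) * s lik + s fac)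
          + x i / √(s (cnt₁ i) * s lik + s fac) else s (a₁ i)), fun j => s (a₂ j))
      ∂(Measure.pi fun _ => gaussianReal 0 1) := by
  have hGv : Measurable fun w : Reg N I₁ I₂ → ℝ => G (view w) := hG.comp measurable_view
  induction l generalizing s with
  | nil =>
    rw [List.flatMap_nil, exec_nil, lintegral_dirac' _ hGv]
    simp [view, readParam]
  | cons k l ih =>
    obtain ⟨hk, hl⟩ := List.nodup_cons.1 hl
    obtain ⟨t, ht, hst⟩ := lintegral_exec_drawLevel k (l.flatMap drawLevel) s hGv
    rw [List.flatMap_cons, ht, ← lintegral_update_pi (gaussianReal 0 1) k]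
    · refine lintegral_congr fun x => (ih hl (t x)).trans (lintegral_congr fun x' => ?_)
      obtain ⟨hdraw, hframe⟩ := hst x
      simp only [hframe, ne_eq, reduceCtorEq, not_false_eq_true]
      congr 4
      funext i
      rcases eq_or_ne i k with rfl | hi
      · simp [hk, hdraw]
      · simp [hi, hframe]
    · refine hG.comp (measurable_const.prodMk (measurable_const.prodMk
        (Measurable.prodMk (measurable_pi_iff.2 fun i => ?_) measurable_const)))
      split_ifs <;> fun_prop

/-- The memory `t` is what `blockProgram`, started from the memory `s`, has computed before the
first random draw, as far as the later instructions read it. -/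
structure IsSummary (lev : Fin N → Fin I₁) (lev' : Fin N → Fin I₂) (τ τk μpr τpr : ℝ)
    (s t : Reg N I₁ I₂ → ℝ) : Prop where
  data_eq : ∀ n, t (data n) = s (data n)
  a₂_eq : ∀ j, t (a₂ j) = s (a₂ j)
  lik_eq : t lik = τ
  fac_eq : t fac = τk
  cnt_eq : ∀ i, t (cnt₁ i) = levelCount lev i
  sum_eq : ∀ i, t (sum₁ i) = levelSum lev (fun n => s (data n) - s (a₂ (lev' n))) i
  prec_eq : t prec = globalPrec lev τ τk τpr
  lin_eq : t lin = globalLin lev τ τk μpr τpr fun n => s (data n) - s (a₂ (lev' n))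

theorem exec_computeSummary (lev : Fin N → Fin I₁) (lev' : Fin N → Fin I₂)
    (τ τk μpr τpr : ℝ) (s : Reg N I₁ I₂ → ℝ) :
    ∃ t, exec ([const lik τ, const fac τk, const one 1, const prec τpr, const lin μpr,
          mul lin lin prec] ++ (List.finRange I₁).flatMap resetLevel
        ++ (List.finRange N).flatMap (readObservation lev lev')
        ++ (List.finRange I₁).flatMap accumulateLevel) s = Measure.dirac t ∧
      IsSummary lev lev' τ τk μpr τpr s t := by
  simp only [List.append_assoc, List.cons_append, List.nil_append, exec_const, exec_mul]
  obtain ⟨s₁, hexec₁, hsum₁, hcnt₁, hframe₁⟩ := exec_resetLevels (List.finRange I₁) _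
  rw [exec_append_of_eq_dirac hexec₁]
  obtain ⟨s₂, hexec₂, hsum₂, hcnt₂, hframe₂⟩ := exec_readObservations lev lev' (List.finRange N) s₁
  rw [exec_append_of_eq_dirac hexec₂]
  obtain ⟨t, hexec₃, hlin, hprec, hframe₃⟩ := exec_accumulateLevels (List.finRange I₁) s₂
  have hsum (i) : s₂ (sum₁ i) = levelSum lev (fun n => s (data n) - s (a₂ (lev' n))) i := by
    simp [hsum₂, hsum₁, hframe₁, levelSum_apply, ← List.ofFn_eq_map, List.sum_ofFn]
  have hcnt (i) : s₂ (cnt₁ i) = levelCount lev i := by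
    simp [hcnt₂, hcnt₁, hframe₁, levelCount, ← List.ofFn_eq_map, List.sum_ofFn]
  refine ⟨t, hexec₃, ?_⟩
  constructor
  case prec_eq | lin_eq =>
    simp [hprec, hlin, hframe₂, hframe₁, hsum, hcnt, globalPrec, globalLin, levelWeight, levelPrec,
      mul_comm μpr, ← List.ofFn_eq_map, List.sum_ofFn]
  all_goals simp [hframe₃, hframe₂, hframe₁, hsum, hcnt]

theorem lintegral_exec_blockProgram₁ (lev : Fin N → Fin I₁) (lev' : Fin N → Fin I₂)
    (τ τk μpr τpr : ℝ) (s : Reg N I₁ I₂ → ℝ)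
    {G : (Fin N → ℝ) × Param I₁ I₂ → ℝ≥0∞} (hG : Measurable G) :
    ∫⁻ w, G (view w) ∂(exec (blockProgram lev lev' a₁ sum₁ cnt₁ a₂ τ τk μpr τpr) s)
    = ∫⁻ x, G (fun n => s (data n),
        (blockDraw lev τ τk μpr τpr (fun n => s (data n) - s (a₂ (lev' n))) x).1,
        (blockDraw lev τ τk μpr τpr (fun n => s (data n) - s (a₂ (lev' n))) x).2,
        fun j => s (a₂ j)) ∂(blockNoise (Fin I₁)) := by
  have hGv : Measurable fun w : Reg N I₁ I₂ → ℝ => G (view w) := hG.comp measurable_view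
  obtain ⟨t, hexec, ht⟩ := exec_computeSummary lev lev' τ τk μpr τpr s
  have hprogram : exec (blockProgram lev lev' a₁ sum₁ cnt₁ a₂ τ τk μpr τpr) s
      = exec (gauss z :: sqrt u prec :: div z z u :: div v lin prec :: add a₀ v z ::
        (List.finRange I₁).flatMap drawLevel) t := by
    rw [blockProgram, List.append_assoc]
    exact exec_append_of_eq_dirac hexec _
  have hblock := measurable_blockDraw_right lev τ τk μpr τpr
    fun n => s (data n) - s (a₂ (lev' n))
  have hGblock : Measurable fun x => G (fun n => s (data n),
      (blockDraw lev τ τk μpr τpr (fun n => s (data n) - s (a₂ (lev' n))) x).1,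
      (blockDraw lev τ τk μpr τpr (fun n => s (data n) - s (a₂ (lev' n))) x).2,
      fun j => s (a₂ j)) :=
    hG.comp (measurable_const.prodMk (hblock.fst.prodMk (hblock.snd.prodMk measurable_const)))
  rw [hprogram, lintegral_exec_gauss _ _ _ hGv, blockNoise,
    lintegral_prod _ hGblock.aemeasurable]
  refine lintegral_congr fun x => ?_
  rw [exec_sqrt, exec_div, exec_div, exec_add,
    lintegral_exec_drawLevels (List.nodup_finRange I₁) _ hG]
  refine lintegral_congr fun x' => ?_
  simp [blockDraw, globalDraw, ht.data_eq, ht.a₂_eq, ht.lik_eq, ht.fac_eq, ht.cnt_eq, ht.sum_eq,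
    ht.prec_eq, ht.lin_eq]
  rfl

end BlockProgram

section Rename

variable {R S : Type}

/-- Rename the registers of an instruction. It transports what is known about a program updating
the first factor to the same program updating the second. -/
def Instr.rename (e : R → S) : Instr R → Instr S
  | .const d c => .const (e d) c
  | .add d a b => .add (e d) (e a) (e b)
  | .sub d a b => .sub (e d) (e a) (e b)
  | .mul d a b => .mul (e d) (e a) (e b)
  | .div d a b => .div (e d) (e a) (e b)
  | .sqrt d a => .sqrt (e d) (e a)
  | .gauss d => .gauss (e d)

theorem lintegral_exec_rename [DecidableEq R] [DecidableEq S] (e : R ≃ S) (p : List (Instr R))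
    (s : S → ℝ) {F : (R → ℝ) → ℝ≥0∞} (hF : Measurable F) :
    ∫⁻ w, F (w ∘ e) ∂(exec (p.map (Instr.rename e)) s) = ∫⁻ w, F w ∂(exec p (s ∘ e)) := by
  have hFe : Measurable fun w : S → ℝ => F (w ∘ e) :=
    hF.comp (measurable_pi_iff.2 fun r => measurable_pi_apply (e r))
  have hupdate (s : S → ℝ) (d : R) (x : ℝ) :
      Function.update s (e d) x ∘ e = Function.update (s ∘ e) d x :=
    Function.update_comp_eq_of_injective _ e.injective _ _
  induction p generalizing s with
  | nil => rw [List.map_nil, exec_nil, exec_nil, lintegral_dirac' _ hFe, lintegral_dirac' _ hF]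
  | cons i p ih =>
    cases i <;> simp only [List.map_cons, Instr.rename, exec_const, exec_add, exec_sub, exec_mul,
      exec_div, exec_sqrt, lintegral_exec_gauss _ _ _ hFe, lintegral_exec_gauss _ _ _ hF, ih,
      hupdate, Function.comp_apply]

end Rename

section Swap

variable {N I₁ I₂ : ℕ}

open Instr Reg

/-- Exchange the roles of the two factors. -/
def Reg.swap : Reg N I₁ I₂ → Reg N I₂ I₁
  | data n => data n
  | a₀ => a₀
  | a₁ i => a₂ i
  | a₂ j => a₁ j
  | sum₁ i => sum₂ i
  | sum₂ j => sum₁ j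
  | cnt₁ i => cnt₂ i
  | cnt₂ j => cnt₁ j
  | lik => lik
  | fac => fac
  | one => one
  | prec => prec
  | lin => lin
  | u => u
  | v => v
  | z => z

/-- `Reg.swap` as an equivalence. -/
def Reg.swapEquiv : Reg N I₁ I₂ ≃ Reg N I₂ I₁ where
  toFun := Reg.swap
  invFun := Reg.swap
  left_inv r := by cases r <;> rfl
  right_inv r := by cases r <;> rfl

theorem map_rename_swap_blockProgram (lev : Fin N → Fin I₂) (lev' : Fin N → Fin I₁)
    (τ τk μpr τpr : ℝ) :
    (blockProgram lev lev' (a₁ : _ → Reg N I₂ I₁) sum₁ cnt₁ a₂ τ τk μpr τpr).map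
      (Instr.rename Reg.swapEquiv)
    = blockProgram lev lev' (a₂ : _ → Reg N I₁ I₂) sum₂ cnt₂ a₁ τ τk μpr τpr := by
  simp only [blockProgram, List.map_append, List.map_flatMap, List.map_cons, List.map_nil,
    Instr.rename]
  rfl

theorem lintegral_exec_blockProgram₂ (lev : Fin N → Fin I₂) (lev' : Fin N → Fin I₁)
    (τ τk μpr τpr : ℝ) (s : Reg N I₁ I₂ → ℝ)
    {G : Param I₁ I₂ → ℝ≥0∞} (hG : Measurable G) :
    ∫⁻ w, G (readParam w) ∂(exec (blockProgram lev lev' a₂ sum₂ cnt₂ a₁ τ τk μpr τpr) s)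
    = ∫⁻ x, G (
        (blockDraw lev τ τk μpr τpr (fun n => s (data n) - s (a₁ (lev' n))) x).1,
        (fun j => s (a₁ j)),
        (blockDraw lev τ τk μpr τpr (fun n => s (data n) - s (a₁ (lev' n))) x).2)
        ∂(blockNoise (Fin I₂)) := by
  rw [← map_rename_swap_blockProgram]
  let G' : (Fin N → ℝ) × Param I₂ I₁ → ℝ≥0∞ := fun x => G (x.2.1, x.2.2.2, x.2.2.1)
  have hG' : Measurable G' := hG.comp (by fun_prop)
  exact (lintegral_exec_rename Reg.swapEquiv _ s (F := fun w => G' (view w))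
    (hG'.comp measurable_view)).trans
    (lintegral_exec_blockProgram₁ lev lev' τ τk μpr τpr (s ∘ Reg.swapEquiv) hG')

end Swap

/-! ### One iteration -/

section Iteration

variable {N I₁ I₂ : ℕ} (D : Design N I₁ I₂) (γ : Precisions) (μpr : ℝ) (τpr : ℝ≥0) (y : Fin N → ℝ)

/-- The state after one iteration, as a function of the current state and the noise. -/
def Design.iterate
    (x : Param I₁ I₂ × ((ℝ × (Fin I₁ → ℝ)) × (ℝ × (Fin I₂ → ℝ)))) : Param I₁ I₂ :=
  D.draw₂ γ μpr τpr y ((D.draw₁ γ μpr τpr y (x.1.2.2, x.2.1)).2.1, x.2.2)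

theorem Design.measurable_iterate : Measurable (D.iterate γ μpr τpr y) := by
  have h : Measurable fun x : Param I₁ I₂ × ((ℝ × (Fin I₁ → ℝ)) × (ℝ × (Fin I₂ → ℝ))) =>
      D.draw₁ γ μpr τpr y (x.1.2.2, x.2.1) := (D.measurable_draw₁ γ μpr τpr y).comp (by fun_prop)
  exact (D.measurable_draw₂ γ μpr τpr y).comp (h.snd.fst.prodMk (by fun_prop))

/-- The transition kernel of `Design.iterate`. -/
def Design.iterateKernel : Kernel (Param I₁ I₂) (Param I₁ I₂) :=
  noiseKernel ((blockNoise (Fin I₁)).prod (blockNoise (Fin I₂))) (D.iterate γ μpr τpr y)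

theorem Design.lintegral_iterateKernel (θ : Param I₁ I₂) {G : Param I₁ I₂ → ℝ≥0∞}
    (hG : Measurable G) :
    ∫⁻ w, G w ∂(D.iterateKernel γ μpr τpr y θ)
      = ∫⁻ x, ∫⁻ x', G (D.draw₂ γ μpr τpr y ((D.draw₁ γ μpr τpr y (θ.2.2, x)).2.1, x'))
        ∂(blockNoise (Fin I₂)) ∂(blockNoise (Fin I₁)) := by
  have hiterate := D.measurable_iterate γ μpr τpr y
  have hGm : Measurable fun z => G (D.iterate γ μpr τpr y (θ, z)) :=
    hG.comp (hiterate.comp measurable_prodMk_left)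
  rw [iterateKernel, lintegral_noiseKernel hiterate _ hG, lintegral_prod _ hGm.aemeasurable]
  rfl

theorem Design.measurable_lintegral_draw₂ {G : Param I₁ I₂ → ℝ≥0∞} (hG : Measurable G) :
    Measurable fun q : (Fin N → ℝ) × Param I₁ I₂ =>
      ∫⁻ x, G (D.draw₂ γ μpr τpr q.1 (q.2.2.1, x)) ∂(blockNoise (Fin I₂)) := by
  have hresidual : Measurable fun p : ((Fin N → ℝ) × Param I₁ I₂) × (ℝ × (Fin I₂ → ℝ)) =>
      ((fun n => p.1.1 n - p.1.2.2.1 (D.lev₁ n), p.2) : (Fin N → ℝ) × (ℝ × (Fin I₂ → ℝ))) := by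
    fun_prop
  have hblock := (measurable_blockDraw D.lev₂ γ.τ γ.τ₂ μpr τpr).comp hresidual
  have hdraw : Measurable fun p : ((Fin N → ℝ) × Param I₁ I₂) × (ℝ × (Fin I₂ → ℝ)) =>
      D.draw₂ γ μpr τpr p.1.1 (p.1.2.2.1, p.2) :=
    hblock.fst.prodMk (Measurable.prodMk (by fun_prop) hblock.snd)
  exact (hG.comp hdraw).lintegral_prod_right'

theorem Design.iterationLaw_eq_iterateKernel (θ : Param I₁ I₂) :
    D.iterationLaw γ μpr τpr y θ = D.iterateKernel γ μpr τpr y θ := by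
  refine Measure.ext_of_lintegral _ fun G hG => ?_
  have hread : Measurable (readParam : (Reg N I₁ I₂ → ℝ) → _) := measurable_view.snd
  have hGread : Measurable fun s : Reg N I₁ I₂ → ℝ => G (readParam s) := hG.comp hread
  rw [iterationLaw, lintegral_map hG hread, iteration, exec_append,
    Kernel.lintegral_comp _ _ _ hGread, D.lintegral_iterateKernel γ μpr τpr y θ hG]
  simp_rw [lintegral_exec_blockProgram₂ _ _ _ _ _ _ _ hG]
  exact lintegral_exec_blockProgram₁ D.lev₁ D.lev₂ γ.τ γ.τ₁ μpr τpr (loadMem y θ)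
    (D.measurable_lintegral_draw₂ γ μpr τpr hG)

variable {γ} [NeZero N]

theorem Design.collapsedGibbs_ae_eq_iterateKernel (hτ : 0 < γ.τ) (hτ₁ : 0 < γ.τ₁)
    (hτ₂ : 0 < γ.τ₂) :
    ∀ᵐ θ ∂(D.posterior γ μpr τpr y),
      D.collapsedGibbs γ μpr τpr y θ = D.iterateKernel γ μpr τpr y θ := by
  have hblock₂ := ae_ae_of_invariant (invariant_blockUpdate (π := D.posterior γ μpr τpr y)
    (X := fun θ : Param I₁ I₂ => θ.2.2) (hX := measurable_snd.comp measurable_snd))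
    (D.blockUpdate_ae_eq₂ μpr τpr y hτ hτ₂)
  filter_upwards [D.blockUpdate_ae_eq₁ μpr τpr y hτ hτ₁, hblock₂] with θ hθ hθ'
  refine Measure.ext_of_lintegral _ fun G hG => ?_
  have hdraw₂ := D.measurable_draw₂ γ μpr τpr y
  have hinner : Measurable fun w : Param I₁ I₂ =>
      ∫⁻ x', G (D.draw₂ γ μpr τpr y (w.2.1, x')) ∂(blockNoise (Fin I₂)) :=
    Measurable.lintegral_prod_right' (f := fun p : Param I₁ I₂ × (ℝ × (Fin I₂ → ℝ)) =>
      G (D.draw₂ γ μpr τpr y (p.1.2.1, p.2))) (hG.comp (hdraw₂.comp (by fun_prop)))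
  rw [D.lintegral_iterateKernel γ μpr τpr y θ hG, collapsedGibbs, twoBlockGibbs,
    Kernel.lintegral_comp _ _ _ hG,
    lintegral_congr_ae (hθ'.mono fun w hw => by rw [hw, lintegral_noiseKernel hdraw₂ _ hG]), hθ,
    lintegral_noiseKernel (D.measurable_draw₁ γ μpr τpr y) _ hinner]

end Iteration

/-! ### Response of the sampler to a change of its state -/

section Response

variable {ν ι κ : Type*} [Fintype ν] [Fintype ι] [DecidableEq ι] (lev : ν → ι) (lev' : ν → κ)
  (τ τk μpr τpr : ℝ)

/-- The change of `blockDraw` caused by a change of the residuals. It is the draw without noise and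
with prior mean zero. -/
def residualResponse : (ν → ℝ) →ₗ[ℝ] ℝ × (ι → ℝ) where
  toFun r := blockDraw lev τ τk 0 τpr r 0
  map_add' r r' := by
    ext <;> simp [blockDraw, globalDraw, globalLin, effectDraw, effectMean, mul_add,
      Finset.sum_add_distrib] <;> ring
  map_smul' c r := by
    ext <;> simp [blockDraw, globalDraw, globalLin, effectDraw, effectMean, mul_left_comm _ c,
      ← Finset.mul_sum] <;> ring

theorem blockDraw_sub_blockDraw (r r' : ν → ℝ) (z : ℝ × (ι → ℝ)) :
    blockDraw lev τ τk μpr τpr r z - blockDraw lev τ τk μpr τpr r' z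
      = residualResponse lev τ τk τpr (r - r') := by
  rw [map_sub]
  ext <;> simp [residualResponse, blockDraw, globalDraw, globalLin, effectDraw, effectMean] <;> ring

/-- The change of the global effect and of the effects drawn by a block update caused by a change of
the effects of the other factor, which has the levels `lev'`. -/
def blockResponse : (κ → ℝ) →ₗ[ℝ] ℝ × (ι → ℝ) :=
  -(residualResponse lev τ τk τpr ∘ₗ LinearMap.funLeft ℝ ℝ lev')

theorem blockDraw_residual_sub (y : ν → ℝ) (b b' : κ → ℝ) (z : ℝ × (ι → ℝ)) :
    blockDraw lev τ τk μpr τpr (fun n => y n - b (lev' n)) z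
        - blockDraw lev τ τk μpr τpr (fun n => y n - b' (lev' n)) z
      = blockResponse lev lev' τ τk τpr (b - b') := by
  have hresidual : ((fun n => y n - b (lev' n)) - fun n => y n - b' (lev' n))
      = -LinearMap.funLeft ℝ ℝ lev' (b - b') := by
    ext n
    simp [LinearMap.funLeft_apply]
  rw [blockDraw_sub_blockDraw, hresidual, map_neg]
  rfl

/-- Shrinkage factor of the effect of a level with `n` observations. -/
def shrinkage (n τ τk : ℝ) : ℝ := n * τ / (n * τ + τk)

/-- Share of the prior in the conditional precision of the global effect, for `N` observations of
which each level has `n`. -/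
def priorShare (N n τ τk τpr : ℝ) : ℝ := τpr / (τpr + τk / (n * τ + τk) * τ * N)

variable [Nonempty ν] {lev lev' τ τk τpr}

theorem IsBalancedFactor.residualResponse_fst (h : IsBalancedFactor lev) (hτ : 0 < τ)
    (hτk : 0 < τk) (hτpr : 0 ≤ τpr) (r : ν → ℝ) :
    (residualResponse lev τ τk τpr r).1
      = (1 - priorShare (Fintype.card ν) (Fintype.card ν / Fintype.card ι) τ τk τpr)
        * 𝔼 n, r n := by
  have hprec : 0 < (Fintype.card ν / Fintype.card ι : ℝ) * τ + τk := by positivity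
  have hglobal :
      0 < τpr + τk / (Fintype.card ν / Fintype.card ι * τ + τk) * τ * Fintype.card ν := by
    have : (0 : ℝ) < Fintype.card ν := Nat.cast_pos.2 Fintype.card_pos
    positivity
  have hweight (i) : levelWeight lev τ τk i
      = τk / (Fintype.card ν / Fintype.card ι * τ + τk) * τ := by
    rw [levelWeight, levelPrec, h i]
  simp only [residualResponse, LinearMap.coe_mk, AddHom.coe_mk, blockDraw, globalDraw, globalLin,
    globalPrec, hweight, ← Finset.mul_sum, sum_levelSum, sum_levelCount, priorShare,
    Fintype.expect_eq_sum_div_card, Prod.fst_zero]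
  generalize (Fintype.card ν / Fintype.card ι : ℝ) * τ + τk = L at *
  field_simp
  ring

theorem IsBalancedFactor.residualResponse_snd (h : IsBalancedFactor lev) (hτ : 0 < τ)
    (hτk : 0 < τk) (hτpr : 0 ≤ τpr) (r : ν → ℝ) (i : ι) :
    (residualResponse lev τ τk τpr r).2 i
      = shrinkage (Fintype.card ν / Fintype.card ι) τ τk * (levelMean lev r i
        - (1 - priorShare (Fintype.card ν) (Fintype.card ν / Fintype.card ι) τ τk τpr)
          * 𝔼 n, r n) := by
  have hcount := h.levelCount_pos i
  rw [← h.residualResponse_fst hτ hτk hτpr, levelMean_apply, shrinkage, ← h i]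
  simp only [residualResponse, LinearMap.coe_mk, AddHom.coe_mk, blockDraw, effectDraw, effectMean,
    levelPrec, Prod.snd_zero, Pi.zero_apply, zero_div, add_zero]
  field_simp

theorem IsBalancedFactor.blockResponse_snd [Fintype κ] [DecidableEq κ] (h : IsBalancedFactor lev)
    (h' : IsBalancedFactor lev') (hτ : 0 < τ) (hτk : 0 < τk) (hτpr : 0 ≤ τpr) (g : κ → ℝ) :
    (blockResponse lev lev' τ τk τpr g).2
      = shrinkage (Fintype.card ν / Fintype.card ι) τ τk •
        ((fun _ => (1 - priorShare (Fintype.card ν) (Fintype.card ν / Fintype.card ι) τ τk τpr)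
          * 𝔼 j, g j) - transfer lev lev' g) := by
  ext i
  have hexpect : 𝔼 n, LinearMap.funLeft ℝ ℝ lev' g n = 𝔼 j, g j := h'.expect_comp g
  rw [blockResponse, LinearMap.neg_apply, LinearMap.comp_apply, Prod.snd_neg, Pi.neg_apply,
    h.residualResponse_snd hτ hτk hτpr, hexpect]
  simp only [transfer, LinearMap.comp_apply, Pi.smul_apply, Pi.sub_apply, smul_eq_mul]
  ring

end Response

section Contraction

variable {N I₁ I₂ : ℕ} (D : Design N I₁ I₂) (γ : Precisions) (μpr : ℝ) (τpr : ℝ≥0) (y : Fin N → ℝ)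

/-- The change of the state after one iteration caused by a change of the effects of the second
factor. -/
def Design.iterateResponse : (Fin I₂ → ℝ) →ₗ[ℝ] Param I₁ I₂ :=
  let A₁ := LinearMap.snd ℝ ℝ _ ∘ₗ blockResponse D.lev₁ D.lev₂ γ.τ γ.τ₁ τpr
  let B := blockResponse D.lev₂ D.lev₁ γ.τ γ.τ₂ τpr ∘ₗ A₁
  (LinearMap.fst ℝ ℝ _ ∘ₗ B).prod (A₁.prod (LinearMap.snd ℝ ℝ _ ∘ₗ B))

theorem Design.iterate_sub (θ θ' : Param I₁ I₂)
    (z : (ℝ × (Fin I₁ → ℝ)) × (ℝ × (Fin I₂ → ℝ))) :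
    D.iterate γ μpr τpr y (θ, z) - D.iterate γ μpr τpr y (θ', z)
      = D.iterateResponse γ τpr (θ.2.2 - θ'.2.2) := by
  have hdraw₁ : (D.draw₁ γ μpr τpr y (θ.2.2, z.1)).2.1 - (D.draw₁ γ μpr τpr y (θ'.2.2, z.1)).2.1
      = (blockResponse D.lev₁ D.lev₂ γ.τ γ.τ₁ τpr (θ.2.2 - θ'.2.2)).2 :=
    congrArg Prod.snd (blockDraw_residual_sub D.lev₁ D.lev₂ γ.τ γ.τ₁ μpr τpr y _ _ _)
  have hdraw₂ := blockDraw_residual_sub D.lev₂ D.lev₁ γ.τ γ.τ₂ μpr τpr y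
    (D.draw₁ γ μpr τpr y (θ.2.2, z.1)).2.1 (D.draw₁ γ μpr τpr y (θ'.2.2, z.1)).2.1 z.2
  rw [hdraw₁] at hdraw₂
  have hglobal := congrArg Prod.fst hdraw₂
  have heffect₂ := congrArg Prod.snd hdraw₂
  refine Prod.ext ?_ (Prod.ext ?_ ?_)
  · exact hglobal
  · exact hdraw₁
  · exact heffect₂

/-- Contraction factor of the collapsed Gibbs sampler on centered effects, relative to the
auxiliary sampler. -/
def Design.centeredFactor (_ : Design N I₁ I₂) (γ : Precisions) : ℝ :=
  shrinkage (N / I₁) γ.τ γ.τ₁ * shrinkage (N / I₂) γ.τ γ.τ₂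

/-- Contraction factor of the collapsed Gibbs sampler on constant effects. -/
def Design.constFactor (D : Design N I₁ I₂) (γ : Precisions) (τpr : ℝ≥0) : ℝ :=
  D.centeredFactor γ *
    (priorShare N (N / I₁) γ.τ γ.τ₁ τpr * priorShare N (N / I₂) γ.τ γ.τ₂ τpr)

theorem Design.centeredFactor_nonneg : 0 ≤ D.centeredFactor γ := by
  unfold centeredFactor shrinkage
  positivity

theorem Design.constFactor_nonneg : 0 ≤ D.constFactor γ τpr := by
  have := D.centeredFactor_nonneg γ
  unfold constFactor priorShare
  positivity

variable {D γ} [NeZero N]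

theorem Design.Balanced.iterateResponse_effect₂ (hB : D.Balanced) (hτ : 0 < γ.τ) (hτ₁ : 0 < γ.τ₁)
    (hτ₂ : 0 < γ.τ₂) (g : Fin I₂ → ℝ) :
    (D.iterateResponse γ τpr g).2.2
      = D.centeredFactor γ • (roundTrip D.lev₁ D.lev₂ g - fun _ => 𝔼 j, g j)
        + fun _ => D.constFactor γ τpr * 𝔼 j, g j := by
  obtain ⟨h₁, h₂⟩ := hB.isBalancedFactor
  have : Nonempty (Fin I₁) := ⟨D.lev₁ 0⟩
  have hresponse₁ := h₁.blockResponse_snd h₂ (NNReal.coe_pos.2 hτ) (NNReal.coe_pos.2 hτ₁)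
    τpr.coe_nonneg
  have hresponse₂ := h₂.blockResponse_snd h₁ (NNReal.coe_pos.2 hτ) (NNReal.coe_pos.2 hτ₂)
    τpr.coe_nonneg
  have hmean : 𝔼 i, (blockResponse D.lev₁ D.lev₂ γ.τ γ.τ₁ τpr g).2 i
      = -(shrinkage (N / I₁) γ.τ γ.τ₁ * priorShare N (N / I₁) γ.τ γ.τ₁ τpr * 𝔼 j, g j) := by
    simp only [hresponse₁, Pi.smul_apply, Pi.sub_apply, smul_eq_mul, ← Finset.mul_expect,
      Finset.expect_sub_distrib, h₁.expect_transfer h₂, Fintype.card_fin, Fintype.expect_const]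
    ring
  change (blockResponse D.lev₂ D.lev₁ γ.τ γ.τ₂ τpr
    (blockResponse D.lev₁ D.lev₂ γ.τ γ.τ₁ τpr g).2).2 = _
  rw [hresponse₂, hmean, hresponse₁, map_smul, map_sub, h₂.transfer_const, ← LinearMap.comp_apply,
    ← roundTrip]
  ext j
  simp only [Pi.smul_apply, Pi.sub_apply, Pi.add_apply, smul_eq_mul, Fintype.card_fin, constFactor,
    centeredFactor]
  ring

theorem sum_add_const_sq {ι : Type*} [Fintype ι] {u : ι → ℝ} (hu : 𝔼 i, u i = 0) (c : ℝ) :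
    ∑ i, (u i + c) ^ 2 = ∑ i, u i ^ 2 + Fintype.card ι * c ^ 2 := by
  have hsum : ∑ i, u i = 0 := by rw [← Fintype.card_mul_expect, hu, mul_zero]
  simp only [add_sq, Finset.sum_add_distrib, mul_right_comm, ← Finset.mul_sum, hsum]
  simp

theorem Design.Balanced.sum_sq_iterateResponse_le (hB : D.Balanced) (hτ : 0 < γ.τ)
    (hτ₁ : 0 < γ.τ₁) (hτ₂ : 0 < γ.τ₂) {l : ℝ≥0}
    (hl : IsSecondEigenvalue (roundTrip D.lev₁ D.lev₂) l) {ρ : ℝ}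
    (hcentered : D.centeredFactor γ * l ≤ ρ) (hconst : D.constFactor γ τpr ≤ ρ) (g : Fin I₂ → ℝ) :
    ∑ j, (D.iterateResponse γ τpr g).2.2 j ^ 2 ≤ ρ ^ 2 * ∑ j, g j ^ 2 := by
  have : Nonempty (Fin I₂) := ⟨D.lev₂ 0⟩
  obtain ⟨h₁, h₂⟩ := hB.isBalancedFactor
  set m : ℝ := 𝔼 j, g j
  set u : Fin I₂ → ℝ := g - fun _ => m
  have hu : 𝔼 j, u j = 0 := by simp [u, m, Finset.expect_sub_distrib]
  have hPu : roundTrip D.lev₁ D.lev₂ u = roundTrip D.lev₁ D.lev₂ g - fun _ => m := by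
    rw [map_sub, h₁.roundTrip_const h₂]
  have hPu_mean : 𝔼 j, (D.centeredFactor γ • roundTrip D.lev₁ D.lev₂ u) j = 0 := by
    simp only [Pi.smul_apply, smul_eq_mul, ← Finset.mul_expect, h₁.expect_roundTrip h₂, hu,
      mul_zero]
  have hcentered_nonneg := D.centeredFactor_nonneg γ
  have hsum_g : ∑ j, g j ^ 2 = ∑ j, u j ^ 2 + Fintype.card (Fin I₂) * m ^ 2 := by
    rw [← sum_add_const_sq hu m]
    simp [u]
  rw [hB.iterateResponse_effect₂ τpr hτ hτ₁ hτ₂, ← hPu, hsum_g]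
  calc ∑ j, (D.centeredFactor γ • roundTrip D.lev₁ D.lev₂ u
          + fun _ => D.constFactor γ τpr * m : Fin I₂ → ℝ) j ^ 2
      = D.centeredFactor γ ^ 2 * ∑ j, roundTrip D.lev₁ D.lev₂ u j ^ 2
        + Fintype.card (Fin I₂) * (D.constFactor γ τpr * m) ^ 2 := by
        simp only [Pi.add_apply, sum_add_const_sq hPu_mean]
        simp only [Pi.smul_apply, smul_eq_mul, mul_pow, Finset.mul_sum]
    _ ≤ D.centeredFactor γ ^ 2 * (l ^ 2 * ∑ j, u j ^ 2)
        + Fintype.card (Fin I₂) * (D.constFactor γ τpr * m) ^ 2 := by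
        gcongr
        exact hl.sum_sq_apply_le u hu
    _ = (D.centeredFactor γ * l) ^ 2 * ∑ j, u j ^ 2
        + D.constFactor γ τpr ^ 2 * (Fintype.card (Fin I₂) * m ^ 2) := by ring
    _ ≤ ρ ^ 2 * ∑ j, u j ^ 2 + ρ ^ 2 * (Fintype.card (Fin I₂) * m ^ 2) := by
        have := D.constFactor_nonneg γ τpr
        gcongr
    _ = ρ ^ 2 * (∑ j, u j ^ 2 + Fintype.card (Fin I₂) * m ^ 2) := by ring

end Contraction

/-! ### Convergence of noise-driven chains by coupling -/

section Coupling

variable {Ω S : Type*} [MeasurableSpace Ω] [MeasurableSpace S]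

theorem abs_integral_le_of_abs_le {μ : Measure Ω} [IsProbabilityMeasure μ] {f : Ω → ℝ} {B : ℝ}
    (hB : ∀ x, |f x| ≤ B) : |∫ x, f x ∂μ| ≤ B := by
  have h : ∀ᵐ x ∂μ, ‖f x‖ ≤ B := .of_forall hB
  simpa using norm_integral_le_of_norm_le_const h

theorem eLpNorm_sub_integral_le {π : Measure Ω} [IsProbabilityMeasure π] {f h : Ω → ℝ}
    (hf : Integrable f π) (hh : Integrable h π) {c : ℝ≥0}
    (hfh : ∀ x x', |f x - f x'| ≤ c * (h x + h x')) (p : ℝ≥0∞) :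
    eLpNorm (fun x => f x - ∫ w, f w ∂π) p π
      ≤ c • eLpNorm (fun x => h x + ∫ w, h w ∂π) p π := by
  refine eLpNorm_le_nnreal_smul_eLpNorm_of_ae_le_mul (.of_forall fun x => ?_) p
  have hfx : f x - ∫ w, f w ∂π = ∫ x', (f x - f x') ∂π := by
    simp [integral_sub (integrable_const _) hf]
  have hhx : c * (h x + ∫ w, h w ∂π) = ∫ x', c * (h x + h x') ∂π := by
    simp [integral_const_mul, integral_add (integrable_const _) hh]
  rw [← NNReal.coe_le_coe]
  push_cast
  calc ‖f x - ∫ w, f w ∂π‖ ≤ c * (h x + ∫ w, h w ∂π) := by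
        rw [hfx, hhx]
        exact norm_integral_le_of_norm_le (((integrable_const _).add hh).const_mul _)
          (.of_forall (hfh x))
    _ ≤ c * ‖h x + ∫ w, h w ∂π‖ := by
        gcongr
        exact le_abs_self _

variable {ν : Measure S} [IsProbabilityMeasure ν] {Φ : Ω × S → Ω} {f : Ω → ℝ} {B : ℝ}

theorem abs_integral_noiseKernel_sub_le (hΦ : Measurable Φ) (hf : Measurable f)
    (hB : ∀ x, |f x| ≤ B) {x x' : Ω} {c : ℝ} (hc : ∀ z, |f (Φ (x, z)) - f (Φ (x', z))| ≤ c) :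
    |∫ w, f w ∂(noiseKernel ν Φ x) - ∫ w, f w ∂(noiseKernel ν Φ x')| ≤ c := by
  have hint (x) : Integrable (fun z => f (Φ (x, z))) ν :=
    .of_bound (hf.comp (hΦ.comp measurable_prodMk_left)).aestronglyMeasurable B
      (.of_forall fun z => hB _)
  rw [integral_noiseKernel hΦ x hf, integral_noiseKernel hΦ x' hf,
    ← integral_sub (hint x) (hint x')]
  exact abs_integral_le_of_abs_le hc

theorem integral_noiseKernel_of_sub_eq (hΦ : Measurable Φ) (hf : Measurable f) {m : ℝ}
    (hfm : ∀ x x' z, f (Φ (x, z)) - f (Φ (x', z)) = m * (f x - f x')) {x₀ : Ω}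
    (hint : Integrable f (noiseKernel ν Φ x₀)) (x : Ω) :
    ∫ w, f w ∂(noiseKernel ν Φ x)
      = m * f x + (∫ w, f w ∂(noiseKernel ν Φ x₀) - m * f x₀) := by
  have hΦx₀ : Measurable fun z => Φ (x₀, z) := hΦ.comp measurable_prodMk_left
  have hint' : Integrable (fun z => f (Φ (x₀, z))) ν := by
    rw [noiseKernel_apply hΦ] at hint
    exact (integrable_map_measure hf.aestronglyMeasurable hΦx₀.aemeasurable).1 hint
  rw [integral_noiseKernel hΦ x hf, integral_noiseKernel hΦ x₀ hf]
  simp only [sub_eq_iff_eq_add'.1 (hfm x x₀ _)]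
  rw [integral_add hint' (integrable_const _), integral_const, probReal_univ, one_smul]
  ring

variable {d : Ω → Ω → ℝ} {ρ M : ℝ≥0}

theorem abs_integral_pow_sub_le (hΦ : Measurable Φ) (hf : Measurable f) (hB : ∀ x, |f x| ≤ B)
    (hfd : ∀ x x' z, |f (Φ (x, z)) - f (Φ (x', z))| ≤ M * d x x')
    (hd : ∀ x x' z, d (Φ (x, z)) (Φ (x', z)) ≤ ρ * d x x') (t : ℕ) (x x' : Ω) :
    |∫ w, f w ∂((noiseKernel ν Φ ^ (t + 1)) x) - ∫ w, f w ∂((noiseKernel ν Φ ^ (t + 1)) x')|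
      ≤ M * ρ ^ t * d x x' := by
  have := isMarkovKernel_noiseKernel (ν := ν) hΦ
  induction t generalizing x x' with
  | zero =>
    rw [zero_add, pow_one, pow_zero, mul_one]
    exact abs_integral_noiseKernel_sub_le hΦ hf hB (hfd x x')
  | succ t ih =>
    have hsucc (x) : ∫ w, f w ∂((noiseKernel ν Φ ^ (t + 2)) x)
        = ∫ v, ∫ w, f w ∂((noiseKernel ν Φ ^ (t + 1)) v) ∂(noiseKernel ν Φ x) := by
      rw [pow_succ]
      exact Kernel.integral_comp (.of_bound hf.aestronglyMeasurable B (.of_forall hB))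
    rw [hsucc, hsucc]
    refine abs_integral_noiseKernel_sub_le hΦ hf.stronglyMeasurable.integral_kernel.measurable
      (fun x => abs_integral_le_of_abs_le hB) fun z => (ih _ _).trans ?_
    rw [pow_succ, mul_assoc, mul_assoc, mul_assoc]
    gcongr
    exact hd x x' z

theorem exists_eLpNorm_pow_succ_sub_le (hΦ : Measurable Φ) {π : Measure Ω} [IsProbabilityMeasure π]
    (hπ : (noiseKernel ν Φ).Invariant π) {h : Ω → ℝ} (hh : MemLp h 2 π)
    (hdh : ∀ x x', d x x' ≤ h x + h x') (hf : Measurable f) (hB : ∀ x, |f x| ≤ B)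
    (hfd : ∀ x x' z, |f (Φ (x, z)) - f (Φ (x', z))| ≤ M * d x x')
    (hd : ∀ x x' z, d (Φ (x, z)) (Φ (x', z)) ≤ ρ * d x x') :
    ∃ C : ℝ≥0, ∀ t : ℕ,
      eLpNorm (fun x => (∫ w, f w ∂((noiseKernel ν Φ ^ (t + 1)) x)) - ∫ w, f w ∂π) 2 π
        ≤ C * (ρ : ℝ≥0∞) ^ t := by
  have := isMarkovKernel_noiseKernel (ν := ν) hΦ
  set H : Ω → ℝ := fun x => h x + ∫ w, h w ∂π
  have hH : MemLp H 2 π := hh.add (memLp_const _)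
  refine ⟨M * (eLpNorm H 2 π).toNNReal, fun t => ?_⟩
  set g : Ω → ℝ := fun x => ∫ w, f w ∂((noiseKernel ν Φ ^ (t + 1)) x)
  have hg : Integrable g π :=
    .of_bound hf.stronglyMeasurable.integral_kernel.aestronglyMeasurable B
      (.of_forall fun x => abs_integral_le_of_abs_le hB)
  have hmean : ∫ x, g x ∂π = ∫ w, f w ∂π := integral_integral_of_invariant (invariant_pow hπ _)
    (.of_bound hf.aestronglyMeasurable B (.of_forall hB))
  have hgh (x x') : |g x - g x'| ≤ (M * ρ ^ t : ℝ≥0) * (h x + h x') := by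
    push_cast
    exact (abs_integral_pow_sub_le hΦ hf hB hfd hd t x x').trans (by gcongr; exact hdh x x')
  calc eLpNorm (fun x => g x - ∫ w, f w ∂π) 2 π
      ≤ (M * ρ ^ t : ℝ≥0) • eLpNorm H 2 π := by
        rw [← hmean]
        exact eLpNorm_sub_integral_le hg (hh.integrable one_le_two) hgh 2
    _ = (M * (eLpNorm H 2 π).toNNReal : ℝ≥0) * (ρ : ℝ≥0∞) ^ t := by
        rw [ENNReal.smul_def, smul_eq_mul]
        push_cast
        rw [ENNReal.coe_toNNReal hH.eLpNorm_ne_top]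
        ring

end Coupling

section Rates

variable {N I₁ I₂ : ℕ}

/-- Euclidean distance of the effects of the second factor, the only part of the state on which the
next state depends. -/
def effectDist (θ θ' : Param I₁ I₂) : ℝ := √(∑ j, (θ.2.2 j - θ'.2.2 j) ^ 2)

theorem norm_sub_le_effectDist (θ θ' : Param I₁ I₂) : ‖θ.2.2 - θ'.2.2‖ ≤ effectDist θ θ' := by
  refine (pi_norm_le_iff_of_nonneg (Real.sqrt_nonneg _)).2 fun j => Real.abs_le_sqrt ?_
  exact Finset.single_le_sum (f := fun j => (θ.2.2 j - θ'.2.2 j) ^ 2)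
    (fun _ _ => sq_nonneg _) (Finset.mem_univ j)

theorem effectDist_le (θ θ' : Param I₁ I₂) :
    effectDist θ θ' ≤ (∑ j, |θ.2.2 j|) + ∑ j, |θ'.2.2 j| := by
  rw [effectDist, Real.sqrt_le_left (by positivity), ← Finset.sum_add_distrib]
  refine le_trans ?_ (Finset.sum_sq_le_sq_sum_of_nonneg fun j _ => by positivity)
  refine Finset.sum_le_sum fun j _ => ?_
  rw [← sq_abs]
  gcongr
  exact abs_sub _ _

theorem exists_abs_sub_iterate_le (D : Design N I₁ I₂) (γ : Precisions) (μpr : ℝ) (τpr : ℝ≥0)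
    (y : Fin N → ℝ) {f : Param I₁ I₂ → ℝ} {L : ℝ≥0} (hf : LipschitzWith L f) :
    ∃ M : ℝ≥0, ∀ θ θ' z, |f (D.iterate γ μpr τpr y (θ, z)) - f (D.iterate γ μpr τpr y (θ', z))|
      ≤ M * effectDist θ θ' := by
  set A := LinearMap.toContinuousLinearMap (D.iterateResponse γ τpr)
  refine ⟨L * ‖A‖₊, fun θ θ' z => ?_⟩
  calc |f (D.iterate γ μpr τpr y (θ, z)) - f (D.iterate γ μpr τpr y (θ', z))|
      ≤ L * ‖A (θ.2.2 - θ'.2.2)‖ := by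
        have hdist := hf.dist_le_mul (D.iterate γ μpr τpr y (θ, z)) (D.iterate γ μpr τpr y (θ', z))
        rwa [dist_eq_norm, dist_eq_norm, D.iterate_sub] at hdist
    _ ≤ L * (‖A‖ * ‖θ.2.2 - θ'.2.2‖) := by
        gcongr
        exact A.le_opNorm _
    _ ≤ (L * ‖A‖₊ : ℝ≥0) * effectDist θ θ' := by
        push_cast
        rw [mul_assoc]
        gcongr
        exact norm_sub_le_effectDist θ θ'

theorem not_ae_eq_const_of_pi_gaussian {ι : Type*} [Fintype ι] {v : ℝ≥0} (hv : v ≠ 0)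
    {g : ι → ℝ} (hg : g ≠ 0) (c : ℝ) :
    ¬ ∀ᵐ b ∂(Measure.pi fun _ : ι => gaussianReal 0 v), ∑ j, g j * b j = c := by
  intro hconst
  have hvar : Var[∑ j, fun b : ι → ℝ => g j * b j; Measure.pi fun _ => gaussianReal 0 v]
      = ∑ j, g j ^ 2 * v := by
    rw [variance_sum_pi (μ := fun _ : ι => gaussianReal 0 v) (X := fun j x => g j * x)
      fun j => (memLp_id_gaussianReal 2).const_mul (g j)]
    simp only [variance_const_mul _ (fun x : ℝ => x), variance_fun_id_gaussianReal]
  have hvar_zero : Var[∑ j, fun b : ι → ℝ => g j * b j; Measure.pi fun _ => gaussianReal 0 v]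
      = 0 := by
    have hae : (∑ j, fun b : ι → ℝ => g j * b j)
        =ᵐ[Measure.pi fun _ : ι => gaussianReal 0 v] fun _ => c := by
      filter_upwards [hconst] with b hb
      simpa using hb
    rw [variance_congr hae]
    simp [variance, evariance]
  obtain ⟨j, hj⟩ := Function.ne_iff.1 hg
  have hterm := (Finset.sum_eq_zero_iff_of_nonneg fun j _ => by positivity).1
    (hvar.symm.trans hvar_zero) j (Finset.mem_univ j)
  have hgj : 0 < g j ^ 2 := sq_pos_of_ne_zero hj
  have hv_pos : (0 : ℝ) < v := NNReal.coe_pos.2 (pos_iff_ne_zero.2 hv)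
  exact (mul_pos hgj hv_pos).ne' hterm

variable {D : Design N I₁ I₂} {γ : Precisions} {μpr : ℝ} {τpr : ℝ≥0} {y : Fin N → ℝ} [NeZero N]

theorem Design.Balanced.effectDist_iterate_le (hB : D.Balanced) (hτ : 0 < γ.τ) (hτ₁ : 0 < γ.τ₁)
    (hτ₂ : 0 < γ.τ₂) {l : ℝ≥0} (hl : IsSecondEigenvalue (roundTrip D.lev₁ D.lev₂) l) {ρ : ℝ≥0}
    (hcentered : D.centeredFactor γ * l ≤ ρ) (hconst : D.constFactor γ τpr ≤ ρ)
    (θ θ' : Param I₁ I₂) (z : (ℝ × (Fin I₁ → ℝ)) × (ℝ × (Fin I₂ → ℝ))) :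
    effectDist (D.iterate γ μpr τpr y (θ, z)) (D.iterate γ μpr τpr y (θ', z))
      ≤ ρ * effectDist θ θ' := by
  have hsub (j) : (D.iterate γ μpr τpr y (θ, z)).2.2 j - (D.iterate γ μpr τpr y (θ', z)).2.2 j
      = (D.iterateResponse γ τpr (θ.2.2 - θ'.2.2)).2.2 j :=
    congrArg (fun θ => θ.2.2 j) (D.iterate_sub γ μpr τpr y θ θ' z)
  unfold effectDist
  rw [← Real.sqrt_sq ρ.coe_nonneg, ← Real.sqrt_mul (sq_nonneg _)]
  simp only [hsub]
  exact Real.sqrt_le_sqrt (hB.sum_sq_iterateResponse_le τpr hτ hτ₁ hτ₂ hl hcentered hconst _)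

theorem Design.Balanced.exists_eLpNorm_collapsedGibbs_pow_le (hB : D.Balanced) (hτ : 0 < γ.τ)
    (hτ₁ : 0 < γ.τ₁) (hτ₂ : 0 < γ.τ₂) {l : ℝ≥0}
    (hl : IsSecondEigenvalue (roundTrip D.lev₁ D.lev₂) l) {ρ : ℝ≥0}
    (hcentered : D.centeredFactor γ * l ≤ ρ) (hconst : D.constFactor γ τpr ≤ ρ)
    {f : Param I₁ I₂ → ℝ} (hfc : HasCompactSupport f) (hf : ContDiff ℝ 1 f) :
    ∃ C : ℝ≥0, ∀ t : ℕ, eLpNorm (fun θ => (∫ w, f w ∂((D.collapsedGibbs γ μpr τpr y ^ (t + 1)) θ))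
      - ∫ w, f w ∂(D.posterior γ μpr τpr y)) 2 (D.posterior γ μpr τpr y)
        ≤ C * (ρ : ℝ≥0∞) ^ t := by
  have _ := D.isProbabilityMeasure_posterior μpr τpr y hτ
  have hae := D.collapsedGibbs_ae_eq_iterateKernel μpr τpr y hτ hτ₁ hτ₂
  have hinv : (D.collapsedGibbs γ μpr τpr y).Invariant (D.posterior γ μpr τpr y) :=
    invariant_twoBlockGibbs
  have hnorm : MemLp (fun θ : Param I₁ I₂ => ∑ j, |θ.2.2 j|) 2 (D.posterior γ μpr τpr y) :=
    memLp_finsetSum _ fun j _ => (D.memLp_effect₂ μpr τpr y hτ j).norm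
  obtain ⟨L, hL⟩ := hf.lipschitzWith_of_hasCompactSupport hfc one_ne_zero
  obtain ⟨B, hfB⟩ := hfc.exists_bound_of_continuous hf.continuous
  obtain ⟨M, hM⟩ := exists_abs_sub_iterate_le D γ μpr τpr y hL
  obtain ⟨C, hC⟩ := exists_eLpNorm_pow_succ_sub_le (D.measurable_iterate γ μpr τpr y)
    (invariant_congr hinv hae) hnorm effectDist_le hf.continuous.measurable hfB hM
    (hB.effectDist_iterate_le hτ hτ₁ hτ₂ hl hcentered hconst)
  refine ⟨C, fun t => le_of_eq_of_le (eLpNorm_congr_ae ?_) (hC t)⟩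
  filter_upwards [pow_ae_eq hinv hae (t + 1)] with θ hθ
  rw [hθ]
  rfl

theorem Design.Balanced.l2Rate_collapsedGibbs_le (hB : D.Balanced) (hτ : 0 < γ.τ) (hτ₁ : 0 < γ.τ₁)
    (hτ₂ : 0 < γ.τ₂) {l : ℝ≥0} (hl : IsSecondEigenvalue (roundTrip D.lev₁ D.lev₂) l) {ρ : ℝ≥0}
    (hcentered : D.centeredFactor γ * l ≤ ρ) (hconst : D.constFactor γ τpr ≤ ρ) :
    l2Rate (D.collapsedGibbs γ μpr τpr y) (D.posterior γ μpr τpr y) ≤ ρ := by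
  have _ := D.isProbabilityMeasure_posterior μpr τpr y hτ
  refine l2Rate_twoBlockGibbs_le
    (D := {f : Param I₁ I₂ → ℝ | HasCompactSupport f ∧ ContDiff ℝ 1 f}) ?_ ?_ ?_
  · rintro f ⟨hfc, hf⟩
    exact hf.continuous.memLp_of_hasCompactSupport hfc
  · intro f hf ε hε
    obtain ⟨g, hgc, hg, hfg⟩ := hf.exist_eLpNorm_sub_le (by norm_num) one_le_two hε
    exact ⟨g, ⟨hgc, hg.of_le (by exact_mod_cast le_top)⟩, hfg⟩
  · rintro f ⟨hfc, hf⟩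
    exact hB.exists_eLpNorm_collapsedGibbs_pow_le hτ hτ₁ hτ₂ hl hcentered hconst hfc hf

theorem Design.Balanced.sum_mul_iterate_sub (hB : D.Balanced) (hτ : 0 < γ.τ) (hτ₁ : 0 < γ.τ₁)
    (hτ₂ : 0 < γ.τ₂) {l : ℝ} {g : Fin I₂ → ℝ} (hgsum : ∑ j, g j = 0)
    (hg : roundTrip D.lev₁ D.lev₂ g = l • g) (θ θ' : Param I₁ I₂)
    (z : (ℝ × (Fin I₁ → ℝ)) × (ℝ × (Fin I₂ → ℝ))) :
    ∑ j, g j * (D.iterate γ μpr τpr y (θ, z)).2.2 j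
        - ∑ j, g j * (D.iterate γ μpr τpr y (θ', z)).2.2 j
      = D.centeredFactor γ * l * (∑ j, g j * θ.2.2 j - ∑ j, g j * θ'.2.2 j) := by
  have hsub (j) : (D.iterate γ μpr τpr y (θ, z)).2.2 j - (D.iterate γ μpr τpr y (θ', z)).2.2 j
      = (D.iterateResponse γ τpr (θ.2.2 - θ'.2.2)).2.2 j :=
    congrArg (fun θ => θ.2.2 j) (D.iterate_sub γ μpr τpr y θ θ' z)
  simp only [← Finset.sum_sub_distrib, ← mul_sub, hsub,
    hB.iterateResponse_effect₂ τpr hτ hτ₁ hτ₂, Pi.add_apply, Pi.smul_apply, smul_eq_mul]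
  obtain ⟨h₁, h₂⟩ := hB.isBalancedFactor
  set δ := θ.2.2 - θ'.2.2
  calc ∑ j, g j * (D.centeredFactor γ
          * (roundTrip D.lev₁ D.lev₂ δ - fun _ => 𝔼 j, δ j : Fin I₂ → ℝ) j
          + D.constFactor γ τpr * 𝔼 j, δ j)
      = D.centeredFactor γ * ∑ j, g j * roundTrip D.lev₁ D.lev₂ δ j
        + (∑ j, g j) * ((D.constFactor γ τpr - D.centeredFactor γ) * 𝔼 j, δ j) := by
        rw [Finset.mul_sum, Finset.sum_mul, ← Finset.sum_add_distrib]
        refine Finset.sum_congr rfl fun j _ => ?_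
        rw [Pi.sub_apply]
        ring
    _ = D.centeredFactor γ * l * ∑ j, g j * δ j := by
        rw [hgsum, h₁.sum_mul_roundTrip_of_eq_smul h₂ hg]
        ring

theorem Design.Balanced.le_l2Rate_collapsedGibbs (hB : D.Balanced) (hτ : 0 < γ.τ) (hτ₁ : 0 < γ.τ₁)
    (hτ₂ : 0 < γ.τ₂) {l : ℝ≥0} (hl : IsSecondEigenvalue (roundTrip D.lev₁ D.lev₂) l) :
    ENNReal.ofReal (D.centeredFactor γ * l)
      ≤ l2Rate (D.collapsedGibbs γ μpr τpr y) (D.posterior γ μpr τpr y) := by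
  rcases hl.eq_zero_or_exists with rfl | ⟨g, hg, hgmean, hgl⟩
  · simp
  have hgsum : ∑ j, g j = 0 := by rw [← Fintype.card_mul_expect, hgmean, mul_zero]
  have _ := D.isProbabilityMeasure_posterior μpr τpr y hτ
  have hae := D.collapsedGibbs_ae_eq_iterateKernel μpr τpr y hτ hτ₁ hτ₂
  have hinv : (D.collapsedGibbs γ μpr τpr y).Invariant (D.posterior γ μpr τpr y) :=
    invariant_twoBlockGibbs
  set π := D.posterior γ μpr τpr y
  set f : Param I₁ I₂ → ℝ := fun θ => ∑ j, g j * θ.2.2 j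
  have hf : MemLp f 2 π :=
    memLp_finsetSum _ fun j _ => (D.memLp_effect₂ μpr τpr y hτ j).const_mul (g j)
  have hne : ¬ ∀ᵐ θ ∂π, f θ = ∫ θ, f θ ∂π := fun hconst =>
    not_ae_eq_const_of_pi_gaussian (inv_ne_zero hτ₂.ne') hg _
      (D.ae_pi_of_ae_posterior μpr τpr y (p := fun b => ∑ j, g j * b j = ∫ θ, f θ ∂π) hτ hconst)
  rw [l2Rate_congr hinv hae]
  have hinv' := invariant_congr hinv hae
  have _ : IsMarkovKernel (D.iterateKernel γ μpr τpr y) :=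
    isMarkovKernel_noiseKernel (D.measurable_iterate γ μpr τpr y)
  obtain ⟨θ₀, hθ₀⟩ := (ae_integrable_of_invariant hinv' (hf.integrable one_le_two)).exists
  exact le_l2Rate_of_affine hinv' hf (.of_forall (integral_noiseKernel_of_sub_eq
    (D.measurable_iterate γ μpr τpr y) (by fun_prop)
    (hB.sum_mul_iterate_sub hτ hτ₁ hτ₂ hgsum hgl) hθ₀)) hne

end Rates

/-! ### Relaxation times and cost -/

section Cost

variable {N I₁ I₂ : ℕ}

theorem steps_blockProgram {I J : ℕ} (lev : Fin N → Fin I) (lev' : Fin N → Fin J)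
    (a sum cnt : Fin I → Reg N I₁ I₂) (b : Fin J → Reg N I₁ I₂) (τ τk μpr τpr : ℝ) :
    steps (blockProgram lev lev' a sum cnt b τ τk μpr τpr) = 11 + 20 * I + 3 * N := by
  simp [steps, blockProgram, List.length_flatMap]
  ring

variable (D : Design N I₁ I₂) (γ : Precisions) (μpr : ℝ) (τpr : ℝ≥0)

theorem Design.steps_iteration :
    steps (D.iteration γ μpr τpr) = 22 + 20 * (I₁ + I₂) + 6 * N := by
  rw [iteration, steps, List.length_append, ← steps, ← steps, steps_blockProgram,
    steps_blockProgram]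
  ring

theorem Design.le_steps_iteration :
    (2 * N + (I₁ + I₂) : ℝ≥0∞) ≤ steps (D.iteration γ μpr τpr) := by
  rw [steps_iteration]
  norm_cast
  omega

theorem Design.steps_iteration_le [NeZero N] :
    (steps (D.iteration γ μpr τpr) : ℝ≥0∞) ≤ 20 * (2 * N + (I₁ + I₂)) := by
  have := NeZero.pos N
  rw [steps_iteration]
  norm_cast
  omega

end Cost

section Factors

variable {N n τ τk τpr : ℝ}

theorem shrinkage_mem_Icc (hn : 0 ≤ n) (hτ : 0 ≤ τ) (hτk : 0 ≤ τk) :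
    shrinkage n τ τk ∈ Set.Icc 0 1 := by
  unfold shrinkage
  exact ⟨by positivity, div_le_one_of_le₀ (by linarith) (by positivity)⟩

theorem one_sub_shrinkage (h : n * τ + τk ≠ 0) : 1 - shrinkage n τ τk = τk / (n * τ + τk) := by
  rw [shrinkage, one_sub_div h, add_sub_cancel_left]

theorem one_sub_shrinkage_le (hn : 0 < n) (hτ : 0 < τ) (hτk : 0 ≤ τk) :
    1 - shrinkage n τ τk ≤ τk / τ * n⁻¹ := by
  rw [one_sub_shrinkage (by positivity), ← div_eq_mul_inv, div_div, mul_comm τ]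
  gcongr
  exact le_add_of_nonneg_right hτk

theorem le_one_sub_shrinkage (hn : 1 ≤ n) (hτ : 0 < τ) (hτk : 0 ≤ τk) :
    τk / (τ + τk) * n⁻¹ ≤ 1 - shrinkage n τ τk := by
  rw [one_sub_shrinkage (by positivity), ← div_eq_mul_inv, div_div]
  gcongr
  nlinarith

theorem priorShare_nonneg (hN : 0 ≤ N) (hn : 0 ≤ n) (hτ : 0 ≤ τ) (hτk : 0 ≤ τk) (hτpr : 0 ≤ τpr) :
    0 ≤ priorShare N n τ τk τpr := by
  unfold priorShare
  positivity

theorem priorShare_le_one (hN : 0 ≤ N) (hn : 0 ≤ n) (hτ : 0 ≤ τ) (hτk : 0 ≤ τk) (hτpr : 0 ≤ τpr) :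
    priorShare N n τ τk τpr ≤ 1 := by
  unfold priorShare
  exact div_le_one_of_le₀ (le_add_of_nonneg_right (by positivity)) (by positivity)

theorem priorShare_le (hn : 1 ≤ n) (hnN : n ≤ N) (hτ : 0 < τ) (hτk : 0 < τk) (hτpr : 0 ≤ τpr) :
    priorShare N n τ τk τpr ≤ τpr / (τpr + τk * τ / (τ + τk)) := by
  have h : τk * τ / (τ + τk) ≤ τk / (n * τ + τk) * τ * N := by
    rw [div_mul_eq_mul_div, div_mul_eq_mul_div, div_le_div_iff₀ (by positivity) (by positivity),
      mul_assoc (τk * τ)]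
    gcongr
    nlinarith
  unfold priorShare
  gcongr

theorem one_sub_mul_mul_le {x y l : ℝ} (hx : x ∈ Set.Icc 0 1) (hy : y ∈ Set.Icc 0 1) (hl : l ≤ 1) :
    1 - x * y * l ≤ (1 - x) + (1 - y) + (1 - l) := by
  obtain ⟨-, hx1⟩ := hx
  obtain ⟨hy0, hy1⟩ := hy
  have hxy : x * y ≤ 1 := mul_le_one₀ hx1 hy0 hy1
  nlinarith

theorem max_one_sub_le_one_sub_mul_mul {x y l : ℝ} (hx : x ∈ Set.Icc 0 1) (hy : y ∈ Set.Icc 0 1)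
    (hl : l ∈ Set.Icc 0 1) :
    max (((1 - x) + (1 - y)) / 2) (1 - l) ≤ 1 - x * y * l := by
  obtain ⟨hx0, hx1⟩ := hx
  obtain ⟨hy0, hy1⟩ := hy
  have hxy_left : x * y ≤ x := mul_le_of_le_one_right hx0 hy1
  have hxy_right : x * y ≤ y := mul_le_of_le_one_left hy0 hx1
  have hxyl : x * y * l ≤ x * y := mul_le_of_le_one_right (by positivity) hl.2
  have hxyl' : x * y * l ≤ l := mul_le_of_le_one_left hl.1 (hxy_left.trans hx1)
  exact max_le (by linarith) (by linarith)

end Factors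

theorem IsBalancedFactor.one_le_card_div_card {ι ν : Type*} [Fintype ι] [Fintype ν] [DecidableEq ι]
    [Nonempty ι] [Nonempty ν] {lev : ν → ι} (h : IsBalancedFactor lev) :
    (1 : ℝ) ≤ Fintype.card ν / Fintype.card ι := by
  obtain ⟨i⟩ := ‹Nonempty ι›
  have hpos := h.levelCount_pos i
  rw [← h i]
  simp only [levelCount] at hpos ⊢
  exact_mod_cast hpos

/-- The spectral gap `1 - l` truncated from below at `1 / n̄`. With `l` the rate of the auxiliary
sampler, its inverse is `min {n̄, T_aux}`. -/
def truncatedGap (N I₁ I₂ : ℕ) (l : ℝ) : ℝ := max (nbar N I₁ I₂ : ℝ)⁻¹ (1 - l)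

section Gap

variable {N I₁ I₂ : ℕ}

theorem inv_nbar : (nbar N I₁ I₂ : ℝ)⁻¹ = (((N : ℝ) / I₁)⁻¹ + ((N : ℝ) / I₂)⁻¹) / 2 := by
  simp only [nbar, NNReal.coe_div, NNReal.coe_mul, NNReal.coe_add, NNReal.coe_natCast,
    NNReal.coe_ofNat, inv_div]
  ring

theorem nbar_pos [NeZero N] [NeZero I₁] : 0 < nbar N I₁ I₂ := by
  have := NeZero.pos N
  have := NeZero.pos I₁
  unfold nbar
  positivity

theorem truncatedGap_nonneg (l : ℝ) : 0 ≤ truncatedGap N I₁ I₂ l :=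
  le_max_of_le_left (inv_nonneg.2 (nbar N I₁ I₂).coe_nonneg)

variable [NeZero N] {D : Design N I₁ I₂} {γ : Precisions} {μpr : ℝ} {τpr : ℝ≥0} {y : Fin N → ℝ}
  {l : ℝ≥0}

theorem Design.Balanced.le_Tcgs (hB : D.Balanced) (hτ : 0 < γ.τ) (hτ₁ : 0 < γ.τ₁)
    (hτ₂ : 0 < γ.τ₂) (hl : IsSecondEigenvalue (roundTrip D.lev₁ D.lev₂) l) :
    (ENNReal.ofReal (1 - D.centeredFactor γ * l))⁻¹ ≤ D.Tcgs γ μpr τpr y := by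
  rw [Tcgs, relaxationTime, ENNReal.inv_le_inv,
    ENNReal.ofReal_sub _ (mul_nonneg (D.centeredFactor_nonneg γ) l.coe_nonneg), ENNReal.ofReal_one]
  exact tsub_le_tsub_left (hB.le_l2Rate_collapsedGibbs hτ hτ₁ hτ₂ hl) 1

theorem Design.Balanced.Tcgs_le (hB : D.Balanced) (hτ : 0 < γ.τ) (hτ₁ : 0 < γ.τ₁)
    (hτ₂ : 0 < γ.τ₂) (hl : IsSecondEigenvalue (roundTrip D.lev₁ D.lev₂) l) {x : ℝ}
    (hcentered : x ≤ 1 - D.centeredFactor γ * l) (hconst : x ≤ 1 - D.constFactor γ τpr) :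
    D.Tcgs γ μpr τpr y ≤ (ENNReal.ofReal x)⁻¹ := by
  have hx : 0 ≤ 1 - x := by linarith [D.constFactor_nonneg γ τpr]
  have hrate := hB.l2Rate_collapsedGibbs_le (μpr := μpr) (τpr := τpr) (y := y) hτ hτ₁ hτ₂ hl
    (ρ := NNReal.mk (1 - x) hx) (le_sub_comm.1 hcentered) (le_sub_comm.1 hconst)
  rw [Tcgs, relaxationTime, ENNReal.inv_le_inv]
  calc ENNReal.ofReal x = 1 - ENNReal.ofReal (1 - x) := by
        rw [← ENNReal.ofReal_one, ← ENNReal.ofReal_sub _ hx, sub_sub_cancel]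
    _ ≤ 1 - l2Rate (D.collapsedGibbs γ μpr τpr y) (D.posterior γ μpr τpr y) :=
        tsub_le_tsub_left (hrate.trans_eq (ENNReal.ofReal_eq_coe_nnreal hx).symm) 1

variable [NeZero I₁] [NeZero I₂]

theorem Design.Balanced.one_le_div (hB : D.Balanced) : (1 : ℝ) ≤ N / I₁ ∧ (1 : ℝ) ≤ N / I₂ := by
  simpa using And.intro hB.isBalancedFactor.1.one_le_card_div_card
    hB.isBalancedFactor.2.one_le_card_div_card

theorem Design.Balanced.truncatedGap_le_one (hB : D.Balanced) {l : ℝ} (hl : 0 ≤ l) :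
    truncatedGap N I₁ I₂ l ≤ 1 := by
  have h₁ := inv_le_one_of_one_le₀ hB.one_le_div.1
  have h₂ := inv_le_one_of_one_le₀ hB.one_le_div.2
  rw [truncatedGap, inv_nbar]
  exact max_le (by linarith) (by linarith)

theorem Design.Balanced.min_nbar_Taux (hB : D.Balanced)
    (hl : IsSecondEigenvalue (roundTrip D.lev₁ D.lev₂) l) :
    min (nbar N I₁ I₂ : ℝ≥0∞) D.Taux = (ENNReal.ofReal (truncatedGap N I₁ I₂ l))⁻¹ := by
  have hTaux : D.Taux = (ENNReal.ofReal (1 - l))⁻¹ := by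
    rw [Taux, relaxationTime, hB.l2Rate_auxGibbs hl, ENNReal.ofReal_sub _ l.coe_nonneg,
      ENNReal.ofReal_one, ENNReal.ofReal_coe_nnreal]
  have hnbar : (nbar N I₁ I₂ : ℝ≥0∞) = (ENNReal.ofReal (nbar N I₁ I₂ : ℝ)⁻¹)⁻¹ := by
    rw [ENNReal.ofReal_inv_of_pos (NNReal.coe_pos.2 nbar_pos), inv_inv, ENNReal.ofReal_coe_nnreal]
  have hanti : Antitone fun x : ℝ => (ENNReal.ofReal x)⁻¹ := fun _ _ h =>
    ENNReal.inv_le_inv.2 (ENNReal.ofReal_le_ofReal h)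
  rw [hTaux, hnbar, truncatedGap, hanti.map_max]

end Gap

/-- The constant, depending only on the precisions, of the lower bound for the relaxation time. -/
def lowerConst (γ : Precisions) : ℝ≥0 := (2 * (γ.τ₁ / γ.τ + γ.τ₂ / γ.τ) + 1)⁻¹

/-- The precision `τ τ₁ / (τ + τ₁)` that one observation carries about the global effect once the
effects of the first factor are integrated out. -/
def singlePrecision (γ : Precisions) : ℝ≥0 := γ.τ₁ * γ.τ / (γ.τ + γ.τ₁)

/-- The constant, depending only on the precisions, of the upper bound for the relaxation time. The
three terms control the two shrinkage factors and the contraction of constant effects. -/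
def upperConst (γ : Precisions) : ℝ≥0 :=
  (min (min (γ.τ₁ / (γ.τ + γ.τ₁)) (γ.τ₂ / (γ.τ + γ.τ₂)))
    (singlePrecision γ / (1 + singlePrecision γ)))⁻¹

section RelaxationTime

variable {N I₁ I₂ : ℕ} [NeZero N] [NeZero I₁] [NeZero I₂] {D : Design N I₁ I₂} {γ : Precisions}
  {μpr : ℝ} {τpr : ℝ≥0} {y : Fin N → ℝ} {l : ℝ≥0}

theorem lowerConst_pos (γ : Precisions) : 0 < lowerConst γ := by
  unfold lowerConst
  positivity

theorem upperConst_pos (hτ : 0 < γ.τ) (hτ₁ : 0 < γ.τ₁) (hτ₂ : 0 < γ.τ₂) : 0 < upperConst γ := by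
  unfold upperConst singlePrecision
  positivity

theorem Design.Balanced.lowerConst_mul_le (hB : D.Balanced) (hτ : 0 < γ.τ) (hl : l ≤ 1) :
    lowerConst γ * (1 - D.centeredFactor γ * l) ≤ truncatedGap N I₁ I₂ l := by
  obtain ⟨hn₁, hn₂⟩ := hB.one_le_div
  have hn₁' := zero_lt_one.trans_le hn₁
  have hn₂' := zero_lt_one.trans_le hn₂
  have hgap := one_sub_mul_mul_le
    (shrinkage_mem_Icc hn₁'.le γ.τ.coe_nonneg γ.τ₁.coe_nonneg)
    (shrinkage_mem_Icc hn₂'.le γ.τ.coe_nonneg γ.τ₂.coe_nonneg) (NNReal.coe_le_one.2 hl)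
  have hx₁ := one_sub_shrinkage_le hn₁' (NNReal.coe_pos.2 hτ) γ.τ₁.coe_nonneg
  have hx₂ := one_sub_shrinkage_le hn₂' (NNReal.coe_pos.2 hτ) γ.τ₂.coe_nonneg
  have hq : (nbar N I₁ I₂ : ℝ)⁻¹ ≤ truncatedGap N I₁ I₂ l := le_max_left _ _
  have hql : 1 - (l : ℝ) ≤ truncatedGap N I₁ I₂ l := le_max_right _ _
  rw [inv_nbar] at hq
  set q := truncatedGap N I₁ I₂ l
  have hq₁ : ((N : ℝ) / I₁)⁻¹ ≤ 2 * q := by linarith [inv_pos.2 hn₂']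
  have hq₂ : ((N : ℝ) / I₂)⁻¹ ≤ 2 * q := by linarith [inv_pos.2 hn₁']
  rw [lowerConst, NNReal.coe_inv, inv_mul_le_iff₀ (by positivity)]
  push_cast
  calc 1 - D.centeredFactor γ * l
      ≤ γ.τ₁ / γ.τ * ((N : ℝ) / I₁)⁻¹ + γ.τ₂ / γ.τ * ((N : ℝ) / I₂)⁻¹ + (1 - l) :=
        hgap.trans (by gcongr)
    _ ≤ γ.τ₁ / γ.τ * (2 * q) + γ.τ₂ / γ.τ * (2 * q) + q := by gcongr
    _ = (2 * (γ.τ₁ / γ.τ + γ.τ₂ / γ.τ) + 1) * q := by ring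

theorem Design.Balanced.mul_truncatedGap_le (hB : D.Balanced) (hτ : 0 < γ.τ) (hl : l ≤ 1) {b : ℝ}
    (hb₀ : 0 ≤ b) (hb₁ : b ≤ γ.τ₁ / (γ.τ + γ.τ₁)) (hb₂ : b ≤ γ.τ₂ / (γ.τ + γ.τ₂)) :
    b * truncatedGap N I₁ I₂ l ≤ 1 - D.centeredFactor γ * l := by
  obtain ⟨hn₁, hn₂⟩ := hB.one_le_div
  have hn₁' := zero_lt_one.trans_le hn₁
  have hn₂' := zero_lt_one.trans_le hn₂
  have hgap := max_one_sub_le_one_sub_mul_mul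
    (shrinkage_mem_Icc hn₁'.le γ.τ.coe_nonneg γ.τ₁.coe_nonneg)
    (shrinkage_mem_Icc hn₂'.le γ.τ.coe_nonneg γ.τ₂.coe_nonneg)
    ⟨l.coe_nonneg, NNReal.coe_le_one.2 hl⟩
  have hx₁ : b * ((N : ℝ) / I₁)⁻¹ ≤ 1 - shrinkage (N / I₁) γ.τ γ.τ₁ :=
    (by gcongr : b * ((N : ℝ) / I₁)⁻¹ ≤ γ.τ₁ / (γ.τ + γ.τ₁) * ((N : ℝ) / I₁)⁻¹).trans
      (le_one_sub_shrinkage hn₁ (NNReal.coe_pos.2 hτ) γ.τ₁.coe_nonneg)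
  have hx₂ : b * ((N : ℝ) / I₂)⁻¹ ≤ 1 - shrinkage (N / I₂) γ.τ γ.τ₂ :=
    (by gcongr : b * ((N : ℝ) / I₂)⁻¹ ≤ γ.τ₂ / (γ.τ + γ.τ₂) * ((N : ℝ) / I₂)⁻¹).trans
      (le_one_sub_shrinkage hn₂ (NNReal.coe_pos.2 hτ) γ.τ₂.coe_nonneg)
  have hb : b ≤ 1 := hb₁.trans
    (div_le_one_of_le₀ (le_add_of_nonneg_left γ.τ.coe_nonneg) (by positivity))
  refine le_trans ?_ hgap
  rw [truncatedGap, mul_max_of_nonneg _ _ hb₀, inv_nbar]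
  exact max_le_max (by linarith)
    (mul_le_of_le_one_left (sub_nonneg.2 (NNReal.coe_le_one.2 hl)) hb)

theorem Design.Balanced.constFactor_le (hB : D.Balanced) (hτ : 0 < γ.τ) (hτ₁ : 0 < γ.τ₁) :
    D.constFactor γ τpr ≤ τpr / (τpr + singlePrecision γ) := by
  obtain ⟨hn₁, hn₂⟩ := hB.one_le_div
  have hn₁' := zero_le_one.trans hn₁
  have hn₂' := zero_le_one.trans hn₂
  have hN : (0 : ℝ) ≤ N := Nat.cast_nonneg N
  have hshrink : D.centeredFactor γ ≤ 1 := by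
    obtain ⟨-, hx₁⟩ := shrinkage_mem_Icc hn₁' γ.τ.coe_nonneg γ.τ₁.coe_nonneg
    obtain ⟨hx₂, hx₂'⟩ := shrinkage_mem_Icc hn₂' γ.τ.coe_nonneg γ.τ₂.coe_nonneg
    exact mul_le_one₀ hx₁ hx₂ hx₂'
  have hp₁ := priorShare_nonneg hN hn₁' γ.τ.coe_nonneg γ.τ₁.coe_nonneg τpr.coe_nonneg
  have hp₂ := priorShare_nonneg hN hn₂' γ.τ.coe_nonneg γ.τ₂.coe_nonneg τpr.coe_nonneg
  have hp₂' := priorShare_le_one hN hn₂' γ.τ.coe_nonneg γ.τ₂.coe_nonneg τpr.coe_nonneg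
  calc D.constFactor γ τpr
      ≤ priorShare N (N / I₁) γ.τ γ.τ₁ τpr * priorShare N (N / I₂) γ.τ γ.τ₂ τpr :=
        mul_le_of_le_one_left (mul_nonneg hp₁ hp₂) hshrink
    _ ≤ priorShare N (N / I₁) γ.τ γ.τ₁ τpr := mul_le_of_le_one_right hp₁ hp₂'
    _ ≤ τpr / (τpr + γ.τ₁ * γ.τ / (γ.τ + γ.τ₁)) :=
        priorShare_le hn₁ (div_le_self hN (by exact_mod_cast NeZero.pos I₁))
          (NNReal.coe_pos.2 hτ) (NNReal.coe_pos.2 hτ₁) τpr.coe_nonneg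
    _ = τpr / (τpr + singlePrecision γ) := by simp only [singlePrecision, NNReal.coe_div,
        NNReal.coe_mul, NNReal.coe_add]

theorem Design.Balanced.le_one_sub_constFactor (hB : D.Balanced) (hτ : 0 < γ.τ)
    (hτ₁ : 0 < γ.τ₁) :
    (singlePrecision γ / (1 + singlePrecision γ) : ℝ) / (1 + τpr) ≤ 1 - D.constFactor γ τpr := by
  have hδ : (0 : ℝ) < singlePrecision γ := by
    rw [NNReal.coe_pos, singlePrecision]
    positivity
  have := τpr.coe_nonneg
  calc (singlePrecision γ / (1 + singlePrecision γ) : ℝ) / (1 + τpr)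
      ≤ singlePrecision γ / (τpr + singlePrecision γ) := by
        rw [div_div]
        gcongr
        nlinarith
    _ = 1 - τpr / (τpr + singlePrecision γ) := by
        rw [one_sub_div (by positivity), add_sub_cancel_left]
    _ ≤ 1 - D.constFactor γ τpr := sub_le_sub_left (hB.constFactor_le hτ hτ₁) 1

theorem Design.Balanced.lowerConst_mul_min_le_Tcgs (hB : D.Balanced) (hτ : 0 < γ.τ)
    (hτ₁ : 0 < γ.τ₁) (hτ₂ : 0 < γ.τ₂) :
    lowerConst γ * min (nbar N I₁ I₂ : ℝ≥0∞) D.Taux ≤ D.Tcgs γ μpr τpr y := by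
  obtain ⟨l, hl1, hl⟩ :=
    hB.isBalancedFactor.1.exists_isSecondEigenvalue hB.isBalancedFactor.2
  refine le_trans ?_ (hB.le_Tcgs hτ hτ₁ hτ₂ hl)
  rw [hB.min_nbar_Taux hl, ENNReal.le_inv_iff_mul_le, mul_right_comm, ← div_eq_mul_inv,
    ← ENNReal.ofReal_coe_nnreal (p := lowerConst γ),
    ← ENNReal.ofReal_mul (lowerConst γ).coe_nonneg]
  exact ENNReal.div_le_of_le_mul
    ((ENNReal.ofReal_le_ofReal (hB.lowerConst_mul_le hτ hl1)).trans_eq (one_mul _).symm)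

theorem Design.Balanced.Tcgs_le_upperConst_mul_min (hB : D.Balanced) (hτ : 0 < γ.τ)
    (hτ₁ : 0 < γ.τ₁) (hτ₂ : 0 < γ.τ₂) :
    D.Tcgs γ μpr τpr y
      ≤ upperConst γ * (1 + τpr) * min (nbar N I₁ I₂ : ℝ≥0∞) D.Taux := by
  obtain ⟨l, hl1, hl⟩ :=
    hB.isBalancedFactor.1.exists_isSecondEigenvalue hB.isBalancedFactor.2
  have hq₁ : truncatedGap N I₁ I₂ l ≤ 1 := hB.truncatedGap_le_one l.coe_nonneg
  have hq₀ : 0 ≤ truncatedGap N I₁ I₂ l := truncatedGap_nonneg _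
  rw [hB.min_nbar_Taux hl]
  set q := truncatedGap N I₁ I₂ l
  obtain ⟨⟨hu₁, hu₂⟩, hδ⟩ : ((upperConst γ : ℝ)⁻¹ ≤ γ.τ₁ / (γ.τ + γ.τ₁)
      ∧ (upperConst γ : ℝ)⁻¹ ≤ γ.τ₂ / (γ.τ + γ.τ₂))
      ∧ (upperConst γ : ℝ)⁻¹ ≤ singlePrecision γ / (1 + singlePrecision γ) := by
    rw [← le_min_iff, ← le_min_iff, upperConst, NNReal.coe_inv, inv_inv]
    push_cast
    rfl
  have hp : 0 < upperConst γ * (1 + τpr) := mul_pos (upperConst_pos hτ hτ₁ hτ₂) (by positivity)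
  calc D.Tcgs γ μpr τpr y ≤ (ENNReal.ofReal ((upperConst γ : ℝ)⁻¹ * q / (1 + τpr)))⁻¹ := by
        refine hB.Tcgs_le hτ hτ₁ hτ₂ hl ?_ ?_
        · exact (div_le_self (by positivity) (le_add_of_nonneg_right τpr.coe_nonneg)).trans
            (hB.mul_truncatedGap_le hτ hl1 (by positivity) hu₁ hu₂)
        · refine le_trans ?_ (hB.le_one_sub_constFactor hτ hτ₁)
          gcongr
          exact (mul_le_of_le_one_right (by positivity) hq₁).trans hδ
    _ = (ENNReal.ofReal (q / (upperConst γ * (1 + τpr) : ℝ≥0)))⁻¹ := by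
        rw [inv_mul_eq_div, div_div, NNReal.coe_mul, NNReal.coe_add, NNReal.coe_one]
    _ = upperConst γ * (1 + τpr) * (ENNReal.ofReal q)⁻¹ := by
        rw [ENNReal.ofReal_div_of_pos (NNReal.coe_pos.2 hp), ENNReal.ofReal_coe_nnreal,
          ENNReal.inv_div (.inl ENNReal.coe_ne_top) (.inl (ENNReal.coe_ne_zero.2 hp.ne')),
          div_eq_mul_inv, ENNReal.coe_mul, ENNReal.coe_add, ENNReal.coe_one]

end RelaxationTime

end CrossedEffects

end

open CrossedEffects

theorem mainTheorem1 (γ : Precisions) (hτ : 0 < γ.τ) (hτ₁ : 0 < γ.τ₁) (hτ₂ : 0 < γ.τ₂) :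
    ∃ c C : ℝ≥0, 0 < c ∧ 0 < C ∧
      ∀ (N I₁ I₂ : ℕ) [NeZero N] [NeZero I₁] [NeZero I₂] (D : Design N I₁ I₂), D.Balanced →
      ∀ (μpr : ℝ) (τpr : ℝ≥0) (y : Fin N → ℝ),
        -- the posterior is a probability measure, and the program samples the updates exactly
        IsProbabilityMeasure (D.posterior γ μpr τpr y) ∧
        (∀ᵐ θ ∂(D.posterior γ μpr τpr y),
          D.iterationLaw γ μpr τpr y θ = D.collapsedGibbs γ μpr τpr y θ) ∧
        -- relaxation time
        c * min (nbar N I₁ I₂ : ℝ≥0∞) D.Taux ≤ D.Tcgs γ μpr τpr y ∧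
        D.Tcgs γ μpr τpr y ≤ C * (1 + τpr) * min (nbar N I₁ I₂ : ℝ≥0∞) D.Taux ∧
        -- cost
        c * ((2 * N + (I₁ + I₂)) * min (nbar N I₁ I₂ : ℝ≥0∞) D.Taux) ≤
          D.costGibbs γ μpr τpr y ∧
        D.costGibbs γ μpr τpr y ≤
          C * (1 + τpr) * ((2 * N + (I₁ + I₂)) * min (nbar N I₁ I₂ : ℝ≥0∞) D.Taux) := by
  refine ⟨lowerConst γ, 20 * upperConst γ, lowerConst_pos γ,
    mul_pos (by norm_num) (upperConst_pos hτ hτ₁ hτ₂), ?_⟩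
  intro N I₁ I₂ _ _ _ D hB μpr τpr y
  have hexact := (D.collapsedGibbs_ae_eq_iterateKernel μpr τpr y hτ hτ₁ hτ₂).mono fun θ hθ =>
    (D.iterationLaw_eq_iterateKernel γ μpr τpr y θ).trans hθ.symm
  have hlower := hB.lowerConst_mul_min_le_Tcgs (μpr := μpr) (τpr := τpr) (y := y) hτ hτ₁ hτ₂
  have hupper := hB.Tcgs_le_upperConst_mul_min (μpr := μpr) (τpr := τpr) (y := y) hτ hτ₁ hτ₂
  have hsteps := D.le_steps_iteration γ μpr τpr
  have hsteps' := D.steps_iteration_le γ μpr τpr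
  push_cast
  refine ⟨D.isProbabilityMeasure_posterior μpr τpr y hτ, hexact, hlower, ?_, ?_, ?_⟩
  · refine hupper.trans ?_
    gcongr
    exact le_mul_of_one_le_left zero_le (by norm_num)
  · rw [mul_left_comm]
    exact mul_le_mul' hsteps hlower
  · refine (mul_le_mul' hsteps' hupper).trans_eq ?_
    ring
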